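/- **Notation.** A binary cubic form $av^3+bv^2w+cvw^2+dw^3$ is written $(a,b,c,d)$, a binary quadratic form $bv^2+cvw+dw^2$ is written $(b,c,d)$, and $g\in \mathrm{GL}_2$ acts on both by $(g\cdot x)(v,w)=x((v,w)g)$. Put $G^+=\{g\in\mathrm{GL}_2(\mathbb R):\det g>0\}$, $\Gamma=\mathrm{SL}_2(\mathbb Z)$, $d_\lambda=\lambda I$, $a_t=\mathrm{diag}(t,1/t)$, $n_u=\begin{pmatrix}1&0\\u&1\end{pmatrix}$, $k_\theta=\begin{pmatrix}\cos2\pi\theta&\sin2\pi\theta\\-\sin2\pi\theta&\cos2\pi\theta\end{pmatrix}$. Let $B^+=\{d_\lambda a_tn_u:\lambda,t>0,u\in\mathbb R\}$ with Haar measure $dg=\frac{d\lambda}{\lambda}\frac{dt}{t^3}du$, let $B^+_{\mathbb Z}=\{n_m:m\in\mathbb Z\}$, and give $G^+=\{d_\lambda k_\theta a_tn_u:\lambda,t>0,\ \theta\in\mathbb R/\mathbb Z,\ u\in\mathbb R\}$ the Haar measure $dg=\frac{d\lambda}{\lambda}d\theta\frac{dt}{t^3}du$. Write $t(g),u(g)$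 for the coordinates $t,u$ of $g=d_\lambda k_\theta a_tn_u$. Let $z\neq0$ be purely imaginary, let $\xi(z)=\pi^{-z/2}\Gamma(z/2)\zeta(z)$, and let $K_\nu$ be the $K$-Bessel function. With $t=t(g)$, $u=u(g)$, let $$E^c(z,g)=t^{1+z}+\frac{\xi(z)}{\xi(1+z)}t^{1-z},\qquad E(z,g)=E^c(z,g)+\frac{4t}{\xi(1+z)}\sum_{m\ge1}\eta_{z/2}(m)K_{z/2}(2\pi mt^2)\cos(2\pi mu),$$ $\eta_\nu(m)=\sum_{ab=m}(a/b)^\nu$, be the real analytic Eisenstein series (right $\Gamma$-invariant and left invariant under rotations) and its constant term. An integral cubic form is non-maximal at a prime $p$ if $p$ divides all its coefficients, or if it is $\mathrm{GL}_2(\mathbb Z)$-equivalent to a form with $p^2\mid a$ and $p\mid b$. For squarefree $q\geq 1$ let $\mathcal N_q$ be the indicator function of the integral forms that are non-maximal at all primes $p\mid q$, and let $\mathcal N_q^r(b,c,d)=\mathcal N_q(0,b,c,d)$. Let $x_+=108^{-1/4}(0,3,0,-1)$ and $x_-=2^{-1/2}(0,1,0,1)$, forms of discriminant $\pm1$, let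 $f_D\in C_c^\infty((0,\infty))$ have Mellin transform $\tilde f_D(s)=\int_0^\infty f_D(x)x^{s-1}dx$, and let $f_G(g)=\exp(-\operatorname{tr}(g^tg)/\det g)$ on $G^+$. Let $f_\pm$ be the function on real binary cubic forms with $f_\pm(g\cdot x_\pm)=f_G(g)f_D((\det g)^6)$ for $g\in G^+$ and $f_\pm=0$ off $G^+\cdot x_\pm$, and let $f_{\pm,0}(b,c,d)=f_\pm(0,b,c,d)$. For either sign define $$Z_{1,c,q}^{\pm,r}(s)=\frac12\int_{B^+/B^+_{\mathbb Z}}(\det g)^{6s}E^c(z,g)\sum_{x=(0,b,c,d)\in\mathbb Z^4}\mathcal N_q(x)f_\pm(g\cdot x)\,dg,$$ $$Z_{q,r}(f,s_1,s_2)=\int_{B^+/B^+_{\mathbb Z}}g_{11}^{2s_1}(\det g)^{2s_2}\sum_{x\in\mathbb Z^3}\mathcal N_q^r(x)f(g\cdot x)\,dg,$$ $$Z_q^\pm(s)=\int_{G^+/\Gamma}(\det g)^{6s}E(z,g)\sum_{x\in\mathbb Z^4}\mathcal N_q(x)f_\pm(g\cdot x)\,dg .$$ **Lemma.** The integrals $Z_{1,c,q}^{\pm,r}(s)$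 and $Z_q^\pm(s)$ converge absolutely for $\operatorname{Re}(s)>\frac54$, and $Z_{q,r}(f_{\pm,0},s_1,s_2)$ converges absolutely for $\operatorname{Re}(s_1)>2$, $\operatorname{Re}(s_2)>1$. The function $Z_{1,c,q}^{\pm,r}$ continues meromorphically to $\operatorname{Re}(s)>\frac34$ and is holomorphic there apart from (at most) simple poles at $s=\frac{5+z}4$ and $s=\frac{5-z}4$. Put $\kappa_-(w)=1$ and $\kappa_+(w)=3^{(1+w)/4}$. The residues are $$\frac1{12}\zeta(3+z)\,2^{\frac{-3-z}2}\kappa_\pm(z)\prod_{p\mid q}\left(\frac1{p^2}+\frac1{p^{3+z}}-\frac1{p^{5+z}}\right)\tilde f_D\left(\tfrac{5+z}4\right)\sqrt\pi K_{z/2}(2)\quad\text{at } s=\tfrac{5+z}4,$$ $$\frac{\xi(z)}{\xi(1+z)}\frac1{12}\zeta(3-z)\,2^{\frac{-3+z}2}\kappa_\pm(-z)\prod_{p\mid q}\left(\frac1{p^2}+\frac1{p^{3-z}}-\frac1{p^{5-z}}\right)\tilde f_D\left(\tfrac{5-z}4\right)\sqrt\pi K_{z/2}(2)\quad\text{at }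 s=\tfrac{5-z}4 .$$ If $K_{z/2}(2)\ne0$ and $\tilde f_D(\frac{5+z}4)\neq0$ (respectively $\tilde f_D(\frac{5-z}4)\ne0$), the pole at $\frac{5+z}4$ (respectively $\frac{5-z}4$) is a genuine simple pole. The function $Z_{q,r}(f_{\pm,0},s_1,s_2)$ continues meromorphically to $\operatorname{Re}(s_1)>2$, $\operatorname{Re}(s_2)>\frac12$, where $(s_2-1)Z_{q,r}(f_{\pm,0},s_1,s_2)$ is holomorphic, and throughout $\operatorname{Re}(s)>\frac34$, off the two points above, $$Z_{1,c,q}^{\pm,r}(s)=\frac13\left(Z_{q,r}\left(f_{\pm,0},2s+\tfrac12+\tfrac z2,s-\tfrac14-\tfrac z4\right)+\frac{\xi(z)}{\xi(1+z)}Z_{q,r}\left(f_{\pm,0},2s+\tfrac12-\tfrac z2,s-\tfrac14+\tfrac z4\right)\right).$$ Finally, these poles match and cancel those of the orbital zeta function of all forms: $Z_q^\pm$ continues meromorphically to $\operatorname{Re}(s)>1$, is holomorphic there apart from at most simple poles at $\frac{5\pm z}4$, its residues at these two points are the same as those of $Z_{1,c,q}^{\pm,r}$, and $Z_q^\pm-Z_{1,c,q}^{\pm,r}$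 extends to a holomorphic function on $\operatorname{Re}(s)>1$. -/

import Mathlib

open Set Filter Topology MeasureTheory

open scoped ContDiff

noncomputable section

namespace ReducibleZeta

/-! ### Binary cubic and quadratic forms -/

/-- The form `a v^3 + b v^2 w + c v w^2 + d w^3` is the vector `(a, b, c, d)`. The matrix `g` acts by
`(g · x)(v, w) = x((v, w) g)`. -/
def cubicAct {R : Type*} [CommRing R] (g : Matrix (Fin 2) (Fin 2) R) (x : Fin 4 → R) : Fin 4 → R :=
  ![x 0 * g 0 0 ^ 3 + x 1 * g 0 0 ^ 2 * g 0 1 + x 2 * g 0 0 * g 0 1 ^ 2 + x 3 * g 0 1 ^ 3,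
    3 * x 0 * g 0 0 ^ 2 * g 1 0 + x 1 * (2 * g 0 0 * g 1 0 * g 0 1 + g 0 0 ^ 2 * g 1 1)
      + x 2 * (g 1 0 * g 0 1 ^ 2 + 2 * g 0 0 * g 0 1 * g 1 1) + 3 * x 3 * g 0 1 ^ 2 * g 1 1,
    3 * x 0 * g 0 0 * g 1 0 ^ 2 + x 1 * (g 1 0 ^ 2 * g 0 1 + 2 * g 0 0 * g 1 0 * g 1 1)
      + x 2 * (2 * g 1 0 * g 0 1 * g 1 1 + g 0 0 * g 1 1 ^ 2) + 3 * x 3 * g 0 1 * g 1 1 ^ 2,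
    x 0 * g 1 0 ^ 3 + x 1 * g 1 0 ^ 2 * g 1 1 + x 2 * g 1 0 * g 1 1 ^ 2 + x 3 * g 1 1 ^ 3]

/-- The value of a binary cubic form. -/
def cubicEval {R : Type*} [CommRing R] (x : Fin 4 → R) (v w : R) : R :=
  x 0 * v ^ 3 + x 1 * v ^ 2 * w + x 2 * v * w ^ 2 + x 3 * w ^ 3

theorem cubicEval_cubicAct {R : Type*} [CommRing R] (g : Matrix (Fin 2) (Fin 2) R) (x : Fin 4 → R)
    (v w : R) : cubicEval (cubicAct g x) v w
      = cubicEval x (v * g 0 0 + w * g 1 0) (v * g 0 1 + w * g 1 1) := by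
  simp only [cubicEval, cubicAct, Matrix.cons_val]
  ring

/-- The form `a v^2 + b v w + c w^2` is the vector `(a, b, c)`. The matrix `g` acts by
`(g · x)(v, w) = x((v, w) g)`, that is `Q ↦ g Q gᵀ` on symmetric matrices. -/
def quadAct {R : Type*} [CommRing R] (g : Matrix (Fin 2) (Fin 2) R) (x : Fin 3 → R) : Fin 3 → R :=
  ![x 0 * g 0 0 ^ 2 + x 1 * g 0 0 * g 0 1 + x 2 * g 0 1 ^ 2,
    2 * x 0 * g 0 0 * g 1 0 + x 1 * (g 0 0 * g 1 1 + g 0 1 * g 1 0) + 2 * x 2 * g 0 1 * g 1 1,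
    x 0 * g 1 0 ^ 2 + x 1 * g 1 0 * g 1 1 + x 2 * g 1 1 ^ 2]

/-- The integral cubic form `x` is non-maximal at the prime `p`: all its coefficients are divisible by
`p`, or it is `GL₂(ℤ)`-equivalent to a form with `p² ∣ a` and `p ∣ b`. -/
def NonMaximalAt (p : ℕ) (x : Fin 4 → ℤ) : Prop :=
  (∀ i, (p : ℤ) ∣ x i) ∨
    ∃ g : Matrix.GeneralLinearGroup (Fin 2) ℤ,
      (p : ℤ) ^ 2 ∣ cubicAct g.val x 0 ∧ (p : ℤ) ∣ cubicAct g.val x 1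

open Classical in
/-- The indicator function of forms that are non-maximal at every prime dividing `q`. -/
def nonMaxInd (q : ℕ) (x : Fin 4 → ℤ) : ℂ :=
  ∏ p ∈ q.primeFactors, if NonMaximalAt p x then 1 else 0

/-- The binary quadratic form `(b, c, d)` as the reducible cubic form
`(0, b, c, d) = w (b v^2 + c v w + d w^2)`. -/
def reducibleForm {R : Type*} [CommRing R] (x : Fin 3 → R) : Fin 4 → R :=
  ![0, x 0, x 1, x 2]

/-- The function `nonMaxInd q` on reducible cubic forms, as a function of binary quadratic forms. -/
def nonMaxIndRed (q : ℕ) (x : Fin 3 → ℤ) : ℂ :=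
  nonMaxInd q (reducibleForm x)

/-- A coefficient vector with integer entries, as a real vector. -/
def toReal {n : ℕ} (x : Fin n → ℤ) : Fin n → ℝ := fun i => (x i : ℝ)

/-! ### Matrices -/

/-- The scalar matrix `d_l`. -/
def dMat (l : ℝ) : Matrix (Fin 2) (Fin 2) ℝ := !![l, 0; 0, l]

/-- The diagonal matrix `a_t`. -/
def aMat (t : ℝ) : Matrix (Fin 2) (Fin 2) ℝ := !![t, 0; 0, 1 / t]

/-- The lower triangular unipotent matrix `n_u`. -/
def nMat (u : ℝ) : Matrix (Fin 2) (Fin 2) ℝ := !![1, 0; u, 1]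

/-- The rotation `k_θ`, with `θ` modulo `1`. -/
def kMat (θ : ℝ) : Matrix (Fin 2) (Fin 2) ℝ :=
  !![Real.cos (2 * Real.pi * θ), Real.sin (2 * Real.pi * θ);
    -Real.sin (2 * Real.pi * θ), Real.cos (2 * Real.pi * θ)]

/-- The character `χ(g) = (det g)^6`, by which the discriminant of a cubic form scales. -/
def chiCubic (g : Matrix (Fin 2) (Fin 2) ℝ) : ℝ := g.det ^ 6

/-- The character `χ(g) = (det g)^2`, by which the discriminant of a quadratic form scales. -/
def chiQuad (g : Matrix (Fin 2) (Fin 2) ℝ) : ℝ := g.det ^ 2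

/-- The character `χ₁(g) = g₁₁^2` of the lower triangular group, by which the first coefficient of a
quadratic form scales. -/
def chiOne (g : Matrix (Fin 2) (Fin 2) ℝ) : ℝ := g 0 0 ^ 2

/-! ### The test functions -/

/-- The sign of the discriminant. -/
inductive DiscSign
  | pos
  | neg

/-- The base points `x_+` (discriminant `1`) and `x_-` (discriminant `-1`). -/
def basePoint : DiscSign → Fin 4 → ℝ
  | .pos => ![0, 3 / (108 : ℝ) ^ (1 / 4 : ℝ), 0, -1 / (108 : ℝ) ^ (1 / 4 : ℝ)]
  | .neg => ![0, 1 / √2, 0, 1 / √2]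

/-- `exp (-tr gᵀ g)` on `SL₂(ℝ)`, extended to positive determinant independently of the
determinant. -/
def fG (g : Matrix (Fin 2) (Fin 2) ℝ) : ℝ := Real.exp (-((g.transpose * g).trace / g.det))

open Classical in
/-- The test function on real binary cubic forms which is `f_±(g · x_±) = f_G(g) f_D(χ(g))` for
`det g > 0`, and zero off the orbit of `x_±`. -/
def testFun (ε : DiscSign) (fD : ℝ → ℂ) (x : Fin 4 → ℝ) : ℂ :=
  if h : ∃ g : Matrix (Fin 2) (Fin 2) ℝ, 0 < g.det ∧ cubicAct g (basePoint ε) = x then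
    (fG h.choose : ℂ) * fD (chiCubic h.choose)
  else 0

theorem cubicAct_mul {R : Type*} [CommRing R] (g h : Matrix (Fin 2) (Fin 2) R) (x : Fin 4 → R) :
    cubicAct (g * h) x = cubicAct g (cubicAct h x) := by
  funext i
  fin_cases i <;> simp [cubicAct, Matrix.mul_apply, Fin.sum_univ_two] <;> ring

theorem cubicAct_one {R : Type*} [CommRing R] (x : Fin 4 → R) :
    cubicAct (1 : Matrix (Fin 2) (Fin 2) R) x = x := by
  funext i
  fin_cases i <;> simp [cubicAct]

theorem stab_basePoint (ε : DiscSign) {k : Matrix (Fin 2) (Fin 2) ℝ} (hk : 0 < k.det)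
    (h : cubicAct k (basePoint ε) = basePoint ε) : k * k.transpose = 1 ∧ k.det = 1 := by
  have key : k 0 0 ^ 2 + k 0 1 ^ 2 = 1 ∧ k 1 0 ^ 2 + k 1 1 ^ 2 = 1 ∧
      k 0 0 * k 1 0 + k 0 1 * k 1 1 = 0 ∧ k.det = 1 := by
    have h0 := congrFun h 0
    have h1 := congrFun h 1
    have h2 := congrFun h 2
    have h3 := congrFun h 3
    rw [Matrix.det_fin_two] at hk ⊢
    simp only [cubicAct] at h0 h1 h2 h3
    generalize k 0 0 = α at *
    generalize k 0 1 = β at *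
    generalize k 1 0 = γ at *
    generalize k 1 1 = δ at *
    cases ε
    · have hc : ((108 : ℝ) ^ (1 / 4 : ℝ)) ≠ 0 := by positivity
      simp only [basePoint, Matrix.cons_val] at h0 h1 h2 h3
      generalize ((108 : ℝ) ^ (1 / 4 : ℝ)) = C at *
      field_simp at h0 h1 h2 h3
      have e0 : β * (3 * α ^ 2 - β ^ 2) = 0 := by linarith
      have e1 : 2 * α * β * γ + α ^ 2 * δ - β ^ 2 * δ = 1 := by linarith
      have e2 : γ ^ 2 * β + 2 * α * γ * δ - β * δ ^ 2 = 0 := by linarith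
      have e3 : 3 * γ ^ 2 * δ - δ ^ 3 = -1 := by linarith
      rcases mul_eq_zero.mp e0 with hb | hb
      · subst hb
        have e1a : α ^ 2 * δ = 1 := by linarith
        have hα : α ≠ 0 := by rintro rfl; simp at e1a
        have hδ : δ ≠ 0 := by rintro rfl; simp at e1a
        have hγ : γ = 0 := by
          have : α * γ * δ = 0 := by linarith
          simpa [hα, hδ] using this
        subst hγ
        have hδ1 : δ = 1 := by
          have : (δ - 1) * (δ ^ 2 + δ + 1) = 0 := by linarith
          rcases mul_eq_zero.mp this with h | h
          · linarith
          · nlinarith [sq_nonneg (δ + 1), sq_nonneg δ]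
        subst hδ1
        have hα1 : α = 1 := by nlinarith
        subst hα1
        norm_num
      · have e1a : 2 * α * (α * δ - β * γ) = -1 := by
          have : β ^ 2 = 3 * α ^ 2 := by linarith
          rw [this] at e1; linarith
        have hα : α < 0 := by nlinarith
        obtain ⟨τ, rfl⟩ : ∃ τ, β = τ * α := ⟨β / α, (div_mul_cancel₀ β hα.ne).symm⟩
        have hτ : τ ^ 2 = 3 := by
          have : α ^ 2 * (τ ^ 2 - 3) = 0 := by linarith
          rcases mul_eq_zero.mp this with h | h
          · exact absurd h (pow_ne_zero 2 hα.ne)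
          · linarith
        have e2a : (3 * γ - τ * δ) * (γ + τ * δ) = 0 := by
          have : α * ((3 * γ - τ * δ) * (γ + τ * δ)) = 0 := by
            linear_combination τ * e2 - α * γ ^ 2 * hτ
          exact (mul_eq_zero.mp this).resolve_left hα.ne
        rcases mul_eq_zero.mp e2a with h | h
        · exfalso
          have hg : γ = τ * δ / 3 := by linarith
          subst hg
          have : 3 * (τ * δ / 3) ^ 2 * δ = δ ^ 3 := by linear_combination δ ^ 3 / 3 * hτ
          linarith
        · have hg : γ = -(τ * δ) := by linarith
          subst hg
          have hδ : δ = -1 / 2 := by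
            have h8 : 8 * δ ^ 3 = -1 := by linear_combination e3 - 3 * δ ^ 3 * hτ
            have : (2 * δ + 1) * (4 * δ ^ 2 - 2 * δ + 1) = 0 := by linear_combination h8
            rcases mul_eq_zero.mp this with h | h
            · linarith
            · nlinarith [sq_nonneg (4 * δ - 1)]
          subst hδ
          have hα1 : α = -1 / 2 := by
            have h4 : 4 * α ^ 2 = 1 := by linear_combination -e1a - α ^ 2 * hτ
            nlinarith
          subst hα1
          refine ⟨?_, ?_, ?_, ?_⟩
          · linear_combination hτ / 4
          · linear_combination hτ / 4
          · ring
          · linear_combination hτ / 4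
    · have hc : √(2 : ℝ) ≠ 0 := by positivity
      simp only [basePoint, Matrix.cons_val] at h0 h1 h2 h3
      generalize √(2 : ℝ) = C at *
      field_simp at h0 h1 h2 h3
      have e0 : β * (α ^ 2 + β ^ 2) = 0 := by linarith
      have hb : β = 0 := by
        rcases mul_eq_zero.mp e0 with hb | hb
        · exact hb
        · nlinarith [sq_nonneg α, sq_nonneg β]
      subst hb
      have e1a : α ^ 2 * δ = 1 := by linarith
      have hα : α ≠ 0 := by rintro rfl; simp at e1a
      have hδ : δ ≠ 0 := by rintro rfl; simp at e1a
      have hγ : γ = 0 := by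
        have : α * γ * δ = 0 := by linarith
        simpa [hα, hδ] using this
      subst hγ
      have hδ1 : δ = 1 := by
        have : (δ - 1) * (δ ^ 2 + δ + 1) = 0 := by linarith
        rcases mul_eq_zero.mp this with h | h
        · linarith
        · nlinarith [sq_nonneg (δ + 1), sq_nonneg δ]
      subst hδ1
      have hα1 : α = 1 := by nlinarith
      subst hα1
      norm_num
  refine ⟨?_, key.2.2.2⟩
  ext i j
  fin_cases i <;> fin_cases j <;> simp [Matrix.mul_apply, Fin.sum_univ_two] <;>
    linarith [key.1, key.2.1, key.2.2.1]

/-- The value of `testFun` on the orbit does not depend on the choice made in its definition. -/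
theorem testFun_apply (ε : DiscSign) (fD : ℝ → ℂ) {g : Matrix (Fin 2) (Fin 2) ℝ} (hg : 0 < g.det) :
    testFun ε fD (cubicAct g (basePoint ε)) = (fG g : ℂ) * fD (chiCubic g) := by
  have hex : ∃ g' : Matrix (Fin 2) (Fin 2) ℝ, 0 < g'.det ∧
      cubicAct g' (basePoint ε) = cubicAct g (basePoint ε) := ⟨g, hg, rfl⟩
  rw [testFun, dif_pos hex]
  obtain ⟨hpos, hact⟩ := hex.choose_spec
  generalize hex.choose = g' at *
  have hu : IsUnit g.det := hg.ne'.isUnit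
  have hk : g' = g * (g⁻¹ * g') := by rw [← Matrix.mul_assoc, Matrix.mul_nonsing_inv g hu, one_mul]
  have hdet : (g⁻¹ * g').det = g'.det / g.det := by
    rw [Matrix.det_mul, Matrix.det_nonsing_inv, Ring.inverse_eq_inv', div_eq_inv_mul]
  obtain ⟨hort, hone⟩ := stab_basePoint ε (k := g⁻¹ * g') (by rw [hdet]; positivity)
    (by rw [cubicAct_mul, hact, ← cubicAct_mul, Matrix.nonsing_inv_mul g hu, cubicAct_one])
  generalize g⁻¹ * g' = k at *
  have hd : g'.det = g.det := by rw [hk, Matrix.det_mul, hone, mul_one]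
  have htr : (g'.transpose * g').trace = (g.transpose * g).trace := by
    rw [Matrix.trace_mul_comm, Matrix.trace_mul_comm g.transpose, hk, Matrix.transpose_mul,
      Matrix.mul_assoc, ← Matrix.mul_assoc k, hort, one_mul]
  rw [fG, fG, chiCubic, chiCubic, hd, htr]

/-- The restriction `f_{±,0}(x) = f_±(0, x)` to reducible forms. -/
def testFunRed (ε : DiscSign) (fD : ℝ → ℂ) (x : Fin 3 → ℝ) : ℂ :=
  testFun ε fD (reducibleForm x)

/-! ### Special functions and the Eisenstein series -/

/-- The Bessel function `K_ν(x) = (1/2) ∫_0^∞ exp (-(x/2)(y + 1/y)) y^(ν-1) dy`, for `x > 0`. -/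
def besselK (ν : ℂ) (x : ℝ) : ℂ :=
  (1 / 2) * ∫ y in Ioi (0 : ℝ), (Real.exp (-(x / 2) * (y + 1 / y)) : ℂ) * (y : ℂ) ^ (ν - 1)

/-- `ξ(z) = π^(-z/2) Γ(z/2) ζ(z)`. -/
def xi (z : ℂ) : ℂ := completedRiemannZeta z

/-- `η_ν(m) = ∑_{ab = m} (a/b)^ν`. -/
def etaDiv (ν : ℂ) (m : ℕ) : ℂ :=
  ∑ ab ∈ m.divisorsAntidiagonal, (((ab.1 : ℝ) / (ab.2 : ℝ) : ℝ) : ℂ) ^ ν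

/-- The coordinate `t` of `g = d_l k_θ a_t n_u`. -/
def iwasawaT (g : Matrix (Fin 2) (Fin 2) ℝ) : ℝ :=
  √g.det / √(g 0 1 ^ 2 + g 1 1 ^ 2)

/-- The coordinate `u` of `g = d_l k_θ a_t n_u`. -/
def iwasawaU (g : Matrix (Fin 2) (Fin 2) ℝ) : ℝ :=
  (g 0 0 * g 0 1 + g 1 0 * g 1 1) / (g 0 1 ^ 2 + g 1 1 ^ 2)

theorem iwasawa_coordinates {l t : ℝ} (hl : 0 < l) (ht : 0 < t) (θ u : ℝ) :
    iwasawaT (dMat l * kMat θ * aMat t * nMat u) = t ∧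
      iwasawaU (dMat l * kMat θ * aMat t * nMat u) = u := by
  have hsc := Real.sin_sq_add_cos_sq (2 * Real.pi * θ)
  have hdet : (dMat l * kMat θ * aMat t * nMat u).det = l ^ 2 := by
    simp only [Matrix.det_mul, dMat, kMat, aMat, nMat, Matrix.det_fin_two_of]
    field_simp
    linear_combination l ^ 2 * hsc
  have hcol : (dMat l * kMat θ * aMat t * nMat u) 0 1 ^ 2
      + (dMat l * kMat θ * aMat t * nMat u) 1 1 ^ 2 = (l / t) ^ 2 := by
    simp [dMat, kMat, aMat, nMat]
    field_simp
    linear_combination hsc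
  have hin : (dMat l * kMat θ * aMat t * nMat u) 0 0 * (dMat l * kMat θ * aMat t * nMat u) 0 1
      + (dMat l * kMat θ * aMat t * nMat u) 1 0 * (dMat l * kMat θ * aMat t * nMat u) 1 1
        = u * (l / t) ^ 2 := by
    simp [dMat, kMat, aMat, nMat]
    field_simp
    linear_combination u * hsc
  refine ⟨?_, ?_⟩
  · rw [iwasawaT, hdet, hcol, Real.sqrt_sq hl.le, Real.sqrt_sq (by positivity)]
    field_simp
  · rw [iwasawaU, hcol, hin]
    field_simp

/-- The constant term `t^(1+z) + ξ(z)/ξ(1+z) t^(1-z)` of the Eisenstein series `eisenstein z g`. -/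
def eisensteinConst (z : ℂ) (g : Matrix (Fin 2) (Fin 2) ℝ) : ℂ :=
  (iwasawaT g : ℂ) ^ (1 + z) + xi z / xi (1 + z) * (iwasawaT g : ℂ) ^ (1 - z)

/-- The Eisenstein series `E(z, g)`, left invariant under rotations and right invariant under
`SL₂(ℤ)`, for `z ≠ 0` on the imaginary axis: the continuation of
`∑_{γ ∈ Γ/Γ_∞} t(gγ)^(1+z)`, given by its Fourier development. In terms of the left `SL₂(ℤ)`-invariant,
right rotation invariant series `𝓔` one has `E(z, g) = 𝓔(gᵀ) = 𝓔(g⁻¹)`. -/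
def eisenstein (z : ℂ) (g : Matrix (Fin 2) (Fin 2) ℝ) : ℂ :=
  eisensteinConst z g + 4 * (iwasawaT g : ℂ) / xi (1 + z) *
    ∑' m : ℕ, etaDiv (z / 2) (m + 1) * besselK (z / 2) (2 * Real.pi * (m + 1) * iwasawaT g ^ 2) *
      (Real.cos (2 * Real.pi * (m + 1) * iwasawaU g) : ℂ)

/-! ### Integration over the quotients -/

/-- The element `d_l a_t n_u` of the lower triangular group `B⁺`. -/
def borelElt (p : ℝ × ℝ × ℝ) : Matrix (Fin 2) (Fin 2) ℝ :=
  dMat p.1 * aMat p.2.1 * nMat p.2.2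

/-- Coordinates `(l, t, u)` of a fundamental domain of `B⁺ / B⁺_ℤ`, where `B⁺_ℤ = {n_m : m ∈ ℤ}`. -/
def borelDomain : Set (ℝ × ℝ × ℝ) := Ioi 0 ×ˢ Ioi 0 ×ˢ Ico 0 1

/-- The function `F` times the density of the Haar measure `(dl / l) (dt / t^3) du` of `B⁺`. -/
def borelIntegrand (F : Matrix (Fin 2) (Fin 2) ℝ → ℂ) (p : ℝ × ℝ × ℝ) : ℂ :=
  F (borelElt p) * ((1 / (p.1 * p.2.1 ^ 3) : ℝ) : ℂ)

/-- `∫_{B⁺ / B⁺_ℤ} F(g) dg`. -/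
def borelIntegral (F : Matrix (Fin 2) (Fin 2) ℝ → ℂ) : ℂ :=
  ∫ p in borelDomain, borelIntegrand F p

/-- Absolute convergence of `∫_{B⁺ / B⁺_ℤ} F(g) dg`. -/
def BorelIntegrable (F : Matrix (Fin 2) (Fin 2) ℝ → ℂ) : Prop :=
  IntegrableOn (borelIntegrand F) borelDomain

/-- The element `d_l k_θ a_t n_u` of `G⁺`. -/
def fullElt (p : ℝ × ℝ × ℝ × ℝ) : Matrix (Fin 2) (Fin 2) ℝ :=
  dMat p.1 * kMat p.2.1 * aMat p.2.2.1 * nMat p.2.2.2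

/-- Coordinates `(l, θ, t, u)` of a fundamental domain of `G⁺ / SL₂(ℤ)`: the point `u + i t^2` lies in
the standard fundamental domain of the upper half plane, and `θ` runs through half a period because
`SL₂(ℤ)` contains `-1`. -/
def fullDomain : Set (ℝ × ℝ × ℝ × ℝ) :=
  {p | 0 < p.1 ∧ 0 ≤ p.2.1 ∧ p.2.1 < 1 / 2 ∧ 0 < p.2.2.1 ∧
    -(1 / 2) ≤ p.2.2.2 ∧ p.2.2.2 < 1 / 2 ∧ 1 ≤ p.2.2.2 ^ 2 + p.2.2.1 ^ 4}

/-- The function `F` times the density of the Haar measure `(dl / l) dθ (dt / t^3) du` of `G⁺`. -/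
def fullIntegrand (F : Matrix (Fin 2) (Fin 2) ℝ → ℂ) (p : ℝ × ℝ × ℝ × ℝ) : ℂ :=
  F (fullElt p) * ((1 / (p.1 * p.2.2.1 ^ 3) : ℝ) : ℂ)

/-- `∫_{G⁺ / SL₂(ℤ)} F(g) dg`, for `F` right invariant under `SL₂(ℤ)`. -/
def fullIntegral (F : Matrix (Fin 2) (Fin 2) ℝ → ℂ) : ℂ :=
  ∫ p in fullDomain, fullIntegrand F p

/-- Absolute convergence of `∫_{G⁺ / SL₂(ℤ)} F(g) dg`. -/
def FullIntegrable (F : Matrix (Fin 2) (Fin 2) ℝ → ℂ) : Prop :=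
  IntegrableOn (fullIntegrand F) fullDomain

/-! ### The orbital zeta functions -/

/-- The integrand of the reducible orbital zeta function paired with the constant term. -/
def redConstKernel (ε : DiscSign) (q : ℕ) (fD : ℝ → ℂ) (z s : ℂ) (g : Matrix (Fin 2) (Fin 2) ℝ) : ℂ :=
  (chiCubic g : ℂ) ^ s * eisensteinConst z g *
    ∑' x : Fin 3 → ℤ, nonMaxInd q (reducibleForm x) *
      testFun ε fD (cubicAct g (toReal (reducibleForm x)))

/-- The reducible orbital zeta function `Z_{1,c,q}^{±,r}` paired with the constant term. -/
def redConstZeta (ε : DiscSign) (q : ℕ) (fD : ℝ → ℂ) (z s : ℂ) : ℂ :=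
  (1 / 2) * borelIntegral (redConstKernel ε q fD z s)

/-- The integrand of the zeta function of binary quadratic forms. -/
def quadKernel (q : ℕ) (f : (Fin 3 → ℝ) → ℂ) (s₁ s₂ : ℂ) (g : Matrix (Fin 2) (Fin 2) ℝ) : ℂ :=
  (chiOne g : ℂ) ^ s₁ * (chiQuad g : ℂ) ^ s₂ *
    ∑' x : Fin 3 → ℤ, nonMaxIndRed q x * f (quadAct g (toReal x))

/-- The orbital zeta function `Z_{q,r}(f, s₁, s₂)` of binary quadratic forms under the lower triangular
group. -/
def quadZeta (q : ℕ) (f : (Fin 3 → ℝ) → ℂ) (s₁ s₂ : ℂ) : ℂ :=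
  borelIntegral (quadKernel q f s₁ s₂)

/-- The integrand of the orbital zeta function of all binary cubic forms. -/
def fullKernel (ε : DiscSign) (q : ℕ) (fD : ℝ → ℂ) (z s : ℂ) (g : Matrix (Fin 2) (Fin 2) ℝ) : ℂ :=
  (chiCubic g : ℂ) ^ s * eisenstein z g *
    ∑' x : Fin 4 → ℤ, nonMaxInd q x * testFun ε fD (cubicAct g (toReal x))

/-- The orbital zeta function `Z_q^±` of all binary cubic forms paired with the Eisenstein series. -/
def fullZeta (ε : DiscSign) (q : ℕ) (fD : ℝ → ℂ) (z s : ℂ) : ℂ :=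
  fullIntegral (fullKernel ε q fD z s)

/-! ### The residues -/

/-- The factor `1` for negative and `3^((1+w)/4)` for positive discriminant. -/
def signFactor : DiscSign → ℂ → ℂ
  | .pos, w => (3 : ℂ) ^ ((1 + w) / 4)
  | .neg, _ => 1

/-- The part of the residue at `(5+w)/4` which depends on `w = ± z`. -/
def residueFactor (ε : DiscSign) (q : ℕ) (fD : ℝ → ℂ) (w : ℂ) : ℂ :=
  1 / 12 * riemannZeta (3 + w) * (2 : ℂ) ^ ((-3 - w) / 2) * signFactor ε w *
    (∏ p ∈ q.primeFactors,
      (1 / (p : ℂ) ^ 2 + 1 / (p : ℂ) ^ (3 + w) - 1 / (p : ℂ) ^ (5 + w))) *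
    mellin fD ((5 + w) / 4)

end ReducibleZeta

end

open ReducibleZeta

/-!
The reducible zeta functions can be computed explicitly by unfolding, and the zeta function of all
forms differs from the reducible one by an integral which converges absolutely for `Re s > 1`.

Unfolding. A reducible form `(0, b, c, d)` contributes only if `b ≠ 0` and `D = c² - 4bd` has the
right sign; its discriminant is `b² D`. The translations `n_m` shift `c` by `2bm`, so the orbits
are enumerated by `b`, by `c` modulo `2b`, and by `|D|`, which runs through the positive terms of
an arithmetic progression (`exists_formOf`, `formOf_injective`). The integral of one orbit runs
over all of `B⁺` and separates into a Mellin transform, a Gaussian integral and a Bessel integral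
(`integral_orbitTerm`). It is the product of a factor independent of the form and of
`|b|^(-s₁) |D|^(-s₂)`. Therefore `Z_{q,r}(f_{±,0}, s₁, s₂)` is an elementary factor times the Dirichlet
series `∑ 𝒩_q(x) |b|^(-s₁) |D|^(-s₂)`, and the reducible zeta function with the constant term of
the Eisenstein series is a combination of two specializations of it, one for each of the powers
`t^(1 + z)` and `t^(1 - z)`.

Continuation and residue. Non-maximality of `(0, b, c, d)` at `p` depends on `d` modulo `p²` only,
so the Dirichlet series is a sum over classes modulo `q²`, each a series over an arithmetic
progression. Comparison with an integral continues such a series past its pole at `s₂ = 1`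
(`progZeta`), with a bound (`norm_progTerm_le`) uniform enough to sum over all classes when
`Re s₁ > 2` and `Re s₂ > 1/2` (`differentiableOn_formSeries`). At `s₂ = 1` each class counts with the
inverse of its step, so the residue is the Dirichlet series in `|b|` of the densities of
non-maximal classes (`sum_nonMaxIndRed`), and this series has an Euler product
(`tsum_prod_density`, `formSeries_one`). The residue is nonzero because `ζ(3 + w)` and the Euler
factors are; the quotient `ξ(z) / ξ(1 + z)` is nonzero because `ζ` has no zeros on the line
`Re s = 1`.

All forms. On `G⁺ / SL₂(ℤ)` the angle contributes a factor `1/2`, and the remaining coordinates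
run over the usual fundamental domain inside the strip `-1/2 ≤ u < 1/2`, over which the reducible
zeta function may be computed as well. The difference of the two integrals (`zetaDiff`) consists
of three parts: the sum over the forms with `a ≠ 0`, which for `t ≥ 1/2` is `O(l⁻¹²)` and vanishes
for large `l` (`exists_norm_cuspSum_le`); the reducible sum times the nonconstant part of the
Eisenstein series, which is bounded on the fundamental domain; and the reducible sum times the
constant term outside the fundamental domain, where `t ≤ 1`. The poles on `Re s = 5/4` come from
the growth of the constant term against the reducible sum for large `t`, which occurs in none of
these parts; they converge for `Re s > 1` (`integrableOn_remainder`), and the difference is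
holomorphic there (`differentiableOn_zetaDiff`).
-/

noncomputable section

namespace ReducibleZeta

/-! ### Reducible forms in the orbit of the base point -/

/-- The discriminant of a binary cubic form. -/
def cubicDisc {R : Type*} [CommRing R] (x : Fin 4 → R) : R :=
  x 1 ^ 2 * x 2 ^ 2 - 4 * x 0 * x 2 ^ 3 - 4 * x 1 ^ 3 * x 3 - 27 * x 0 ^ 2 * x 3 ^ 2
    + 18 * x 0 * x 1 * x 2 * x 3

theorem cubicDisc_cubicAct {R : Type*} [CommRing R] (g : Matrix (Fin 2) (Fin 2) R) (x : Fin 4 → R) :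
    cubicDisc (cubicAct g x) = g.det ^ 6 * cubicDisc x := by
  simp only [cubicDisc, cubicAct, Matrix.cons_val, Matrix.det_fin_two]
  ring

/-- The sign `±1` of the discriminant, as an integer. -/
def DiscSign.toInt : DiscSign → ℤ
  | .pos => 1
  | .neg => -1

theorem DiscSign.toInt_mul_self (ε : DiscSign) : ε.toInt * ε.toInt = 1 := by
  cases ε <;> rfl

theorem rpow_quarter_pow_four : ((108 : ℝ) ^ (1 / 4 : ℝ)) ^ 4 = 108 := by
  rw [← Real.rpow_natCast, ← Real.rpow_mul (by norm_num)]
  norm_num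

theorem cubicDisc_basePoint (ε : DiscSign) : cubicDisc (basePoint ε) = ε.toInt := by
  cases ε
  · have hc : ((108 : ℝ) ^ (1 / 4 : ℝ)) ≠ 0 := by positivity
    have h4 := rpow_quarter_pow_four
    simp only [cubicDisc, basePoint, Matrix.cons_val, DiscSign.toInt]
    generalize ((108 : ℝ) ^ (1 / 4 : ℝ)) = C at *
    field_simp
    push_cast
    linarith
  · have hc : √(2 : ℝ) ≠ 0 := by positivity
    have h2 : √(2 : ℝ) ^ 2 = 2 := Real.sq_sqrt (by norm_num)
    simp only [cubicDisc, basePoint, Matrix.cons_val, DiscSign.toInt]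
    generalize √(2 : ℝ) = C at *
    have h4 : C ^ 4 = 4 := by linear_combination (C ^ 2 + 2) * h2
    field_simp
    push_cast
    linarith

/-- The constant `k` for which the reducible form `(0, b, c, d)` with `b ≠ 0` and `D = c² - 4bd` is
the translate of the base point by an element of `B⁺` with `t² = k |b| / √|D|`, up to sign. -/
def shapeConst : DiscSign → ℝ
  | .pos => 2 / √3
  | .neg => 2

theorem shapeConst_pos (ε : DiscSign) : 0 < shapeConst ε := by
  cases ε <;> simp only [shapeConst] <;> positivity

theorem chiCubic_eq_mul_cubicDisc {x : Fin 4 → ℝ} (ε : DiscSign) {g : Matrix (Fin 2) (Fin 2) ℝ}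
    (h : cubicAct g (basePoint ε) = x) : chiCubic g = ε.toInt * cubicDisc x := by
  rw [← h, cubicDisc_cubicAct, cubicDisc_basePoint, chiCubic]
  have : (ε.toInt : ℝ) * ε.toInt = 1 := mod_cast ε.toInt_mul_self
  linear_combination (-g.det ^ 6) * this

theorem testFun_eq_zero_of_disc (ε : DiscSign) (fD : ℝ → ℂ) {x : Fin 4 → ℝ}
    (h : ε.toInt * cubicDisc x ≤ 0) : testFun ε fD x = 0 := by
  rw [testFun, dif_neg]
  rintro ⟨g, hg, hx⟩
  have := chiCubic_eq_mul_cubicDisc ε hx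
  have h6 : 0 < chiCubic g := by rw [chiCubic]; positivity
  linarith

/-- The ratio `k |b| / √(ε D)`, which is the square of the coordinate `t` of the form
`(0, b, c, d)` of discriminant `D = c² - 4bd`. -/
def shape (ε : DiscSign) (b Δ : ℝ) : ℝ := shapeConst ε * |b| / √Δ

/-- A reducible form with `b ≠ 0` and discriminant of the right sign is a translate of the base
point by a lower triangular element, whose shape `tr (hᵗh) / det h` is explicit. Its diagonal
entries are both positive or both negative, according to the sign of `b`. -/
theorem exists_lower_triangular (ε : DiscSign) (b c d : ℝ) (hb : b ≠ 0)
    (hD : 0 < ε.toInt * (c ^ 2 - 4 * b * d)) :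
    ∃ h : Matrix (Fin 2) (Fin 2) ℝ, 0 < h.det ∧ cubicAct h (basePoint ε) = ![0, b, c, d] ∧
      (h.transpose * h).trace / h.det =
        shape ε b (ε.toInt * (c ^ 2 - 4 * b * d)) + 1 / shape ε b (ε.toInt * (c ^ 2 - 4 * b * d))
          + shape ε b (ε.toInt * (c ^ 2 - 4 * b * d)) * (c / (2 * b)) ^ 2 := by
  obtain ⟨Δ, hΔ⟩ : ∃ Δ : ℝ, Δ = ε.toInt * (c ^ 2 - 4 * b * d) := ⟨_, rfl⟩
  rw [← hΔ] at hD ⊢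
  have hTpos : 0 < shape ε b Δ := by
    have := shapeConst_pos ε
    rw [shape]; positivity
  obtain ⟨T, hT⟩ : ∃ T, T = shape ε b Δ := ⟨_, rfl⟩
  rw [← hT] at hTpos ⊢
  obtain ⟨τ, hτ0, hτ⟩ : ∃ τ : ℝ, 0 < τ ∧ τ ^ 2 = T := ⟨√T, by positivity, Real.sq_sqrt hTpos.le⟩
  -- the sign of `b`
  obtain ⟨s, hs, hsb⟩ : ∃ s : ℝ, s ^ 2 = 1 ∧ b = s * |b| := by
    rcases lt_or_gt_of_ne hb with h | h
    · exact ⟨-1, by norm_num, by rw [abs_of_neg h]; ring⟩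
    · exact ⟨1, by norm_num, by rw [abs_of_pos h]; ring⟩
  have habs : 0 < |b| := abs_pos.mpr hb
  have hT2 : T ^ 2 * Δ = shapeConst ε ^ 2 * b ^ 2 := by
    rw [hT, shape, div_pow, Real.sq_sqrt hD.le, mul_pow, sq_abs]
    field_simp
  -- a base point is `(0, β, 0, δ)`, and the scalar `m` satisfies `m ^ 3 τ β = |b|`
  obtain ⟨β, δ, hβ, hbase, hk⟩ : ∃ β δ : ℝ, 0 < β ∧ basePoint ε = ![0, β, 0, δ] ∧
      4 * δ = - ε.toInt * shapeConst ε ^ 2 * β := by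
    cases ε
    · refine ⟨3 / (108 : ℝ) ^ (1 / 4 : ℝ), -1 / (108 : ℝ) ^ (1 / 4 : ℝ), by positivity, rfl, ?_⟩
      have h3 : √(3 : ℝ) ^ 2 = 3 := Real.sq_sqrt (by norm_num)
      simp only [shapeConst, DiscSign.toInt, div_pow, h3]
      push_cast
      ring
    · refine ⟨1 / √2, 1 / √2, by positivity, rfl, ?_⟩
      simp only [shapeConst, DiscSign.toInt]
      push_cast
      ring
  obtain ⟨m, hm0, hm⟩ : ∃ m : ℝ, 0 < m ∧ m ^ 3 = |b| / (τ * β) := by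
    refine ⟨(|b| / (τ * β)) ^ (1 / 3 : ℝ), by positivity, ?_⟩
    rw [← Real.rpow_natCast, ← Real.rpow_mul (by positivity)]
    norm_num
  obtain ⟨ν, hν⟩ : ∃ ν : ℝ, ν = T * c / (2 * b) := ⟨_, rfl⟩
  have hε : (ε.toInt : ℝ) * ε.toInt = 1 := mod_cast ε.toInt_mul_self
  have hm' : m ^ 3 * τ * β = |b| := by rw [hm]; field_simp
  have hm3 : s * m ^ 3 * τ * β = b := by rw [hsb, ← hm']; ring
  have hT0 : T ≠ 0 := hTpos.ne'
  have hνb : ν * (2 * b) = T * c := by rw [hν]; field_simp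
  have hs3 : s ^ 3 = s := by rw [pow_succ, hs, one_mul]
  refine ⟨!![s * m * τ, 0; s * m * ν / τ, s * m / τ], ?_, ?_, ?_⟩
  · rw [Matrix.det_fin_two_of]
    have : s * m * τ * (s * m / τ) = m ^ 2 := by field_simp; linear_combination hs
    rw [zero_mul, sub_zero, this]; exact pow_pos hm0 2
  · rw [hbase]
    funext i
    fin_cases i
    · simp [cubicAct]
    · simp [cubicAct]
      rw [← hm3]
      field_simp
      linear_combination s * hs
    · simp [cubicAct]
      have : T * c = 2 * ν * (s * m ^ 3 * τ * β) := by rw [hm3]; linarith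
      have h2 : c = 2 * ν * (s * m ^ 3 * τ * β) / τ ^ 2 := by
        rw [hτ, ← this]; field_simp
      rw [h2]
      field_simp
      linear_combination (s * ν) * hs
    · simp [cubicAct]
      have hd : 4 * b * d = c ^ 2 - ε.toInt * Δ := by
        rw [hΔ]; linear_combination (c ^ 2 - 4 * b * d) * hε
      -- the two terms account for `c ^ 2 / (4 b)` and for the discriminant
      have e1 : (s * m * ν / τ) ^ 2 * (s * m / τ) * β = c ^ 2 / (4 * b) := by
        have hc : c = ν * (2 * b) / τ ^ 2 := by rw [hτ]; field_simp; linarith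
        rw [hc]
        have : b ^ 2 = b * (s * m ^ 3 * τ * β) := by rw [hm3]; ring
        field_simp
        rw [← hm3]
        linear_combination (4 * s * m ^ 3 * ν ^ 2 * τ * β) * hs
      have e2 : δ * (s * m / τ) ^ 3 = -(ε.toInt * Δ) / (4 * b) := by
        have hΔ' : Δ = shapeConst ε ^ 2 * b ^ 2 / T ^ 2 := by
          rw [eq_div_iff (by positivity)]; linarith
        have hδ : δ = - ε.toInt * shapeConst ε ^ 2 * β / 4 := by linarith
        rw [hΔ', hδ, ← hτ]
        field_simp
        rw [← hm3]
        linear_combination (-(ε.toInt * shapeConst ε ^ 2 * β * s * m ^ 3 * τ)) * hs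
      have : d = c ^ 2 / (4 * b) + -(ε.toInt * Δ) / (4 * b) := by
        field_simp; linarith
      rw [this, ← e1, ← e2]
      ring
  · have hs0 : s ≠ 0 := by rintro rfl; norm_num at hs
    rw [Matrix.det_fin_two_of]
    have hc : c / (2 * b) = ν / τ ^ 2 := by rw [hτ, hν]; field_simp
    rw [hc, ← hτ]
    simp [Matrix.trace, Matrix.mul_apply, Fin.sum_univ_two]
    field_simp
    ring

/-- The test function at a reducible form. The discriminant of `(0, b, c, d)` is `b² (c² - 4bd)`,
and the exponent comes from `exists_lower_triangular`. -/
theorem testFun_reducible (ε : DiscSign) (fD : ℝ → ℂ) (b c d : ℝ) (hb : b ≠ 0)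
    (hD : 0 < ε.toInt * (c ^ 2 - 4 * b * d)) :
    testFun ε fD ![0, b, c, d] =
      (Real.exp (-(shape ε b (ε.toInt * (c ^ 2 - 4 * b * d)) +
        1 / shape ε b (ε.toInt * (c ^ 2 - 4 * b * d)) +
        shape ε b (ε.toInt * (c ^ 2 - 4 * b * d)) * (c / (2 * b)) ^ 2)) : ℂ) *
      fD (b ^ 2 * (ε.toInt * (c ^ 2 - 4 * b * d))) := by
  obtain ⟨h, hdet, hx, htr⟩ := exists_lower_triangular ε b c d hb hD
  rw [← hx, testFun_apply ε fD hdet, fG, htr, chiCubic_eq_mul_cubicDisc ε hx]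
  congr 2
  simp [cubicDisc]
  ring

theorem testFun_reducible_eq_zero (ε : DiscSign) (fD : ℝ → ℂ) (b c d : ℝ)
    (h : ¬ (b ≠ 0 ∧ 0 < ε.toInt * (c ^ 2 - 4 * b * d))) : testFun ε fD ![0, b, c, d] = 0 := by
  apply testFun_eq_zero_of_disc
  have e : ε.toInt * cubicDisc ![0, b, c, d] = b ^ 2 * (ε.toInt * (c ^ 2 - 4 * b * d)) := by
    simp [cubicDisc]; ring
  rw [e]
  by_cases hb : b = 0
  · simp [hb]
  · have : ε.toInt * (c ^ 2 - 4 * b * d) ≤ 0 := by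
      by_contra hc
      exact h ⟨hb, not_le.mp hc⟩
    exact mul_nonpos_of_nonneg_of_nonpos (sq_nonneg b) this

/-! ### Mellin transforms and Bessel functions -/

theorem ofReal_cpow_eq_exp {x : ℝ} (hx : 0 < x) (a : ℂ) :
    (x : ℂ) ^ a = Complex.exp (a * (Real.log x : ℝ)) := by
  rw [Complex.cpow_def_of_ne_zero (mod_cast hx.ne'), Complex.ofReal_log hx.le, mul_comm]

theorem mellin_comp_mul_pow (f : ℝ → ℂ) {κ : ℝ} (hκ : 0 < κ) (p : ℕ) (A : ℂ) :
    mellin (fun l => f (κ * l ^ p)) A = (1 / p : ℂ) * (κ : ℂ) ^ (-(A / p)) * mellin f (A / p) := by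
  have h := mellin_comp_rpow (fun x => f (κ * x)) A (p : ℝ)
  simp only [Real.rpow_natCast] at h
  rw [h, mellin_comp_mul_left f _ hκ]
  simp [mul_assoc]

theorem mellinConvergent_comp_mul_pow {f : ℝ → ℂ} {κ : ℝ} (hκ : 0 < κ) {p : ℕ} (hp : p ≠ 0) {A : ℂ}
    (h : MellinConvergent f (A / p)) : MellinConvergent (fun l => f (κ * l ^ p)) A := by
  have := (MellinConvergent.comp_rpow (f := fun x => f (κ * x)) (s := A) (a := (p : ℝ))
    (by exact_mod_cast hp)).mpr
  simp only [Real.rpow_natCast] at this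
  apply this
  rw [MellinConvergent.comp_mul_left hκ]
  simpa using h

theorem isBigO_zero_of_support {f : ℝ → ℂ} (hsupp : tsupport f ⊆ Ioi 0)
    (b : ℝ) : f =O[𝓝[>] 0] (fun x : ℝ => x ^ b) := by
  have h0 : (0 : ℝ) ∉ tsupport f := fun h => lt_irrefl (0 : ℝ) (hsupp h)
  have : f =ᶠ[𝓝 0] 0 := notMem_tsupport_iff_eventuallyEq.mp h0
  exact (this.filter_mono nhdsWithin_le_nhds).trans_isBigO (Asymptotics.isBigO_zero _ _)

theorem isBigO_atTop_of_support {f : ℝ → ℂ} (hc : HasCompactSupport f)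
    (b : ℝ) : f =O[atTop] (fun x : ℝ => x ^ b) := by
  have : f =ᶠ[cocompact ℝ] 0 := by
    rw [hasCompactSupport_iff_eventuallyEq] at hc
    rwa [coclosedCompact_eq_cocompact] at hc
  exact (this.filter_mono atTop_le_cocompact).trans_isBigO (Asymptotics.isBigO_zero _ _)

theorem mellinConvergent_of_support {f : ℝ → ℂ} (hf : Continuous f) (hc : HasCompactSupport f)
    (hsupp : tsupport f ⊆ Ioi 0) (s : ℂ) : MellinConvergent f s :=
  mellinConvergent_of_isBigO_rpow (a := s.re + 1) (b := s.re - 1)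
    (hf.locallyIntegrable.locallyIntegrableOn _)
    (isBigO_atTop_of_support hc _) (by linarith) (isBigO_zero_of_support hsupp _) (by linarith)

theorem differentiable_mellin_of_support {f : ℝ → ℂ} (hf : Continuous f) (hc : HasCompactSupport f)
    (hsupp : tsupport f ⊆ Ioi 0) : Differentiable ℂ (mellin f) := fun s =>
  mellin_differentiableAt_of_isBigO_rpow (a := s.re + 1) (b := s.re - 1)
    (hf.locallyIntegrable.locallyIntegrableOn _)
    (isBigO_atTop_of_support hc _) (by linarith) (isBigO_zero_of_support hsupp _) (by linarith)

/-- The function `y ↦ exp (-c (y + 1/y))`, whose Mellin transform is a Bessel function. -/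
def besselExp (c y : ℝ) : ℂ := (Real.exp (-c * (y + 1 / y)) : ℂ)

theorem besselK_eq_mellin (ν : ℂ) (x : ℝ) : besselK ν x = 1 / 2 * mellin (besselExp (x / 2)) ν := by
  rw [besselK, mellin]
  congr 1
  refine setIntegral_congr_fun measurableSet_Ioi fun y _ => ?_
  simp only [besselExp, smul_eq_mul]
  ring

theorem norm_besselExp (c y : ℝ) : ‖besselExp c y‖ = Real.exp (-c * (y + 1 / y)) := by
  rw [besselExp, Complex.norm_real, Real.norm_of_nonneg (Real.exp_pos _).le]

theorem besselExp_isBigO_top {c : ℝ} (hc : 0 < c) (a : ℝ) :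
    besselExp c =O[atTop] (fun x : ℝ => x ^ (-a)) := by
  refine Asymptotics.IsBigO.trans ?_ (isLittleO_exp_neg_mul_rpow_atTop hc (-a)).isBigO
  refine Asymptotics.IsBigO.of_bound 1 ?_
  filter_upwards [eventually_gt_atTop 0] with y hy
  rw [norm_besselExp, Real.norm_of_nonneg (Real.exp_pos _).le, one_mul]
  apply Real.exp_le_exp.mpr
  have : 0 < c * (1 / y) := by positivity
  linarith

theorem besselExp_isBigO_zero {c : ℝ} (hc : 0 < c) (b : ℝ) :
    besselExp c =O[𝓝[>] 0] (fun x : ℝ => x ^ (-b)) := by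
  have h := ((isLittleO_exp_neg_mul_rpow_atTop hc b).comp_tendsto tendsto_inv_nhdsGT_zero).isBigO
  have h2 : ((fun x : ℝ => x ^ b) ∘ fun x : ℝ => x⁻¹) =ᶠ[𝓝[>] 0] (fun x : ℝ => x ^ (-b)) := by
    filter_upwards [self_mem_nhdsWithin] with x hx
    simp only [Function.comp]
    rw [Real.inv_rpow (le_of_lt hx), Real.rpow_neg (le_of_lt hx)]
  refine Asymptotics.IsBigO.trans ?_ (h.trans_eventuallyEq h2)
  refine Asymptotics.IsBigO.of_bound 1 ?_
  filter_upwards [self_mem_nhdsWithin] with y hy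
  rw [norm_besselExp, one_mul]
  simp only [Function.comp]
  rw [Real.norm_of_nonneg (Real.exp_pos _).le]
  apply Real.exp_le_exp.mpr
  have : 0 < c * y := mul_pos hc hy
  rw [one_div]
  linarith

theorem locallyIntegrableOn_besselExp (c : ℝ) :
    LocallyIntegrableOn (besselExp c) (Ioi 0) := by
  apply ContinuousOn.locallyIntegrableOn _ measurableSet_Ioi
  unfold besselExp
  refine Complex.continuous_ofReal.comp_continuousOn (Real.continuous_exp.comp_continuousOn ?_)
  refine continuousOn_const.mul (continuousOn_id.add (continuousOn_const.div continuousOn_id ?_))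
  intro x hx
  exact (ne_of_gt hx)

theorem mellinConvergent_besselExp {c : ℝ} (hc : 0 < c) (s : ℂ) :
    MellinConvergent (besselExp c) s :=
  mellinConvergent_of_isBigO_rpow (a := s.re + 1) (b := s.re - 1)
    (locallyIntegrableOn_besselExp c)
    (besselExp_isBigO_top hc _) (by linarith) (besselExp_isBigO_zero hc _) (by linarith)

theorem differentiable_besselK {x : ℝ} (hx : 0 < x) : Differentiable ℂ (fun ν => besselK ν x) := by
  simp_rw [besselK_eq_mellin]
  refine Differentiable.const_mul (fun s => ?_) _
  exact mellin_differentiableAt_of_isBigO_rpow (a := s.re + 1) (b := s.re - 1)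
    (locallyIntegrableOn_besselExp (x / 2))
    (besselExp_isBigO_top (half_pos hx) _) (by linarith)
    (besselExp_isBigO_zero (half_pos hx) _) (by linarith)

/-! ### The archimedean integral of an orbit -/

/-- The Gaussian factor of the test function on the orbit of a reducible form. -/
def gaussFactor (T v t u : ℝ) : ℝ := Real.exp (-(T * t ^ 2 + 1 / (T * t ^ 2) + T * (u + v) ^ 2 / t ^ 2))

/-- The integrand attached to one reducible form, in the coordinates `(l, t, u)`. The form enters
through `κ = |b² D|`, `T` (its `shape`) and `v = c / (2b)`; the exponents `p, r` describe how the
discriminant scales with `l` and `t`, and the last factor is the density of the Haar measure. -/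
def orbitTerm (fD : ℝ → ℂ) (p r : ℕ) (κ T v : ℝ) (A B : ℂ) (x : ℝ × ℝ × ℝ) : ℂ :=
  (x.1 : ℂ) ^ A * (x.2.1 : ℂ) ^ B * ((gaussFactor T v x.2.1 x.2.2 : ℂ) * fD (κ * x.1 ^ p * x.2.1 ^ r))
    * ((1 / (x.1 * x.2.1 ^ 3) : ℝ) : ℂ)

theorem measurable_orbitTerm {fD : ℝ → ℂ} (hf : Continuous fD) (p r : ℕ) (κ T v : ℝ) (A B : ℂ) :
    Measurable (orbitTerm fD p r κ T v A B) := by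
  have := hf.measurable
  unfold orbitTerm gaussFactor
  fun_prop

theorem norm_orbitTerm (fD : ℝ → ℂ) (p r : ℕ) (κ T v : ℝ) (A B : ℂ) {x : ℝ × ℝ × ℝ} (h1 : 0 < x.1)
    (h2 : 0 < x.2.1) : (‖orbitTerm fD p r κ T v A B x‖ : ℂ) =
      orbitTerm (fun y => (‖fD y‖ : ℂ)) p r κ T v A.re B.re x := by
  simp only [orbitTerm, norm_mul, Complex.norm_real, Complex.norm_cpow_eq_rpow_re_of_pos h1,
    Complex.norm_cpow_eq_rpow_re_of_pos h2, gaussFactor, Complex.ofReal_mul,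
    Complex.ofReal_cpow h1.le, Complex.ofReal_cpow h2.le]
  rw [Real.norm_of_nonneg (Real.exp_pos _).le, Real.norm_of_nonneg]
  positivity

/-- The half space on which the coordinates `(l, t, u)` of `B⁺` range. -/
def halfSpace : Set (ℝ × ℝ × ℝ) := Ioi 0 ×ˢ Ioi 0 ×ˢ univ

theorem volume_restrict_prod3 (s t u : Set ℝ) :
    (volume : Measure (ℝ × ℝ × ℝ)).restrict (s ×ˢ t ×ˢ u) =
      (volume.restrict s).prod ((volume.restrict t).prod (volume.restrict u)) := by
  rw [Measure.prod_restrict, Measure.prod_restrict]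
  rfl

/-- The slice integral over `l`. -/
theorem orbitTerm_slice (fD : ℝ → ℂ) (p r : ℕ) {κ : ℝ} (hκ : 0 < κ) (T v : ℝ)
    (A B : ℂ) {t : ℝ} (ht : 0 < t) (u : ℝ) :
    ∫ l in Ioi (0 : ℝ), orbitTerm fD p r κ T v A B (l, t, u) =
      ((1 / p : ℂ) * (κ : ℂ) ^ (-(A / p)) * mellin fD (A / p)) *
        ((t : ℂ) ^ (B - r * A / p - 3) * (gaussFactor T v t u : ℂ)) := by
  have hκt : 0 < κ * t ^ r := by positivity
  have ht0 : (t : ℂ) ≠ 0 := mod_cast ht.ne'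
  have e : ∀ l ∈ Ioi (0 : ℝ), orbitTerm fD p r κ T v A B (l, t, u) =
      ((t : ℂ) ^ B * (t : ℂ) ^ (-3 : ℂ) * (gaussFactor T v t u : ℂ)) *
        ((l : ℂ) ^ (A - 1) • fD ((κ * t ^ r) * l ^ p)) := by
    intro l hl
    have hl0 : (l : ℂ) ≠ 0 := mod_cast (ne_of_gt hl)
    have h3 : (t : ℂ) ^ (-3 : ℂ) = ((t : ℂ) ^ 3)⁻¹ := by
      rw [Complex.cpow_neg]; norm_cast
    simp only [orbitTerm, smul_eq_mul]
    rw [h3, Complex.cpow_sub _ _ hl0, Complex.cpow_one, mul_right_comm κ]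
    push_cast
    field_simp
  rw [setIntegral_congr_fun measurableSet_Ioi e, integral_const_mul]
  change _ * mellin (fun l => fD ((κ * t ^ r) * l ^ p)) A = _
  rw [mellin_comp_mul_pow fD hκt p, Complex.ofReal_mul,
    Complex.mul_cpow_ofReal_nonneg hκ.le (by positivity), Complex.ofReal_pow]
  have h4 : ((t : ℂ) ^ r) ^ (-(A / p)) = (t : ℂ) ^ (-(r * A / p)) := by
    rw [← Complex.ofReal_pow, ofReal_cpow_eq_exp (by positivity), ofReal_cpow_eq_exp ht, Real.log_pow]
    push_cast
    ring_nf
  have h5 : (t : ℂ) ^ (B - r * A / p - 3) = (t : ℂ) ^ B * (t : ℂ) ^ (-(r * A / p)) *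
      (t : ℂ) ^ (-3 : ℂ) := by
    rw [← Complex.cpow_add _ _ ht0, ← Complex.cpow_add _ _ ht0]
    ring_nf
  rw [h4, h5]
  ring

theorem orbitTerm_slice_integrable {fD : ℝ → ℂ} (hf : Continuous fD) (hc : HasCompactSupport fD)
    (hsupp : tsupport fD ⊆ Ioi 0) {p : ℕ} (hp : p ≠ 0) (r : ℕ) {κ : ℝ} (hκ : 0 < κ) (T v : ℝ)
    (A B : ℂ) {t : ℝ} (ht : 0 < t) (u : ℝ) :
    IntegrableOn (fun l => orbitTerm fD p r κ T v A B (l, t, u)) (Ioi 0) := by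
  have hκt : 0 < κ * t ^ r := by positivity
  have e : ∀ l ∈ Ioi (0 : ℝ), orbitTerm fD p r κ T v A B (l, t, u) =
      ((t : ℂ) ^ B * ((t : ℂ) ^ 3)⁻¹ * (gaussFactor T v t u : ℂ)) *
        ((l : ℂ) ^ (A - 1) • fD ((κ * t ^ r) * l ^ p)) := by
    intro l hl
    have hl0 : (l : ℂ) ≠ 0 := mod_cast (ne_of_gt hl)
    simp only [orbitTerm, smul_eq_mul]
    rw [Complex.cpow_sub _ _ hl0, Complex.cpow_one, mul_right_comm κ]
    push_cast
    field_simp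
  rw [integrableOn_congr_fun e measurableSet_Ioi]
  exact Integrable.const_mul (mellinConvergent_comp_mul_pow hκt hp
    (mellinConvergent_of_support hf hc hsupp _)) _

theorem integral_gaussFactor {T : ℝ} (hT : 0 < T) (v : ℝ) {t : ℝ} (ht : 0 < t) :
    ∫ u : ℝ, gaussFactor T v t u =
      Real.exp (-(T * t ^ 2 + 1 / (T * t ^ 2))) * (√Real.pi * t / √T) := by
  have e : ∀ u : ℝ, gaussFactor T v t u = Real.exp (-(T * t ^ 2 + 1 / (T * t ^ 2))) *
      Real.exp (-(T / t ^ 2) * (u + v) ^ 2) := by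
    intro u
    rw [gaussFactor, ← Real.exp_add]
    congr 1
    ring
  simp_rw [e]
  rw [integral_const_mul, integral_add_right_eq_self (fun u => Real.exp (-(T / t ^ 2) * u ^ 2)) v,
    integral_gaussian, div_div_eq_mul_div, Real.sqrt_div' _ hT.le, Real.sqrt_mul Real.pi_pos.le,
    Real.sqrt_sq ht.le]

theorem integrable_gaussFactor {T : ℝ} (hT : 0 < T) (v : ℝ) {t : ℝ} (ht : 0 < t) :
    Integrable (fun u => gaussFactor T v t u) := by
  have e : ∀ u : ℝ, gaussFactor T v t u = Real.exp (-(T * t ^ 2 + 1 / (T * t ^ 2))) *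
      Real.exp (-(T / t ^ 2) * (u + v) ^ 2) := by
    intro u
    rw [gaussFactor, ← Real.exp_add]
    congr 1
    ring
  simp_rw [e]
  exact ((integrable_exp_neg_mul_sq (div_pos hT (pow_pos ht 2))).comp_add_right v).const_mul _

theorem gaussFactor_pos (T v t u : ℝ) : 0 < gaussFactor T v t u := Real.exp_pos _

theorem gauss_t_eq (T : ℝ) (γ : ℂ) {t : ℝ} (ht : 0 < t) :
    (t : ℂ) ^ (γ - 3) * ((Real.exp (-(T * t ^ 2 + 1 / (T * t ^ 2))) * (√Real.pi * t / √T) : ℝ) : ℂ)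
      = (√Real.pi / √T : ℝ) * ((t : ℂ) ^ ((γ - 1) - 1) • besselExp 1 (T * t ^ 2)) := by
  have ht0 : (t : ℂ) ≠ 0 := mod_cast ht.ne'
  have : (t : ℂ) ^ ((γ - 1) - 1) = (t : ℂ) ^ (γ - 3) * t := by
    have h := Complex.cpow_add (γ - 3) 1 ht0
    rw [Complex.cpow_one] at h
    rw [← h]
    ring_nf
  rw [this, besselExp, smul_eq_mul, neg_one_mul]
  push_cast
  ring

theorem integrable_gauss_t {T : ℝ} (hT : 0 < T) (γ : ℂ) :
    IntegrableOn (fun t : ℝ => (t : ℂ) ^ (γ - 3) *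
      ((Real.exp (-(T * t ^ 2 + 1 / (T * t ^ 2))) * (√Real.pi * t / √T) : ℝ) : ℂ)) (Ioi 0) := by
  rw [integrableOn_congr_fun (fun t (ht : t ∈ Ioi (0 : ℝ)) => gauss_t_eq T γ ht) measurableSet_Ioi]
  exact Integrable.const_mul (mellinConvergent_comp_mul_pow hT two_ne_zero
    (mellinConvergent_besselExp one_pos _)) _

theorem integral_gauss_t {T : ℝ} (hT : 0 < T) (γ : ℂ) :
    ∫ t in Ioi (0 : ℝ), (t : ℂ) ^ (γ - 3) *
      ((Real.exp (-(T * t ^ 2 + 1 / (T * t ^ 2))) * (√Real.pi * t / √T) : ℝ) : ℂ) =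
    (T : ℂ) ^ (-(γ / 2)) * ((√Real.pi : ℂ) * besselK ((γ - 1) / 2) 2) := by
  rw [setIntegral_congr_fun measurableSet_Ioi (fun t ht => gauss_t_eq T γ ht), integral_const_mul]
  change _ * mellin (fun t => besselExp 1 (T * t ^ 2)) (γ - 1) = _
  rw [mellin_comp_mul_pow _ hT, besselK_eq_mellin, div_self two_ne_zero]
  have : (T : ℂ) ^ (-(γ / 2)) = (T : ℂ) ^ (-((γ - 1) / 2)) * ((√T : ℝ) : ℂ)⁻¹ := by
    rw [Real.sqrt_eq_rpow, Complex.ofReal_cpow hT.le, ← Complex.cpow_neg, ← Complex.cpow_add]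
    · congr 1; push_cast; ring
    · exact mod_cast hT.ne'
  push_cast
  rw [this]
  ring

theorem measurable_gaussFactor (T v : ℝ) : Measurable (fun x : ℝ × ℝ => gaussFactor T v x.1 x.2) := by
  unfold gaussFactor
  fun_prop

theorem integrable_gauss_prod {T : ℝ} (hT : 0 < T) (v : ℝ) (γ : ℂ) :
    Integrable (fun x : ℝ × ℝ => (x.1 : ℂ) ^ (γ - 3) * (gaussFactor T v x.1 x.2 : ℂ))
      ((volume.restrict (Ioi 0)).prod volume) := by
  have hm : Measurable (fun x : ℝ × ℝ => (x.1 : ℂ) ^ (γ - 3) * (gaussFactor T v x.1 x.2 : ℂ)) := by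
    have := measurable_gaussFactor T v
    fun_prop
  rw [integrable_prod_iff hm.aestronglyMeasurable]
  refine ⟨?_, ?_⟩
  · refine (ae_restrict_iff' measurableSet_Ioi).mpr (Eventually.of_forall fun t ht => ?_)
    exact ((integrable_gaussFactor hT v ht).ofReal (𝕜 := ℂ)).const_mul ((t : ℂ) ^ (γ - 3))
  · refine Integrable.congr (integrable_gauss_t hT (γ.re : ℂ)).norm ?_
    refine (ae_restrict_iff' measurableSet_Ioi).mpr (Eventually.of_forall fun t ht => ?_)
    have ht' : 0 < t := ht
    simp only [norm_mul, Complex.norm_real, Complex.norm_cpow_eq_rpow_re_of_pos ht']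
    rw [integral_const_mul]
    simp only [Complex.sub_re, Complex.ofReal_re]
    congr 1
    simp_rw [fun u => Real.norm_of_nonneg (gaussFactor_pos T v t u).le]
    rw [integral_gaussFactor hT v ht', Real.norm_of_nonneg (Real.exp_pos _).le,
      Real.norm_of_nonneg (by positivity)]

theorem integral_gauss_prod {T : ℝ} (hT : 0 < T) (v : ℝ) (γ : ℂ) :
    ∫ x, (x.1 : ℂ) ^ (γ - 3) * (gaussFactor T v x.1 x.2 : ℂ)
      ∂((volume.restrict (Ioi (0 : ℝ))).prod (volume : Measure ℝ)) =
    (T : ℂ) ^ (-(γ / 2)) * ((√Real.pi : ℂ) * besselK ((γ - 1) / 2) 2) := by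
  rw [integral_prod _ (integrable_gauss_prod hT v γ), ← integral_gauss_t hT]
  refine setIntegral_congr_fun measurableSet_Ioi fun t ht => ?_
  simp only
  rw [integral_const_mul, integral_complex_ofReal, integral_gaussFactor hT v ht]

/-- The archimedean factor common to all orbits: `mellin fD` comes from the integral over `l`, the
Bessel function and `√π` from those over `t` and `u`. -/
def archFactor (fD : ℝ → ℂ) (p r : ℕ) (A B : ℂ) : ℂ :=
  (1 / p : ℂ) * mellin fD (A / p) * ((√Real.pi : ℂ) * besselK ((B - r * A / p - 1) / 2) 2)

theorem integrable_orbitTerm {fD : ℝ → ℂ} (hf : Continuous fD) (hc : HasCompactSupport fD)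
    (hsupp : tsupport fD ⊆ Ioi 0) {p : ℕ} (hp : p ≠ 0) (r : ℕ) {κ T : ℝ} (hκ : 0 < κ) (hT : 0 < T)
    (v : ℝ) (A B : ℂ) : IntegrableOn (orbitTerm fD p r κ T v A B) halfSpace := by
  have hpos : ∀ᵐ y ∂((volume.restrict (Ioi (0 : ℝ))).prod (volume : Measure ℝ)), 0 < y.1 := by
    have h : ∀ᵐ t ∂(volume.restrict (Ioi (0 : ℝ))), 0 < t :=
      (ae_restrict_iff' measurableSet_Ioi).mpr (Eventually.of_forall fun t ht => ht)
    exact Measure.quasiMeasurePreserving_fst.ae h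
  rw [IntegrableOn, halfSpace, volume_restrict_prod3, Measure.restrict_univ,
    integrable_prod_iff' (measurable_orbitTerm hf p r κ T v A B).aestronglyMeasurable]
  refine ⟨?_, ?_⟩
  · filter_upwards [hpos] with y hy
    exact orbitTerm_slice_integrable hf hc hsupp hp r hκ T v A B hy y.2
  · have hint := (integrable_gauss_prod hT v
      ((B.re : ℂ) - r * (A.re : ℂ) / p)).const_mul
      ((1 / p : ℂ) * (κ : ℂ) ^ (-((A.re : ℂ) / p)) * mellin (fun y => (‖fD y‖ : ℂ)) ((A.re : ℂ) / p))
    refine (Complex.reCLM.integrable_comp hint).congr ?_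
    filter_upwards [hpos] with y hy
    have h := orbitTerm_slice (fun y => (‖fD y‖ : ℂ)) p r hκ T v A.re B.re hy y.2
    rw [← setIntegral_congr_fun measurableSet_Ioi
      (fun l (hl : 0 < l) => norm_orbitTerm fD p r κ T v A B (x := (l, y.1, y.2)) hl hy),
      integral_complex_ofReal] at h
    rw [← h, Complex.reCLM_apply, Complex.ofReal_re]

/-- The integral over a full orbit. The integral over `l` is a Mellin transform of `fD`, the
integral over `u` is Gaussian, and the remaining integral over `t` is that of a Bessel function. -/
theorem integral_orbitTerm {fD : ℝ → ℂ} (hf : Continuous fD) (hc : HasCompactSupport fD)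
    (hsupp : tsupport fD ⊆ Ioi 0) {p : ℕ} (hp : p ≠ 0) (r : ℕ) {κ T : ℝ} (hκ : 0 < κ) (hT : 0 < T)
    (v : ℝ) (A B : ℂ) : ∫ x in halfSpace, orbitTerm fD p r κ T v A B x =
      archFactor fD p r A B * ((κ : ℂ) ^ (-(A / p)) * (T : ℂ) ^ (-((B - r * A / p) / 2))) := by
  have hint := integrable_orbitTerm hf hc hsupp hp r hκ hT v A B
  rw [IntegrableOn, halfSpace, volume_restrict_prod3, Measure.restrict_univ] at hint
  rw [halfSpace, volume_restrict_prod3, Measure.restrict_univ, integral_prod_symm _ hint]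
  have hpos : ∀ᵐ y ∂((volume.restrict (Ioi (0 : ℝ))).prod (volume : Measure ℝ)), 0 < y.1 := by
    have h : ∀ᵐ t ∂(volume.restrict (Ioi (0 : ℝ))), 0 < t :=
      (ae_restrict_iff' measurableSet_Ioi).mpr (Eventually.of_forall fun t ht => ht)
    exact Measure.quasiMeasurePreserving_fst.ae h
  have e : ∀ᵐ y ∂((volume.restrict (Ioi (0 : ℝ))).prod (volume : Measure ℝ)),
      ∫ l in Ioi (0 : ℝ), orbitTerm fD p r κ T v A B (l, y) =
      ((1 / p : ℂ) * (κ : ℂ) ^ (-(A / p)) * mellin fD (A / p)) *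
        ((y.1 : ℂ) ^ (B - r * A / p - 3) * (gaussFactor T v y.1 y.2 : ℂ)) := by
    filter_upwards [hpos] with y hy
    exact orbitTerm_slice fD p r hκ T v A B hy y.2
  rw [integral_congr_ae e, integral_const_mul, integral_gauss_prod hT, archFactor]
  ring

/-! ### Holomorphic series -/

/-- A normally convergent series of holomorphic functions on a complex normed space is
differentiable: the Cauchy estimate turns the bound for the terms into one for their derivatives on
a smaller ball. -/
theorem differentiableAt_tsum_of_bound {E ι : Type*} [NormedAddCommGroup E] [NormedSpace ℂ E]
    {F : ι → E → ℂ} {u : ι → ℝ} (hu : Summable u) {x₀ : E} {ρ : ℝ} (hρ : 0 < ρ)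
    (hF : ∀ i, DifferentiableOn ℂ (F i) (Metric.ball x₀ ρ))
    (hb : ∀ i, ∀ y ∈ Metric.ball x₀ ρ, ‖F i y‖ ≤ u i) :
    DifferentiableAt ℂ (fun y => ∑' i, F i y) x₀ := by
  let _ : NormedSpace ℝ E := NormedSpace.restrictScalars ℝ ℂ E
  have hρ2 : 0 < ρ / 2 := half_pos hρ
  have hsub : ∀ y ∈ Metric.ball x₀ (ρ / 2), Metric.ball y (ρ / 2) ⊆ Metric.ball x₀ ρ := by
    intro y hy
    apply Metric.ball_subset_ball'
    have := Metric.mem_ball.mp hy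
    linarith
  have hmem : ∀ y ∈ Metric.ball x₀ (ρ / 2), y ∈ Metric.ball x₀ ρ := fun y hy =>
    hsub y hy (Metric.mem_ball_self hρ2)
  have hx : x₀ ∈ Metric.ball x₀ (ρ / 2) := Metric.mem_ball_self hρ2
  refine (hasFDerivAt_tsum_of_isPreconnected (u := fun i => 2 * u i / (ρ / 2))
    (f' := fun i y => fderiv ℂ (F i) y) ((hu.mul_left 2).div_const _)
    Metric.isOpen_ball (convex_ball x₀ (ρ / 2)).isPreconnected ?_ ?_ hx ?_ hx).differentiableAt
  · intro i y hy
    exact ((hF i).differentiableAt (Metric.isOpen_ball.mem_nhds (hmem y hy))).hasFDerivAt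
  · intro i y hy
    refine Complex.norm_fderiv_le_div_of_mapsTo_ball ((hF i).mono (hsub y hy)) ?_ hρ2
    intro w hw
    rw [Metric.mem_closedBall, dist_eq_norm]
    calc ‖F i w - F i y‖ ≤ ‖F i w‖ + ‖F i y‖ := norm_sub_le _ _
      _ ≤ u i + u i := add_le_add (hb i w (hsub y hy hw)) (hb i y (hmem y hy))
      _ = 2 * u i := by ring
  · exact hu.of_norm_bounded fun i => hb i x₀ (Metric.mem_ball_self hρ)

/-! ### Zeta functions of arithmetic progressions -/

/-- The terms of the continuation of `(s - 1) ∑ (a + M k)^(-s)`. -/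
def progTerm (a M : ℝ) (k : ℕ) (s : ℂ) : ℂ :=
  (s - 1) * ((a + M * k : ℝ) : ℂ) ^ (-s) -
    (((a + M * k : ℝ) : ℂ) ^ (1 - s) - ((a + M * (k + 1 : ℕ) : ℝ) : ℂ) ^ (1 - s)) / M

/-- The function `(s - 1) ∑_k (a + M k)^(-s)`, continued to `Re s > 0`: the sum is compared with
the integral of `x^(-s)` from `a` to `∞`. -/
def progZeta (a M : ℝ) (s : ℂ) : ℂ := (a : ℂ) ^ (1 - s) / M + ∑' k, progTerm a M k s

theorem hasDerivAt_ofReal_cpow {y : ℝ} (hy : 0 < y) (c : ℂ) :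
    HasDerivAt (fun x : ℝ => (x : ℂ) ^ c) (c * (y : ℂ) ^ (c - 1)) y := by
  have h := ((hasDerivAt_id (y : ℂ)).cpow_const (c := c) (by simp [hy])).comp_ofReal
  simpa using h

theorem norm_cpow_sub_le {y₀ y₁ : ℝ} (h0 : 0 < y₀) (h1 : y₀ ≤ y₁) {s : ℂ} (hs : 0 ≤ s.re) :
    ‖(y₁ : ℂ) ^ (-s) - (y₀ : ℂ) ^ (-s)‖ ≤ ‖s‖ * y₀ ^ (-s.re - 1) * (y₁ - y₀) := by
  have h := norm_image_sub_le_of_norm_deriv_le_segment' (f := fun x : ℝ => (x : ℂ) ^ (-s))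
    (f' := fun x => -s * (x : ℂ) ^ (-s - 1)) (a := y₀) (b := y₁) (C := ‖s‖ * y₀ ^ (-s.re - 1))
    (fun x hx => (hasDerivAt_ofReal_cpow (h0.trans_le hx.1) (-s)).hasDerivWithinAt) ?_ y₁
    (right_mem_Icc.mpr h1)
  · exact h
  · intro x hx
    have hx0 : 0 < x := h0.trans_le hx.1
    rw [norm_mul, norm_neg, Complex.norm_cpow_eq_rpow_re_of_pos hx0]
    refine mul_le_mul_of_nonneg_left ?_ (norm_nonneg _)
    simp only [Complex.sub_re, Complex.neg_re, Complex.one_re]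
    exact Real.rpow_le_rpow_of_nonpos h0 hx.1 (by linarith)

/-- The difference between a summand and the mean of the integral over the following interval of
length `M` gains one power of `y`. -/
theorem norm_progTerm_le_aux {y M : ℝ} (hy : 0 < y) (hM : 0 < M) {s : ℂ} (hs : 0 ≤ s.re) :
    ‖(s - 1) * (y : ℂ) ^ (-s) - ((y : ℂ) ^ (1 - s) - ((y + M : ℝ) : ℂ) ^ (1 - s)) / M‖ ≤
      ‖s - 1‖ * ‖s‖ * M * y ^ (-s.re - 1) := by
  -- the derivative of `φ` is `(s - 1) (y^(-s) - x^(-s))`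
  set φ : ℝ → ℂ := fun x => (s - 1) * (y : ℂ) ^ (-s) * x + (x : ℂ) ^ (1 - s) with hφ
  have hd : ∀ x ∈ Icc y (y + M), HasDerivWithinAt φ
      ((s - 1) * (y : ℂ) ^ (-s) + (1 - s) * (x : ℂ) ^ (1 - s - 1)) (Icc y (y + M)) x := by
    intro x hx
    have h1 : HasDerivAt (fun x : ℝ => (s - 1) * (y : ℂ) ^ (-s) * (x : ℂ))
        ((s - 1) * (y : ℂ) ^ (-s)) x := by
      simpa using (Complex.ofRealCLM.hasDerivAt (x := x)).const_mul ((s - 1) * (y : ℂ) ^ (-s))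
    exact (h1.add (hasDerivAt_ofReal_cpow (hy.trans_le hx.1) (1 - s))).hasDerivWithinAt
  have h := norm_image_sub_le_of_norm_deriv_le_segment' hd
    (C := ‖s - 1‖ * (‖s‖ * y ^ (-s.re - 1) * M)) ?_ (y + M) (right_mem_Icc.mpr (by linarith))
  · have hM0 : (M : ℂ) ≠ 0 := mod_cast hM.ne'
    have e : (s - 1) * (y : ℂ) ^ (-s) - ((y : ℂ) ^ (1 - s) - ((y + M : ℝ) : ℂ) ^ (1 - s)) / M =
        (φ (y + M) - φ y) / M := by
      simp only [hφ]
      push_cast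
      field_simp
      ring
    rw [e, norm_div, Complex.norm_real, Real.norm_of_nonneg hM.le, div_le_iff₀ hM]
    refine h.trans (le_of_eq ?_)
    ring
  · intro x hx
    have e : (s - 1) * (y : ℂ) ^ (-s) + (1 - s) * (x : ℂ) ^ (1 - s - 1) =
        -((s - 1) * ((x : ℂ) ^ (-s) - (y : ℂ) ^ (-s))) := by
      rw [show 1 - s - 1 = -s by ring]; ring
    rw [e, norm_neg, norm_mul]
    refine mul_le_mul_of_nonneg_left ((norm_cpow_sub_le hy hx.1 hs).trans ?_) (norm_nonneg _)
    refine mul_le_mul_of_nonneg_left ?_ (by positivity)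
    linarith [hx.2]

theorem norm_cpow_one_sub_div_le {x M : ℝ} (hx1 : 1 ≤ x) (hM : 1 ≤ M) (hx : x ≤ 2 * M) {s : ℂ}
    (hs : 0 ≤ s.re) : ‖(x : ℂ) ^ (1 - s) / M‖ ≤ 2 := by
  have hx0 : 0 < x := by linarith
  rw [norm_div, Complex.norm_real, Real.norm_of_nonneg (by linarith),
    Complex.norm_cpow_eq_rpow_re_of_pos hx0, div_le_iff₀ (by linarith)]
  refine (Real.rpow_le_rpow_of_exponent_le hx1 (y := (1 - s).re) (z := 1) ?_).trans ?_
  · simpa using hs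
  · simpa using hx

/-- The bound is uniform in `a ≤ M`; this uniformity makes the sum over all classes of forms
converge for `Re s₂ > 1/2`. -/
theorem norm_progTerm_le {a M : ℝ} (ha : 1 ≤ a) (haM : a ≤ M) {s : ℂ} (hs : 1 / 2 ≤ s.re) {R : ℝ}
    (hR : ‖s‖ ≤ R) (k : ℕ) :
    ‖progTerm a M k s‖ ≤ (4 * (R + 1) * R + R + 5) * ((k : ℝ) + 1) ^ (-(3 / 2) : ℝ) := by
  have hM : 1 ≤ M := ha.trans haM
  have hR0 : 0 ≤ R := (norm_nonneg _).trans hR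
  have hs1 : ‖s - 1‖ ≤ R + 1 := (norm_sub_le _ _).trans (by simpa using hR)
  rcases Nat.eq_zero_or_pos k with rfl | hk
  · have h1 : ‖(a : ℂ) ^ (-s)‖ ≤ 1 := by
      rw [Complex.norm_cpow_eq_rpow_re_of_pos (by linarith)]
      apply Real.rpow_le_one_of_one_le_of_nonpos ha
      simp only [Complex.neg_re]
      linarith
    have h2 := norm_cpow_one_sub_div_le ha hM (by linarith) (s := s) (by linarith)
    have h3 := norm_cpow_one_sub_div_le (x := a + M) (by linarith) hM (by linarith) (s := s)
      (by linarith)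
    simp only [progTerm, Nat.cast_zero, mul_zero, add_zero, zero_add, Nat.cast_one, mul_one,
      Real.one_rpow]
    rw [sub_div]
    calc _ ≤ ‖(s - 1) * (a : ℂ) ^ (-s)‖ +
          (‖(a : ℂ) ^ (1 - s) / M‖ + ‖((a + M : ℝ) : ℂ) ^ (1 - s) / M‖) :=
          (norm_sub_le _ _).trans (add_le_add le_rfl (norm_sub_le _ _))
      _ ≤ (R + 1) * 1 + (2 + 2) := by
          rw [norm_mul]
          gcongr
      _ ≤ _ := by nlinarith [mul_nonneg hR0 hR0]
  · have hk1 : (1 : ℝ) ≤ k := mod_cast hk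
    have hy1 : 1 ≤ a + M * k := by nlinarith
    have h := norm_progTerm_le_aux (y := a + M * k) (M := M) (by linarith) (by linarith) (s := s)
      (by linarith)
    have e : progTerm a M k s = (s - 1) * ((a + M * k : ℝ) : ℂ) ^ (-s) -
        (((a + M * k : ℝ) : ℂ) ^ (1 - s) - ((a + M * k + M : ℝ) : ℂ) ^ (1 - s)) / M := by
      rw [progTerm]
      push_cast
      ring_nf
    rw [e]
    refine h.trans ?_
    have hbase : M * (a + M * k) ^ (-s.re - 1) ≤ 4 * ((k : ℝ) + 1) ^ (-(3 / 2) : ℝ) := by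
      have e1 : (a + M * k) ^ (-s.re - 1) ≤ (a + M * k) ^ (-(3 / 2) : ℝ) :=
        Real.rpow_le_rpow_of_exponent_le hy1 (by linarith)
      have e2 : (a + M * k) ^ (-(3 / 2) : ℝ) ≤ (M * ((k + 1) / 2)) ^ (-(3 / 2) : ℝ) := by
        apply Real.rpow_le_rpow_of_nonpos (by positivity) _ (by norm_num)
        nlinarith
      have e3 : (M * (((k : ℝ) + 1) / 2)) ^ (-(3 / 2) : ℝ) =
          M ^ (-(3 / 2) : ℝ) * (2 ^ (3 / 2 : ℝ) * ((k : ℝ) + 1) ^ (-(3 / 2) : ℝ)) := by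
        rw [Real.mul_rpow (by linarith) (by positivity), Real.div_rpow (by positivity) (by norm_num),
          Real.rpow_neg (by norm_num : (0 : ℝ) ≤ 2)]
        field_simp
      have e4 : M * M ^ (-(3 / 2) : ℝ) ≤ 1 := by
        have : M * M ^ (-(3 / 2) : ℝ) = M ^ (-(1 / 2) : ℝ) := by
          conv_lhs => rw [← Real.rpow_one_add' (by linarith) (by norm_num)]
          norm_num
        rw [this]
        exact Real.rpow_le_one_of_one_le_of_nonpos hM (by norm_num)
      have e5 : (2 : ℝ) ^ (3 / 2 : ℝ) ≤ 4 := by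
        calc (2 : ℝ) ^ (3 / 2 : ℝ) ≤ 2 ^ (2 : ℝ) :=
              Real.rpow_le_rpow_of_exponent_le (by norm_num) (by norm_num)
          _ = 4 := by norm_num
      have hk0 : (0 : ℝ) ≤ ((k : ℝ) + 1) ^ (-(3 / 2) : ℝ) := by positivity
      calc M * (a + M * k) ^ (-s.re - 1)
          ≤ M * (M ^ (-(3 / 2) : ℝ) * (2 ^ (3 / 2 : ℝ) * ((k : ℝ) + 1) ^ (-(3 / 2) : ℝ))) := by
            rw [← e3]; gcongr; exact e1.trans e2
        _ = (M * M ^ (-(3 / 2) : ℝ)) * (2 ^ (3 / 2 : ℝ) * ((k : ℝ) + 1) ^ (-(3 / 2) : ℝ)) := by ring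
        _ ≤ 1 * (4 * ((k : ℝ) + 1) ^ (-(3 / 2) : ℝ)) := by gcongr
        _ = _ := one_mul _
    have hk0 : (0 : ℝ) ≤ ((k : ℝ) + 1) ^ (-(3 / 2) : ℝ) := by positivity
    calc ‖s - 1‖ * ‖s‖ * M * (a + M * k) ^ (-s.re - 1)
        = ‖s - 1‖ * ‖s‖ * (M * (a + M * k) ^ (-s.re - 1)) := by ring
      _ ≤ (R + 1) * R * (4 * ((k : ℝ) + 1) ^ (-(3 / 2) : ℝ)) := by gcongr
      _ ≤ _ := by nlinarith

theorem summable_nat_add_one_rpow {σ : ℝ} (h : 1 < σ) :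
    Summable fun k : ℕ => ((k : ℝ) + 1) ^ (-σ) := by
  have := (summable_nat_add_iff 1).mpr (Real.summable_nat_rpow.mpr (by linarith : -σ < -1))
  simpa using this

/-- The constant in the bound for `progZeta` on `‖s‖ ≤ R`. -/
def progBound (R : ℝ) : ℝ :=
  2 + ∑' k : ℕ, (4 * (R + 1) * R + R + 5) * ((k : ℝ) + 1) ^ (-(3 / 2) : ℝ)

theorem summable_progBound (R : ℝ) :
    Summable fun k : ℕ => (4 * (R + 1) * R + R + 5) * ((k : ℝ) + 1) ^ (-(3 / 2) : ℝ) :=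
  (summable_nat_add_one_rpow (by norm_num)).mul_left _

theorem norm_progZeta_le {a M : ℝ} (ha : 1 ≤ a) (haM : a ≤ M) {s : ℂ} (hs : 1 / 2 ≤ s.re) {R : ℝ}
    (hR : ‖s‖ ≤ R) : ‖progZeta a M s‖ ≤ progBound R := by
  refine (norm_add_le _ _).trans (add_le_add ?_ ?_)
  · exact norm_cpow_one_sub_div_le ha (ha.trans haM) (by linarith) (by linarith)
  · exact tsum_of_norm_bounded (summable_progBound R).hasSum fun k => norm_progTerm_le ha haM hs hR k

theorem differentiable_const_cpow {x : ℝ} (hx : 0 < x) {f : ℂ → ℂ} (hf : Differentiable ℂ f) :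
    Differentiable ℂ fun s => (x : ℂ) ^ f s := fun s =>
  (hf s).const_cpow (Or.inl (mod_cast hx.ne'))

theorem differentiable_progTerm {a M : ℝ} (ha : 1 ≤ a) (hM : 1 ≤ M) (k : ℕ) :
    Differentiable ℂ (progTerm a M k) := by
  have h1 : 0 < a + M * k := by positivity
  have h2 : 0 < a + M * (k + 1 : ℕ) := by positivity
  unfold progTerm
  exact ((differentiable_id.sub_const 1).mul (differentiable_const_cpow h1 differentiable_neg)).sub
    (((differentiable_const_cpow h1 (differentiable_id.const_sub 1)).sub
      (differentiable_const_cpow h2 (differentiable_id.const_sub 1))).div_const _)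

theorem differentiableAt_progZeta {a M : ℝ} (ha : 1 ≤ a) (haM : a ≤ M) {s : ℂ} (hs : 1 / 2 < s.re) :
    DifferentiableAt ℂ (progZeta a M) s := by
  have hM : 1 ≤ M := ha.trans haM
  refine DifferentiableAt.add ?_ ?_
  · exact ((differentiable_const_cpow (by linarith) (differentiable_id.const_sub 1)) s).div_const _
  · refine differentiableAt_tsum_of_bound (summable_progBound (‖s‖ + (s.re - 1 / 2)))
      (ρ := s.re - 1 / 2) (by linarith)
      (fun k => (differentiable_progTerm ha hM k).differentiableOn) ?_
    intro k y hy
    have hd : ‖y - s‖ < s.re - 1 / 2 := by simpa [dist_eq_norm] using hy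
    have hre : |(y - s).re| ≤ ‖y - s‖ := Complex.abs_re_le_norm _
    refine norm_progTerm_le ha haM ?_ ?_ k
    · have := (abs_le.mp hre).1
      simp only [Complex.sub_re] at this
      linarith
    · have : ‖y‖ ≤ ‖s‖ + ‖y - s‖ := by
        calc ‖y‖ = ‖s + (y - s)‖ := by congr 1; ring
          _ ≤ _ := norm_add_le _ _
      linarith

theorem norm_prog_cpow_le {a M : ℝ} (ha : 1 ≤ a) (hM : 1 ≤ M) {s : ℂ} (hs : 0 ≤ s.re) (k : ℕ) :
    ‖((a + M * k : ℝ) : ℂ) ^ (-s)‖ ≤ ((k : ℝ) + 1) ^ (-s.re) := by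
  have hk : (0 : ℝ) ≤ k := Nat.cast_nonneg k
  rw [Complex.norm_cpow_eq_rpow_re_of_pos (by positivity), Complex.neg_re]
  exact Real.rpow_le_rpow_of_nonpos (by positivity) (by nlinarith) (by linarith)

theorem summable_prog_cpow {a M : ℝ} (ha : 1 ≤ a) (hM : 1 ≤ M) {s : ℂ} (hs : 1 < s.re) :
    Summable fun k : ℕ => ((a + M * k : ℝ) : ℂ) ^ (-s) :=
  (summable_nat_add_one_rpow hs).of_norm_bounded fun k =>
    norm_prog_cpow_le ha hM (by linarith) k

/-- In the region of absolute convergence the integrals telescope. -/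
theorem progZeta_eq {a M : ℝ} (ha : 1 ≤ a) (haM : a ≤ M) {s : ℂ} (hs : 1 < s.re) :
    progZeta a M s = (s - 1) * ∑' k : ℕ, ((a + M * k : ℝ) : ℂ) ^ (-s) := by
  have hM : 1 ≤ M := ha.trans haM
  have h1 := (summable_prog_cpow ha hM hs).mul_left (s - 1)
  have h2 : Summable fun k => progTerm a M k s :=
    (summable_progBound ‖s‖).of_norm_bounded fun k =>
      norm_progTerm_le ha haM (by linarith) le_rfl k
  have h3 := (h1.sub h2).hasSum
  have h4 := h3.tendsto_sum_nat
  have e : ∀ n, ∑ k ∈ Finset.range n, ((s - 1) * ((a + M * k : ℝ) : ℂ) ^ (-s) - progTerm a M k s) =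
      (a : ℂ) ^ (1 - s) / M - ((a + M * n : ℝ) : ℂ) ^ (1 - s) / M := by
    intro n
    have := Finset.sum_range_sub' (fun k : ℕ => ((a + M * k : ℝ) : ℂ) ^ (1 - s) / M) n
    simp only [Nat.cast_zero, mul_zero, add_zero] at this
    rw [← this]
    refine Finset.sum_congr rfl fun k _ => ?_
    rw [progTerm]
    ring
  have hlim : Tendsto (fun n : ℕ => ((a + M * n : ℝ) : ℂ) ^ (1 - s) / M) atTop (𝓝 0) := by
    rw [tendsto_zero_iff_norm_tendsto_zero]
    have : Tendsto (fun n : ℕ => ((n : ℝ) + 1) ^ (-(s.re - 1)) / M) atTop (𝓝 (0 / M)) := by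
      refine Tendsto.div_const ?_ _
      exact (tendsto_rpow_neg_atTop (by linarith)).comp
        (tendsto_natCast_atTop_atTop.atTop_add tendsto_const_nhds)
    rw [zero_div] at this
    refine squeeze_zero (fun n => norm_nonneg _) (fun n => ?_) this
    rw [norm_div, Complex.norm_real, Real.norm_of_nonneg (by linarith : 0 ≤ M)]
    gcongr
    have := norm_prog_cpow_le ha hM (s := s - 1) (by simp; linarith) n
    simpa using this
  simp_rw [e] at h4
  have h5 := tendsto_nhds_unique h4 (tendsto_const_nhds.sub hlim)
  rw [h1.tsum_sub h2, tsum_mul_left, sub_zero] at h5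
  rw [progZeta, ← h5]
  ring

theorem progZeta_one {a M : ℝ} : progZeta a M 1 = 1 / M := by
  simp [progZeta, progTerm]

/-! ### Non-maximal reducible forms -/

theorem exists_root_of_nonMaximal {p : ℕ} (hp : p.Prime) {b c d : ℤ} (hb : ¬ (p : ℤ) ∣ b)
    (g : Matrix.GeneralLinearGroup (Fin 2) ℤ)
    (h0 : (p : ℤ) ^ 2 ∣ cubicAct g.val (reducibleForm ![b, c, d]) 0)
    (h1 : (p : ℤ) ∣ cubicAct g.val (reducibleForm ![b, c, d]) 1) :
    ∃ r : ℤ, (p : ℤ) ∣ c + 2 * b * r ∧ (p : ℤ) ^ 2 ∣ b * r ^ 2 + c * r + d := by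
  have hpp : Prime (p : ℤ) := Nat.prime_iff_prime_int.mp hp
  have hdet : IsUnit g.val.det := (Matrix.isUnit_iff_isUnit_det _).mp g.isUnit
  rw [Matrix.det_fin_two] at hdet
  simp only [cubicAct, reducibleForm, Matrix.cons_val] at h0 h1
  generalize g.val 0 0 = α at *
  generalize g.val 0 1 = β at *
  generalize g.val 1 0 = γ at *
  generalize g.val 1 1 = δ at *
  have hnu : ¬ (p : ℤ) ∣ α * δ - β * γ := fun h => hpp.not_isUnit (isUnit_of_dvd_unit h hdet)
  have hβ : ¬ (p : ℤ) ∣ β := by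
    rintro ⟨m, rfl⟩
    have e : (p : ℤ) ∣ α ^ 2 * δ * b := by
      have h2 : (p : ℤ) ∣ p * (2 * α * γ * m * b + c * (γ * p * m ^ 2 + 2 * α * m * δ)
          + 3 * d * p * m ^ 2 * δ) := dvd_mul_right _ _
      have := dvd_sub h1 h2
      ring_nf at this ⊢
      exact this
    rcases hpp.dvd_or_dvd e with h | h
    · apply hnu
      have hαδ : (p : ℤ) ∣ α * δ := by
        rcases hpp.dvd_or_dvd h with h | h
        · exact (hpp.dvd_of_dvd_pow h).mul_right _
        · exact h.mul_left _
      exact dvd_sub hαδ (by rw [mul_assoc]; exact dvd_mul_right _ _)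
    · exact hb h
  have hcop : IsCoprime ((p : ℤ) ^ 2) β :=
    ((Prime.coprime_iff_not_dvd hpp).mpr hβ).pow_left
  -- the quadratic factor vanishes at the root modulo `p ^ 2`
  have hQ : (p : ℤ) ^ 2 ∣ b * α ^ 2 + c * α * β + d * β ^ 2 := by
    apply hcop.dvd_of_dvd_mul_left
    have e : β * (b * α ^ 2 + c * α * β + d * β ^ 2) =
        0 * α ^ 3 + b * α ^ 2 * β + c * α * β ^ 2 + d * β ^ 3 := by ring
    rw [e]
    exact h0
  obtain ⟨x, y, hxy⟩ := hcop
  have hα : (p : ℤ) ^ 2 ∣ α - α * y * β := ⟨α * x, by linear_combination (-α) * hxy⟩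
  refine ⟨α * y, ?_, ?_⟩
  · have hpQ : (p : ℤ) ∣ b * α ^ 2 + c * α * β + d * β ^ 2 := (Dvd.intro_left _ (by ring)).trans hQ
    have h2 : (p : ℤ) ∣ β * (γ * (2 * b * α + c * β) + δ * (c * α + 2 * d * β)) := by
      have e : β * (γ * (2 * b * α + c * β) + δ * (c * α + 2 * d * β)) =
          (0 * α ^ 3 + b * (2 * α * γ * β + α ^ 2 * δ) + c * (γ * β ^ 2 + 2 * α * β * δ)
            + 3 * d * β ^ 2 * δ) - δ * (b * α ^ 2 + c * α * β + d * β ^ 2) := by ring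
      rw [e]
      refine dvd_sub ?_ (hpQ.mul_left _)
      ring_nf at h1 ⊢
      exact h1
    have h3 : (p : ℤ) ∣ (α * δ - β * γ) * (2 * b * α + c * β) := by
      have e : (α * δ - β * γ) * (2 * b * α + c * β) =
          δ * (2 * (b * α ^ 2 + c * α * β + d * β ^ 2)) -
          β * (γ * (2 * b * α + c * β) + δ * (c * α + 2 * d * β)) := by ring
      rw [e]
      exact dvd_sub ((hpQ.mul_left _).mul_left _) h2
    have h4 := (hpp.dvd_or_dvd h3).resolve_left hnu
    have h5 : (p : ℤ) ∣ β * (c + 2 * b * (α * y)) := by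
      have hα1 : (p : ℤ) ∣ α - α * y * β := (Dvd.intro_left _ (by ring)).trans hα
      have e : β * (c + 2 * b * (α * y)) = (2 * b * α + c * β) - 2 * b * (α - α * y * β) := by ring
      rw [e]
      exact dvd_sub h4 (hα1.mul_left _)
    exact (hpp.dvd_or_dvd h5).resolve_left hβ
  · have e : b * (α * y) ^ 2 + c * (α * y) + d =
        y ^ 2 * (b * α ^ 2 + c * α * β + d * β ^ 2) + p ^ 2 * (x * (c * α * y + d * (1 + y * β))) := by
      linear_combination (-(c * α * y) - d * (1 + y * β)) * hxy
    rw [e]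
    exact dvd_add (hQ.mul_left _) (dvd_mul_right _ _)

/-- A reducible form is non-maximal at `p` when the linear factor is a double root modulo `p`, or
when the quadratic factor has a double root `r` modulo `p` at which it vanishes modulo `p²`. -/
theorem nonMaximalAt_reducible_iff {p : ℕ} (hp : p.Prime) (b c d : ℤ) :
    NonMaximalAt p (reducibleForm ![b, c, d]) ↔
      (p : ℤ) ∣ b ∨ ∃ r : ℤ, (p : ℤ) ∣ c + 2 * b * r ∧ (p : ℤ) ^ 2 ∣ b * r ^ 2 + c * r + d := by
  constructor
  · rintro (h | ⟨g, h0, h1⟩)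
    · exact Or.inl (by simpa [reducibleForm] using h 1)
    · by_cases hb : (p : ℤ) ∣ b
      · exact Or.inl hb
      · exact Or.inr (exists_root_of_nonMaximal hp hb g h0 h1)
  · rintro (h | ⟨r, h1, h2⟩)
    · exact Or.inr ⟨1, by simp [cubicAct, reducibleForm], by simpa [cubicAct, reducibleForm] using h⟩
    · let g : Matrix.GeneralLinearGroup (Fin 2) ℤ :=
        ⟨!![r, 1; -1, 0], !![0, -1; 1, r], by simp [Matrix.one_fin_two], by simp [Matrix.one_fin_two]⟩
      refine Or.inr ⟨g, ?_, ?_⟩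
      · simpa [cubicAct, reducibleForm, g] using h2
      · have e : 3 * 0 * r ^ 2 * -1 + b * (2 * r * -1 * 1 + r ^ 2 * 0) +
            c * (-1 * 1 ^ 2 + 2 * r * 1 * 0) + 3 * d * 1 ^ 2 * 0 = -(c + 2 * b * r) := by ring
        simp only [cubicAct, reducibleForm, g, Matrix.cons_val, Matrix.of_apply]
        rw [e]
        exact (dvd_neg).mpr h1

theorem nonMaximalAt_translate {p : ℕ} (hp : p.Prime) (b c d m : ℤ) :
    NonMaximalAt p (reducibleForm ![b, c + 2 * b * m, b * m ^ 2 + c * m + d]) ↔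
      NonMaximalAt p (reducibleForm ![b, c, d]) := by
  rw [nonMaximalAt_reducible_iff hp, nonMaximalAt_reducible_iff hp]
  refine or_congr Iff.rfl ⟨?_, ?_⟩
  · rintro ⟨r, h1, h2⟩
    refine ⟨r + m, ?_, ?_⟩
    · convert h1 using 1; ring
    · convert h2 using 1; ring
  · rintro ⟨r, h1, h2⟩
    refine ⟨r - m, ?_, ?_⟩
    · convert h1 using 1; ring
    · convert h2 using 1; ring

theorem nonMaximalAt_periodic {p : ℕ} (hp : p.Prime) (b c : ℤ) {d d' : ℤ}
    (h : (p : ℤ) ^ 2 ∣ d' - d) :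
    NonMaximalAt p (reducibleForm ![b, c, d']) ↔ NonMaximalAt p (reducibleForm ![b, c, d]) := by
  rw [nonMaximalAt_reducible_iff hp, nonMaximalAt_reducible_iff hp]
  refine or_congr Iff.rfl (exists_congr fun r => and_congr Iff.rfl ?_)
  have e : b * r ^ 2 + c * r + d' = (b * r ^ 2 + c * r + d) + (d' - d) := by ring
  rw [e, dvd_add_left h]

open Classical in
/-- The indicator function of non-maximality at one prime. -/
def nonMaxAtInd (p : ℕ) (b c d : ℤ) : ℂ :=
  if NonMaximalAt p (reducibleForm ![b, c, d]) then 1 else 0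

theorem nonMaxIndRed_eq (q : ℕ) (b c d : ℤ) :
    nonMaxIndRed q ![b, c, d] = ∏ p ∈ q.primeFactors, nonMaxAtInd p b c d := rfl

theorem nonMaxIndRed_translate (q : ℕ) (b c d m : ℤ) :
    nonMaxIndRed q ![b, c + 2 * b * m, b * m ^ 2 + c * m + d] = nonMaxIndRed q ![b, c, d] := by
  rw [nonMaxIndRed_eq, nonMaxIndRed_eq]
  refine Finset.prod_congr rfl fun p hp => ?_
  rw [nonMaxAtInd, nonMaxAtInd, nonMaximalAt_translate (Nat.prime_of_mem_primeFactors hp)]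

theorem nonMaxIndRed_periodic (q : ℕ) (b c : ℤ) {d d' : ℤ} (h : (q : ℤ) ^ 2 ∣ d' - d) :
    nonMaxIndRed q ![b, c, d'] = nonMaxIndRed q ![b, c, d] := by
  rw [nonMaxIndRed_eq, nonMaxIndRed_eq]
  refine Finset.prod_congr rfl fun p hp => ?_
  rw [nonMaxAtInd, nonMaxAtInd, nonMaximalAt_periodic (Nat.prime_of_mem_primeFactors hp)]
  refine dvd_trans (pow_dvd_pow_of_dvd ?_ 2) h
  exact_mod_cast Nat.dvd_of_mem_primeFactors hp

theorem norm_nonMaxInd_le (q : ℕ) (x : Fin 4 → ℤ) : ‖nonMaxInd q x‖ ≤ 1 := by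
  rw [nonMaxInd, norm_prod]
  refine Finset.prod_le_one (fun _ _ => norm_nonneg _) fun p _ => ?_
  split_ifs <;> simp

/-! ### Densities of non-maximal forms -/

theorem sum_range_eq_sum_zmod (N : ℕ) [NeZero N] (G : ZMod N → ℂ) :
    ∑ k ∈ Finset.range N, G (k : ZMod N) = ∑ x, G x := by
  refine Finset.sum_nbij' (fun k => (k : ZMod N)) ZMod.val ?_ ?_ ?_ ?_ ?_
  · simp
  · intro x _; simpa using ZMod.val_lt x
  · intro k hk; exact ZMod.val_cast_of_lt (Finset.mem_range.mp hk)
  · intro x _; simp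
  · simp

theorem exists_zmod_lift (N : ℕ) [NeZero N] {F : ℤ → ℂ}
    (hF : ∀ x y : ℤ, (N : ℤ) ∣ x - y → F x = F y) :
    ∃ G : ZMod N → ℂ, ∀ x : ℤ, F x = G x := by
  refine ⟨fun x => F x.val, fun x => hF _ _ ?_⟩
  rw [ZMod.val_intCast]
  exact Int.dvd_self_sub_emod

theorem sum_range_shift {N : ℕ} [NeZero N] {F : ℤ → ℂ}
    (hF : ∀ x y : ℤ, (N : ℤ) ∣ x - y → F x = F y) {σ : ℤ} (hσ : σ * σ = 1) (e : ℤ) :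
    ∑ k ∈ Finset.range N, F (σ * (e + k)) = ∑ k ∈ Finset.range N, F k := by
  obtain ⟨G, hG⟩ := exists_zmod_lift N hF
  simp_rw [hG]
  push_cast
  rw [sum_range_eq_sum_zmod N (fun x : ZMod N => G ((σ : ZMod N) * ((e : ZMod N) + x))), sum_range_eq_sum_zmod N G]
  have hσ' : (σ : ZMod N) * σ = 1 := by exact_mod_cast congrArg (Int.cast : ℤ → ZMod N) hσ
  refine Fintype.sum_equiv
    ⟨fun x : ZMod N => (σ : ZMod N) * ((e : ZMod N) + x), fun y => (σ : ZMod N) * y - e,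
      fun x => ?_, fun y => ?_⟩ _ _ fun x => rfl
  · linear_combination (e + x) * hσ'
  · linear_combination y * hσ'

/-- The Chinese remainder theorem for sums over residue classes. -/
theorem sum_range_mul_coprime {m n : ℕ} [NeZero m] [NeZero n] (h : m.Coprime n) {f g : ℤ → ℂ}
    (hf : ∀ x y : ℤ, (m : ℤ) ∣ x - y → f x = f y) (hg : ∀ x y : ℤ, (n : ℤ) ∣ x - y → g x = g y) :
    ∑ k ∈ Finset.range (m * n), f k * g k =
      (∑ k ∈ Finset.range m, f k) * ∑ k ∈ Finset.range n, g k := by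
  obtain ⟨F, hF⟩ := exists_zmod_lift m hf
  obtain ⟨G, hG⟩ := exists_zmod_lift n hg
  simp_rw [hF, hG, Int.cast_natCast]
  rw [sum_range_eq_sum_zmod m F, sum_range_eq_sum_zmod n G, Finset.sum_mul_sum,
    ← Fintype.sum_prod_type']
  have e : ∀ k : ℕ, F k * G k = (fun x : ZMod (m * n) => F (ZMod.chineseRemainder h x).1 *
      G (ZMod.chineseRemainder h x).2) k := by
    intro k
    simp
  simp_rw [e]
  rw [sum_range_eq_sum_zmod (m * n) (fun x : ZMod (m * n) => F (ZMod.chineseRemainder h x).1 *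
      G (ZMod.chineseRemainder h x).2)]
  exact Fintype.sum_equiv (ZMod.chineseRemainder h).toEquiv _ _ fun x => rfl

theorem sum_range_prod_coprime (S : Finset ℕ) (hS : ∀ p ∈ S, p.Prime) (f : ℕ → ℤ → ℂ)
    (hf : ∀ p ∈ S, ∀ x y : ℤ, (p : ℤ) ^ 2 ∣ x - y → f p x = f p y) :
    ∑ k ∈ Finset.range ((∏ p ∈ S, p) ^ 2), ∏ p ∈ S, f p k =
      ∏ p ∈ S, ∑ k ∈ Finset.range (p ^ 2), f p k := by
  induction S using Finset.induction_on with
  | empty => simp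
  | insert p S hpS ih =>
    have hp := hS p (Finset.mem_insert_self _ _)
    have hS' : ∀ r ∈ S, r.Prime := fun r hr => hS r (Finset.mem_insert_of_mem hr)
    have hne : NeZero (p ^ 2) := ⟨pow_ne_zero 2 hp.ne_zero⟩
    have hne' : NeZero ((∏ r ∈ S, r) ^ 2) :=
      ⟨pow_ne_zero 2 (Finset.prod_ne_zero_iff.mpr fun r hr => (hS' r hr).ne_zero)⟩
    have hcop : (p ^ 2).Coprime ((∏ r ∈ S, r) ^ 2) := by
      refine Nat.Coprime.pow 2 2 (Nat.Coprime.prod_right fun r hr => ?_)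
      rw [Nat.coprime_primes hp (hS' r hr)]
      rintro rfl
      exact hpS hr
    rw [Finset.prod_insert hpS, mul_pow, Finset.prod_insert hpS, ← ih hS'
      (fun r hr => hf r (Finset.mem_insert_of_mem hr)), ← sum_range_mul_coprime hcop (f := f p)
      (g := fun d => ∏ r ∈ S, f r d)]
    · simp_rw [Finset.prod_insert hpS]
    · intro x y h
      exact hf p (Finset.mem_insert_self _ _) x y (by exact_mod_cast h)
    · intro x y h
      refine Finset.prod_congr rfl fun r hr => hf r (Finset.mem_insert_of_mem hr) x y ?_
      refine dvd_trans (b := (((∏ r ∈ S, r : ℕ) : ℤ)) ^ 2) (pow_dvd_pow_of_dvd ?_ 2)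
        (by exact_mod_cast h)
      exact_mod_cast Finset.dvd_prod_of_mem (fun r : ℕ => r) hr

/-- The density of the non-maximal forms among the reducible forms with first coefficient `b`. -/
def density (p : ℕ) (b : ℤ) : ℂ := if (p : ℤ) ∣ b then 1 else 1 / (p : ℂ) ^ 2

/-- The dependence on `c` of the number of non-maximal classes `d` modulo `p²`. At the prime `2` the
coefficient `c` has to be even, unless `b` is. -/
def parityFactor (p : ℕ) (b c : ℤ) : ℂ :=
  if p = 2 ∧ ¬ (2 : ℤ) ∣ b then (if (2 : ℤ) ∣ c then 2 else 0) else 1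

/-- The number of classes `d` modulo `p²` for which `(0, b, c, d)` is non-maximal at `p`. For
`p ∤ b` the quadratic form `(b, c, d)` has to have a double root modulo `p` whose lift is a root modulo
`p²`; this determines `d` unless `p = 2`. -/
theorem sum_nonMaxAtInd {p : ℕ} (hp : p.Prime) (b c : ℤ) :
    ∑ k ∈ Finset.range (p ^ 2), nonMaxAtInd p b c k =
      (p : ℂ) ^ 2 * density p b * parityFactor p b c := by
  classical
  have hp0 : (p : ℂ) ≠ 0 := mod_cast hp.ne_zero
  by_cases hb : (p : ℤ) ∣ b
  · have h1 : ∀ k : ℤ, nonMaxAtInd p b c k = 1 := fun k => by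
      rw [nonMaxAtInd, if_pos ((nonMaximalAt_reducible_iff hp b c k).mpr (Or.inl hb))]
    have h2 : parityFactor p b c = 1 := by
      rw [parityFactor, if_neg]
      rintro ⟨rfl, h⟩
      exact h (by exact_mod_cast hb)
    simp [h1, h2, density, hb]
  · have hd : (p : ℂ) ^ 2 * density p b = 1 := by
      rw [density, if_neg hb]; field_simp
    rw [hd, one_mul]
    rcases eq_or_ne p 2 with rfl | h2
    · have hb' : ¬ (2 : ℤ) ∣ b := by exact_mod_cast hb
      rw [parityFactor, if_pos ⟨rfl, hb'⟩]
      have key : ∀ k : ℤ, NonMaximalAt 2 (reducibleForm ![b, c, k]) ↔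
          (2 : ℤ) ∣ c ∧ ((4 : ℤ) ∣ k ∨ (4 : ℤ) ∣ b + c + k) := by
        intro k
        rw [nonMaximalAt_reducible_iff Nat.prime_two]
        constructor
        · rintro (h | ⟨r, h1, h2⟩)
          · exact absurd h hb
          · have hc : (2 : ℤ) ∣ c := (dvd_add_left ⟨b * r, by ring⟩).mp h1
            refine ⟨hc, ?_⟩
            obtain ⟨c', rfl⟩ := hc
            push_cast at h2
            rcases Int.even_or_odd' r with ⟨j, rfl | rfl⟩
            · left
              have e : b * (2 * j) ^ 2 + 2 * c' * (2 * j) + k = 4 * (b * j ^ 2 + c' * j) + k := by ring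
              rw [e] at h2; omega
            · right
              have e : b * (2 * j + 1) ^ 2 + 2 * c' * (2 * j + 1) + k =
                4 * (b * j ^ 2 + b * j + c' * j) + (b + 2 * c' + k) := by ring
              rw [e] at h2; omega
        · rintro ⟨hc, h | h⟩
          · exact Or.inr ⟨0, by push_cast; simpa using hc, by push_cast; simpa using h⟩
          · exact Or.inr ⟨1, by push_cast; omega, by push_cast; ring_nf; omega⟩
      simp only [nonMaxAtInd, key]
      by_cases hc : (2 : ℤ) ∣ c
      · simp only [hc, true_and, if_true]
        rw [show (2 : ℕ) ^ 2 = 4 by norm_num, Finset.sum_range_succ, Finset.sum_range_succ,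
          Finset.sum_range_succ, Finset.sum_range_succ, Finset.sum_range_zero]
        have h13 : (b + c) % 4 = 1 ∨ (b + c) % 4 = 3 := by omega
        rcases h13 with h | h
        · rw [if_pos (by omega), if_neg (by omega), if_neg (by omega), if_pos (by omega)]
          norm_num
        · rw [if_pos (by omega), if_pos (by omega), if_neg (by omega), if_neg (by omega)]
          norm_num
      · simp [hc]
    · rw [parityFactor, if_neg (fun h => h2 h.1)]
      have hpp : Prime (p : ℤ) := Nat.prime_iff_prime_int.mp hp
      have hp2 : ¬ (p : ℤ) ∣ 2 := by
        intro h
        have : p ∣ 2 := by exact_mod_cast h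
        exact h2 ((Nat.prime_dvd_prime_iff_eq hp Nat.prime_two).mp this)
      have h2b : ¬ (p : ℤ) ∣ 2 * b := fun h => (hpp.dvd_or_dvd h).elim hp2 hb
      obtain ⟨x, y, hxy⟩ := (Prime.coprime_iff_not_dvd hpp).mpr h2b
      -- the double root modulo `p`
      obtain ⟨r₀, hr₀⟩ : ∃ r₀ : ℤ, r₀ = -c * y := ⟨_, rfl⟩
      have hr : (p : ℤ) ∣ c + 2 * b * r₀ := ⟨c * x, by rw [hr₀]; linear_combination (-c) * hxy⟩
      have key : ∀ k : ℤ, NonMaximalAt p (reducibleForm ![b, c, k]) ↔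
          (p : ℤ) ^ 2 ∣ b * r₀ ^ 2 + c * r₀ + k := by
        intro k
        rw [nonMaximalAt_reducible_iff hp]
        constructor
        · rintro (h | ⟨r, h1, h3⟩)
          · exact absurd h hb
          · have hd1 : (p : ℤ) ∣ r₀ - r := by
              have : (p : ℤ) ∣ 2 * b * (r₀ - r) := by
                have e : 2 * b * (r₀ - r) = (c + 2 * b * r₀) - (c + 2 * b * r) := by ring
                rw [e]
                exact dvd_sub hr h1
              exact (hpp.dvd_or_dvd this).resolve_left h2b
            have hd2 : (p : ℤ) ∣ b * (r₀ + r) + c := by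
              have e : b * (r₀ + r) + c = (c + 2 * b * r₀) - b * (r₀ - r) := by ring
              rw [e]
              exact dvd_sub hr (hd1.mul_left b)
            have e : b * r₀ ^ 2 + c * r₀ + k =
                (r₀ - r) * (b * (r₀ + r) + c) + (b * r ^ 2 + c * r + k) := by ring
            rw [e]
            refine dvd_add ?_ h3
            rw [pow_two]
            exact mul_dvd_mul hd1 hd2
        · exact fun h => Or.inr ⟨r₀, hr, h⟩
      have hne : NeZero (p ^ 2) := ⟨pow_ne_zero 2 hp.ne_zero⟩
      have hper : ∀ x y : ℤ, ((p ^ 2 : ℕ) : ℤ) ∣ x - y →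
          nonMaxAtInd p b c x = nonMaxAtInd p b c y := by
        intro x y h
        rw [nonMaxAtInd, nonMaxAtInd, nonMaximalAt_periodic hp b c (by exact_mod_cast h)]
      -- a shift moves the only class to zero
      rw [← sum_range_shift hper (σ := 1) (by norm_num) (-(b * r₀ ^ 2 + c * r₀))]
      simp only [nonMaxAtInd, key]
      rw [Finset.sum_eq_single_of_mem 0 (Finset.mem_range.mpr (pow_pos hp.pos 2))]
      · rw [if_pos]; simp
      · intro k hk hk0
        rw [if_neg]
        intro h
        have h' : p ^ 2 ∣ k := by
          have e : b * r₀ ^ 2 + c * r₀ + 1 * (-(b * r₀ ^ 2 + c * r₀) + (k : ℤ)) = k := by ring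
          rw [e] at h
          exact_mod_cast h
        exact hk0 (Nat.eq_zero_of_dvd_of_lt h' (Finset.mem_range.mp hk))

theorem sum_range_even (n : ℕ) :
    ∑ c ∈ Finset.range (2 * n), (if (2 : ℤ) ∣ (c : ℤ) then (2 : ℂ) else 0) = 2 * n := by
  induction n with
  | zero => simp
  | succ n ih =>
    rw [show 2 * (n + 1) = 2 * n + 1 + 1 by ring, Finset.sum_range_succ, Finset.sum_range_succ, ih,
      if_pos (by push_cast; omega), if_neg (by push_cast; omega)]
    push_cast
    ring

/-- The non-maximal forms in a box: the dependence on the parity of `c` at the prime `2` averages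
out, so that the count is the product of the local densities. -/
theorem sum_nonMaxIndRed {q : ℕ} (hq : Squarefree q) (b : ℤ) {σ : ℤ} (hσ : σ * σ = 1) (e : ℕ → ℤ) :
    ∑ c ∈ Finset.range (2 * b.natAbs), ∑ k ∈ Finset.range (q ^ 2),
      nonMaxIndRed q ![b, c, σ * (e c + k)] =
    2 * b.natAbs * (q : ℂ) ^ 2 * ∏ p ∈ q.primeFactors, density p b := by
  have hq0 : q ≠ 0 := hq.ne_zero
  have hne : NeZero (q ^ 2) := ⟨pow_ne_zero 2 hq0⟩
  have hqprod : ∏ p ∈ q.primeFactors, p = q := Nat.prod_primeFactors_of_squarefree hq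
  have hinner : ∀ c : ℕ, ∑ k ∈ Finset.range (q ^ 2), nonMaxIndRed q ![b, c, σ * (e c + k)] =
      ((q : ℂ) ^ 2 * ∏ p ∈ q.primeFactors, density p b) *
        ∏ p ∈ q.primeFactors, parityFactor p b c := by
    intro c
    -- a complete set of residues modulo `q²` may be shifted and reflected
    rw [sum_range_shift (F := fun d => nonMaxIndRed q ![b, c, d])
      (fun x y h => nonMaxIndRed_periodic q b c (by exact_mod_cast h)) hσ (e c)]
    simp_rw [nonMaxIndRed_eq]
    conv_lhs => rw [← hqprod]
    rw [Nat.primeFactors_prod (fun p hp => Nat.prime_of_mem_primeFactors hp),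
      sum_range_prod_coprime _ (fun p hp => Nat.prime_of_mem_primeFactors hp)
      (fun p d => nonMaxAtInd p b c d)]
    · rw [Finset.prod_congr rfl fun p hp =>
        sum_nonMaxAtInd (Nat.prime_of_mem_primeFactors hp) b c]
      rw [Finset.prod_mul_distrib, Finset.prod_mul_distrib, Finset.prod_pow, ← Nat.cast_prod, hqprod]
    · intro p hp x y h
      rw [nonMaxAtInd, nonMaxAtInd, nonMaximalAt_periodic (Nat.prime_of_mem_primeFactors hp) b c h]
  simp_rw [hinner]
  rw [← Finset.mul_sum]
  -- the mean of `parityFactor` over `c` modulo `2b` is `1`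
  have hpar : ∑ c ∈ Finset.range (2 * b.natAbs), ∏ p ∈ q.primeFactors, parityFactor p b c =
      2 * b.natAbs := by
    by_cases h : 2 ∈ q.primeFactors ∧ ¬ (2 : ℤ) ∣ b
    · have h2 : ∀ c : ℤ, ∏ p ∈ q.primeFactors, parityFactor p b c = if (2 : ℤ) ∣ c then 2 else 0 := by
        intro c
        rw [Finset.prod_eq_single_of_mem 2 h.1]
        · rw [parityFactor, if_pos ⟨rfl, h.2⟩]
        · intro p _ hp2
          rw [parityFactor, if_neg (fun h => hp2 h.1)]
      simp_rw [h2]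
      exact sum_range_even _
    · have h2 : ∀ c : ℤ, ∏ p ∈ q.primeFactors, parityFactor p b c = 1 := by
        intro c
        refine Finset.prod_eq_one fun p hp => ?_
        rw [parityFactor, if_neg]
        rintro ⟨rfl, h3⟩
        exact h ⟨hp, h3⟩
      simp [h2]
  rw [hpar]
  ring

/-! ### The Euler product of the densities -/

theorem norm_density_le (p : ℕ) (b : ℤ) : ‖density p b‖ ≤ 1 := by
  rw [density]
  split_ifs
  · simp
  · rcases Nat.eq_zero_or_pos p with rfl | hp
    · simp
    · rw [norm_div, norm_one, norm_pow, Complex.norm_natCast, one_div]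
      apply inv_le_one_of_one_le₀
      exact one_le_pow₀ (mod_cast hp)

theorem norm_prod_density_le (S : Finset ℕ) (b : ℤ) : ‖∏ p ∈ S, density p b‖ ≤ 1 := by
  rw [norm_prod]
  exact Finset.prod_le_one (fun _ _ => norm_nonneg _) fun p _ => norm_density_le p b

theorem summable_prod_density (S : Finset ℕ) {s : ℂ} (hs : 1 < s.re) :
    Summable fun n : ℕ => (∏ p ∈ S, density p n) * (n : ℂ) ^ (-s) := by
  have h := (Complex.summable_one_div_nat_cpow.mpr hs).norm
  refine h.of_norm_bounded fun n => ?_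
  rw [norm_mul, Complex.cpow_neg, one_div]
  exact mul_le_of_le_one_left (norm_nonneg _) (norm_prod_density_le S n)

theorem density_mul_of_ne {p r : ℕ} (hp : p.Prime) (hr : r.Prime) (h : r ≠ p) (n : ℕ) :
    density r ((p * n : ℕ) : ℤ) = density r n := by
  have : (r : ℤ) ∣ ((p * n : ℕ) : ℤ) ↔ (r : ℤ) ∣ (n : ℤ) := by
    rw [Int.natCast_dvd_natCast, Int.natCast_dvd_natCast]
    refine ⟨fun hd => ?_, fun hd => hd.mul_left _⟩
    exact Nat.Coprime.dvd_of_dvd_mul_left ((Nat.coprime_primes hr hp).mpr h) hd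
  simp only [density, this]

/-- By induction on `S`: the terms divisible by `p` are split off, and there the substitution
`n = p m` multiplies the series by `p^(-s)`. -/
theorem tsum_prod_density (S : Finset ℕ) (hS : ∀ p ∈ S, p.Prime) {s : ℂ} (hs : 1 < s.re) :
    ∑' n : ℕ, (∏ p ∈ S, density p n) * (n : ℂ) ^ (-s) =
      riemannZeta s * ∏ p ∈ S, (1 / (p : ℂ) ^ 2 + 1 / (p : ℂ) ^ s - 1 / (p : ℂ) ^ (2 + s)) := by
  induction S using Finset.induction_on with
  | empty =>
    simp only [Finset.prod_empty, one_mul, mul_one]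
    rw [zeta_eq_tsum_one_div_nat_cpow hs]
    exact tsum_congr fun n => by rw [Complex.cpow_neg, one_div]
  | insert p S hpS ih =>
    have hp := hS p (Finset.mem_insert_self _ _)
    have hS' : ∀ r ∈ S, r.Prime := fun r hr => hS r (Finset.mem_insert_of_mem hr)
    have hp0 : (p : ℂ) ≠ 0 := mod_cast hp.ne_zero
    have hs0 : -s ≠ 0 := fun h => by
      have := congrArg Complex.re h
      simp at this
      linarith
    -- the multiples of `p`
    set F : ℕ → ℂ := fun n => (∏ r ∈ S, density r n) * (n : ℂ) ^ (-s) with hF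
    have hsum : Summable F := summable_prod_density S hs
    set G : ℕ → ℂ := fun n => if p ∣ n then F n else 0 with hG
    have hGF : ∀ n, G (p * n) = (p : ℂ) ^ (-s) * F n := by
      intro n
      have e : ∏ r ∈ S, density r ((p * n : ℕ) : ℤ) = ∏ r ∈ S, density r n :=
        Finset.prod_congr rfl fun r hr => density_mul_of_ne hp (hS' r hr)
          (fun h => hpS (h ▸ hr)) n
      simp only [hG, hF, if_pos (dvd_mul_right p n)]
      rw [e, Nat.cast_mul, Complex.natCast_mul_natCast_cpow]
      ring
    have hinj : Function.Injective fun n : ℕ => p * n := fun a b h =>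
      Nat.eq_of_mul_eq_mul_left hp.pos h
    have hsupp : Function.support G ⊆ Set.range fun n : ℕ => p * n := by
      intro n hn
      by_cases h : p ∣ n
      · obtain ⟨m, rfl⟩ := h; exact ⟨m, rfl⟩
      · simp [hG, h] at hn
    have hGsum : ∑' n, G n = (p : ℂ) ^ (-s) * ∑' n, F n := by
      rw [← hinj.tsum_eq hsupp, ← tsum_mul_left]
      exact tsum_congr hGF
    have hGs : Summable G := hsum.norm.of_norm_bounded fun n => by
      simp only [hG]; split_ifs <;> simp
    have e : ∀ n : ℕ, (∏ r ∈ insert p S, density r n) * (n : ℂ) ^ (-s) =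
        1 / (p : ℂ) ^ 2 * F n + (1 - 1 / (p : ℂ) ^ 2) * G n := by
      intro n
      have e1 : (∏ r ∈ insert p S, density r n) * (n : ℂ) ^ (-s) = density p n * F n := by
        rw [Finset.prod_insert hpS, mul_assoc]
      rw [e1]
      simp only [hG, density, Int.natCast_dvd_natCast]
      split_ifs <;> ring
    simp_rw [e]
    rw [(hsum.mul_left _).tsum_add (hGs.mul_left _), tsum_mul_left, tsum_mul_left, hGsum, ih hS',
      Finset.prod_insert hpS, Complex.cpow_neg, Complex.cpow_add _ _ hp0]
    norm_cast
    field_simp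
    ring

theorem tsum_int_prod_density (S : Finset ℕ) (hS : ∀ p ∈ S, p.Prime) {s : ℂ} (hs : 1 < s.re) :
    ∑' b : ℤ, (1 / 2) * ((∏ p ∈ S, density p b) * ((|(b : ℝ)| : ℝ) : ℂ) ^ (-s)) =
      riemannZeta s * ∏ p ∈ S, (1 / (p : ℂ) ^ 2 + 1 / (p : ℂ) ^ s - 1 / (p : ℂ) ^ (2 + s)) := by
  have hs0 : -s ≠ 0 := fun h => by
    have := congrArg Complex.re h
    simp at this
    linarith
  have hsum := summable_prod_density S hs
  have h0 : (∏ p ∈ S, density p (0 : ℕ)) * ((0 : ℕ) : ℂ) ^ (-s) = 0 := by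
    rw [Nat.cast_zero (R := ℂ), Complex.zero_cpow hs0, mul_zero]
  have h1 := hsum.hasSum.mul_left (1 / 2 : ℂ)
  have h2 := ((hasSum_nat_add_iff' 1).mpr hsum.hasSum).mul_left (1 / 2 : ℂ)
  rw [Finset.sum_range_one, h0, sub_zero] at h2
  have hneg : ∀ (p : ℕ) (n : ℤ), density p (-n) = density p n := fun p n => by
    simp [density]
  have e1 : ∀ n : ℕ, ((|((n : ℤ) : ℝ)| : ℝ) : ℂ) = n := fun n => by simp
  have e2 : ∀ n : ℕ, ((|((-((n : ℤ) + 1) : ℤ) : ℝ)| : ℝ) : ℂ) = ((n + 1 : ℕ) : ℂ) := fun n => by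
    have : |((-((n : ℤ) + 1) : ℤ) : ℝ)| = ((n + 1 : ℕ) : ℝ) := by
      push_cast
      rw [abs_of_nonpos (by linarith [Nat.cast_nonneg (α := ℝ) n])]
      ring
    rw [this, Complex.ofReal_natCast]
  have h := HasSum.of_nat_of_neg_add_one (f := fun b : ℤ =>
    (1 / 2 : ℂ) * ((∏ p ∈ S, density p b) * ((|(b : ℝ)| : ℝ) : ℂ) ^ (-s)))
    (m := 1 / 2 * ∑' n : ℕ, (∏ p ∈ S, density p n) * (n : ℂ) ^ (-s))
    (m' := 1 / 2 * ∑' n : ℕ, (∏ p ∈ S, density p n) * (n : ℂ) ^ (-s))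
    (by simpa only [e1] using h1) (by simpa only [e2, hneg, Nat.cast_add, Nat.cast_one] using h2)
  rw [h.tsum_eq, ← tsum_prod_density S hS hs]
  ring

/-! ### The Dirichlet series of the reducible forms -/

/-- The classes `(b, c, ρ)` of reducible forms: `c` modulo `2b`, and a residue class modulo `q²`
which determines that of the last coefficient. There is no class with `b = 0`. -/
abbrev FormClass (q : ℕ) : Type := Σ b : ℤ, Fin (2 * b.natAbs) × Fin (q ^ 2)

/-- The least `e` with `ε c² + 4|b| e > 0`. -/
def leastShift (ε : DiscSign) (b c : ℤ) : ℤ := -(ε.toInt * c ^ 2) / (4 * |b|) + 1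

/-- The sign for which `ε (c² - 4bd)` increases with `d` times this sign. -/
def tailSign (ε : DiscSign) (b : ℤ) : ℤ := -(ε.toInt * b.sign)

/-- The least absolute discriminant `ε (c² - 4bd)` in a class. -/
def leastDisc (ε : DiscSign) {q : ℕ} (j : FormClass q) : ℤ :=
  ε.toInt * (j.2.1 : ℤ) ^ 2 + 4 * |j.1| * (leastShift ε j.1 j.2.1 + (j.2.2 : ℕ))

/-- The difference of consecutive discriminants in a class. -/
def discStep (q : ℕ) (b : ℤ) : ℤ := 4 * |b| * (q : ℤ) ^ 2

/-- The common value of the indicator function of non-maximality on a class. -/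
def classWeight (ε : DiscSign) {q : ℕ} (j : FormClass q) : ℂ :=
  nonMaxIndRed q ![j.1, (j.2.1 : ℕ),
    tailSign ε j.1 * (leastShift ε j.1 (j.2.1 : ℕ) + (j.2.2 : ℕ))]

theorem FormClass.ne_zero {q : ℕ} (j : FormClass q) : j.1 ≠ 0 := by
  intro h
  have := j.2.1.isLt
  simp [h] at this

theorem tailSign_mul_self (ε : DiscSign) {b : ℤ} (hb : b ≠ 0) : tailSign ε b * tailSign ε b = 1 := by
  have h1 := ε.toInt_mul_self
  have h2 : b.sign * b.sign = 1 := by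
    rcases lt_or_gt_of_ne hb with h | h
    · rw [Int.sign_eq_neg_one_of_neg h]; rfl
    · rw [Int.sign_eq_one_of_pos h]; rfl
  rw [tailSign]
  linear_combination b.sign * b.sign * h1 + h2

theorem leastShift_spec (ε : DiscSign) {b : ℤ} (hb : b ≠ 0) (c : ℤ) :
    1 ≤ ε.toInt * c ^ 2 + 4 * |b| * leastShift ε b c ∧
      ε.toInt * c ^ 2 + 4 * |b| * leastShift ε b c ≤ 4 * |b| := by
  have hb' : 0 < 4 * |b| := by have := abs_pos.mpr hb; omega
  have h1 := Int.emod_add_mul_ediv (-(ε.toInt * c ^ 2)) (4 * |b|)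
  have h2 := Int.emod_nonneg (-(ε.toInt * c ^ 2)) hb'.ne'
  have h3 := Int.emod_lt_of_pos (-(ε.toInt * c ^ 2)) hb'
  rw [leastShift, mul_add, mul_one]
  constructor <;> linarith

theorem leastDisc_pos (ε : DiscSign) {q : ℕ} (j : FormClass q) : 1 ≤ leastDisc ε j := by
  have h := (leastShift_spec ε j.ne_zero (j.2.1 : ℕ)).1
  have hk : 0 ≤ 4 * |j.1| * ((j.2.2 : ℕ) : ℤ) := by positivity
  rw [leastDisc, mul_add]
  linarith

/-- The step bounds the least discriminant, as `norm_progZeta_le` requires. -/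
theorem leastDisc_le (ε : DiscSign) {q : ℕ} (j : FormClass q) : leastDisc ε j ≤ discStep q j.1 := by
  have h := (leastShift_spec ε j.ne_zero (j.2.1 : ℕ)).2
  have hk : ((j.2.2 : ℕ) : ℤ) + 1 ≤ (q : ℤ) ^ 2 := by exact_mod_cast j.2.2.isLt
  have := mul_le_mul_of_nonneg_left hk (by positivity : 0 ≤ 4 * |j.1|)
  rw [leastDisc, discStep, mul_add]
  linarith

theorem norm_classWeight_le (ε : DiscSign) {q : ℕ} (j : FormClass q) : ‖classWeight ε j‖ ≤ 1 :=
  norm_nonMaxInd_le _ _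

theorem FormClass.abs_pos {q : ℕ} (j : FormClass q) : (0 : ℝ) < |(j.1 : ℝ)| :=
  _root_.abs_pos.mpr (mod_cast j.ne_zero)

theorem summable_formClass (q : ℕ) {σ : ℝ} (hσ : 2 < σ) :
    Summable fun j : FormClass q => |(j.1 : ℝ)| ^ (-σ) := by
  rw [summable_sigma_of_nonneg (fun j => by positivity)]
  refine ⟨fun b => (hasSum_fintype _).summable, ?_⟩
  have h := (Real.summable_abs_int_rpow (b := σ - 1) (by linarith)).mul_left (2 * (q : ℝ) ^ 2)
  refine h.congr fun b => ?_
  rw [tsum_fintype]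
  simp only [Finset.sum_const, Finset.card_univ, Fintype.card_prod, Fintype.card_fin, nsmul_eq_mul]
  rcases eq_or_ne b 0 with rfl | hb
  · rw [Int.cast_zero, abs_zero, Real.zero_rpow (by linarith)]; simp
  · have hb' : (0 : ℝ) < |(b : ℝ)| := abs_pos.mpr (mod_cast hb)
    have e : ((b.natAbs : ℕ) : ℝ) = |(b : ℝ)| := by
      rw [Nat.cast_natAbs]; push_cast; rfl
    push_cast
    rw [e, show -(σ - 1) = -σ + 1 by ring, Real.rpow_add hb', Real.rpow_one]
    ring

/-- The function `(s₂ - 1) ∑ 𝒩_q(x) |b|^(-s₁) |D|^(-s₂)`, the sum running over the classes of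
reducible forms `x = (0, b, c, d)` of discriminant `b² D` of the given sign, continued to
`Re s₂ > 1/2`. -/
def formSeries (ε : DiscSign) (q : ℕ) (s : ℂ × ℂ) : ℂ :=
  ∑' j : FormClass q, classWeight ε j * ((|(j.1 : ℝ)| : ℝ) : ℂ) ^ (-s.1) *
    progZeta (leastDisc ε j) (discStep q j.1) s.2

theorem differentiableOn_formSeries (ε : DiscSign) (q : ℕ) :
    DifferentiableOn ℂ (formSeries ε q) {s | 2 < s.1.re ∧ 1 / 2 < s.2.re} := by
  rintro s ⟨h1, h2⟩
  apply DifferentiableAt.differentiableWithinAt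
  obtain ⟨ρ, hρ, hρ1, hρ2⟩ : ∃ ρ : ℝ, 0 < ρ ∧ ρ ≤ (s.1.re - 2) / 2 ∧ ρ ≤ s.2.re - 1 / 2 :=
    ⟨min ((s.1.re - 2) / 2) (s.2.re - 1 / 2), lt_min (by linarith) (by linarith),
      min_le_left _ _, min_le_right _ _⟩
  have hball : ∀ y ∈ Metric.ball s ρ, 2 + (s.1.re - 2) / 2 ≤ y.1.re ∧ 1 / 2 < y.2.re ∧
      ‖y.2‖ ≤ ‖s.2‖ + ρ := by
    intro y hy
    have hy' : ‖y - s‖ < ρ := by simpa [dist_eq_norm] using hy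
    have n1 : ‖(y - s).1‖ ≤ ‖y - s‖ := norm_fst_le _
    have n2 : ‖(y - s).2‖ ≤ ‖y - s‖ := norm_snd_le _
    have r1 := (abs_le.mp (Complex.abs_re_le_norm (y - s).1)).1
    have r2 := (abs_le.mp (Complex.abs_re_le_norm (y - s).2)).1
    simp only [Prod.fst_sub, Prod.snd_sub, Complex.sub_re] at r1 r2 n1 n2
    refine ⟨by linarith, by linarith, ?_⟩
    calc ‖y.2‖ = ‖s.2 + (y.2 - s.2)‖ := by congr 1; ring
      _ ≤ ‖s.2‖ + ‖y.2 - s.2‖ := norm_add_le _ _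
      _ ≤ _ := by linarith
  have hu := (summable_formClass q (σ := 2 + (s.1.re - 2) / 2) (by linarith)).mul_right
    (progBound (‖s.2‖ + ρ))
  refine differentiableAt_tsum_of_bound hu hρ (fun j => ?_) (fun j y hy => ?_)
  · intro y hy
    have ha : (1 : ℝ) ≤ leastDisc ε j := mod_cast leastDisc_pos ε j
    have haM : (leastDisc ε j : ℝ) ≤ discStep q j.1 := mod_cast leastDisc_le ε j
    have d1 : DifferentiableAt ℂ (fun s : ℂ × ℂ => ((|(j.1 : ℝ)| : ℝ) : ℂ) ^ (-s.1)) y :=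
      (differentiableAt_fst.neg).const_cpow (Or.inl (mod_cast j.abs_pos.ne'))
    have d2 : DifferentiableAt ℂ (fun s : ℂ × ℂ =>
        progZeta (leastDisc ε j) (discStep q j.1) s.2) y :=
      DifferentiableAt.comp (g := progZeta (leastDisc ε j) (discStep q j.1)) y
        (differentiableAt_progZeta ha haM (hball y hy).2.1) differentiableAt_snd
    exact ((d1.const_mul _).mul d2).differentiableWithinAt
  · have ha : (1 : ℝ) ≤ leastDisc ε j := mod_cast leastDisc_pos ε j
    have haM : (leastDisc ε j : ℝ) ≤ discStep q j.1 := mod_cast leastDisc_le ε j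
    have hb1 : (1 : ℝ) ≤ |(j.1 : ℝ)| := by
      have := Int.one_le_abs j.ne_zero
      exact_mod_cast this
    obtain ⟨g1, g2, g3⟩ := hball y hy
    rw [norm_mul, norm_mul, Complex.norm_cpow_eq_rpow_re_of_pos j.abs_pos]
    refine mul_le_mul ?_ (norm_progZeta_le ha haM g2.le g3) (norm_nonneg _) (by positivity)
    refine (mul_le_of_le_one_left (by positivity) (norm_classWeight_le ε j)).trans ?_
    exact Real.rpow_le_rpow_of_exponent_le hb1 (by simp only [Complex.neg_re]; linarith)

/-- The residue at `s₂ = 1`. Each progression contributes the inverse of its step `4 |b| q²`, so the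
residue counts the classes with fixed `b`, which is `sum_nonMaxIndRed`. -/
theorem formSeries_one (ε : DiscSign) {q : ℕ} (hq : Squarefree q) {s : ℂ} (hs : 2 < s.re) :
    formSeries ε q (s, 1) = riemannZeta s * ∏ p ∈ q.primeFactors,
      (1 / (p : ℂ) ^ 2 + 1 / (p : ℂ) ^ s - 1 / (p : ℂ) ^ (2 + s)) := by
  have hq0 : (q : ℂ) ≠ 0 := mod_cast hq.ne_zero
  rw [← tsum_int_prod_density _ (fun p hp => Nat.prime_of_mem_primeFactors hp) (by linarith),
    formSeries]
  have hsum : Summable fun j : FormClass q => classWeight ε j * ((|(j.1 : ℝ)| : ℝ) : ℂ) ^ (-s) *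
      progZeta (leastDisc ε j) (discStep q j.1) 1 := by
    refine ((summable_formClass q hs).mul_right (progBound 1)).of_norm_bounded fun j => ?_
    rw [norm_mul, norm_mul, Complex.norm_cpow_eq_rpow_re_of_pos j.abs_pos]
    refine mul_le_mul (mul_le_of_le_one_left (by positivity) (norm_classWeight_le ε j))
      (norm_progZeta_le (mod_cast leastDisc_pos ε j) (mod_cast leastDisc_le ε j) (by norm_num)
        (by simp)) (norm_nonneg _) (by positivity)
  rw [hsum.tsum_sigma]
  refine tsum_congr fun b => ?_
  rw [tsum_fintype]
  rcases eq_or_ne b 0 with rfl | hb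
  · have hs0 : -s ≠ 0 := fun h => by
      have := congrArg Complex.re h
      simp at this
      linarith
    rw [Int.cast_zero, abs_zero, Complex.ofReal_zero, Complex.zero_cpow hs0]
    simp
  · have hcount := sum_nonMaxIndRed hq b (tailSign_mul_self ε hb) (fun c => leastShift ε b c)
    simp only [progZeta_one, classWeight]
    rw [← Finset.sum_mul, ← Finset.sum_mul, Fintype.sum_prod_type]
    have e : ∀ x : Fin (2 * b.natAbs), ∑ y : Fin (q ^ 2), nonMaxIndRed q ![b, ((x : ℕ) : ℤ),
        tailSign ε b * (leastShift ε b ((x : ℕ) : ℤ) + ((y : ℕ) : ℤ))] =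
        ∑ k ∈ Finset.range (q ^ 2), nonMaxIndRed q ![b, ((x : ℕ) : ℤ),
        tailSign ε b * (leastShift ε b ((x : ℕ) : ℤ) + (k : ℤ))] := fun x =>
      Fin.sum_univ_eq_sum_range (fun k => nonMaxIndRed q ![b, ((x : ℕ) : ℤ),
        tailSign ε b * (leastShift ε b ((x : ℕ) : ℤ) + (k : ℤ))]) (q ^ 2)
    simp_rw [e]
    rw [Fin.sum_univ_eq_sum_range (fun c => ∑ k ∈ Finset.range (q ^ 2), nonMaxIndRed q ![b, (c : ℤ),
        tailSign ε b * (leastShift ε b (c : ℤ) + (k : ℤ))]) (2 * b.natAbs), hcount]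
    have e2 : ((b.natAbs : ℕ) : ℂ) = ((|(b : ℝ)| : ℝ) : ℂ) := by
      have : ((b.natAbs : ℕ) : ℝ) = |(b : ℝ)| := by rw [Nat.cast_natAbs]; push_cast; rfl
      rw [← this, Complex.ofReal_natCast]
    have hb0 : ((|(b : ℝ)| : ℝ) : ℂ) ≠ 0 := by simpa using hb
    rw [e2, discStep]
    push_cast
    field_simp
    ring

theorem summable_formSeries (ε : DiscSign) (q : ℕ) {σ₁ σ₂ : ℝ} (h1 : 2 < σ₁) (h2 : 1 < σ₂) :
    Summable fun x : FormClass q × ℕ => |(x.1.1 : ℝ)| ^ (-σ₁) *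
      ((leastDisc ε x.1 + discStep q x.1.1 * x.2 : ℝ)) ^ (-σ₂) := by
  have h := (summable_formClass q h1).mul_of_nonneg (summable_nat_add_one_rpow h2)
    (fun j => by positivity) (fun k => by positivity)
  refine h.of_nonneg_of_le (fun x => ?_) (fun x => ?_)
  · have ha : (1 : ℝ) ≤ leastDisc ε x.1 := mod_cast leastDisc_pos ε x.1
    have hM : (1 : ℝ) ≤ discStep q x.1.1 := ha.trans (mod_cast leastDisc_le ε x.1)
    positivity
  · have ha : (1 : ℝ) ≤ leastDisc ε x.1 := mod_cast leastDisc_pos ε x.1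
    have hM : (1 : ℝ) ≤ discStep q x.1.1 := ha.trans (mod_cast leastDisc_le ε x.1)
    refine mul_le_mul_of_nonneg_left ?_ (by positivity)
    refine Real.rpow_le_rpow_of_nonpos (by positivity) ?_ (by linarith)
    nlinarith [Nat.cast_nonneg (α := ℝ) x.2]

/-- `formSeries` is `s₂ - 1` times the Dirichlet series where the latter converges. -/
theorem tsum_formSeries (ε : DiscSign) (q : ℕ) {s₁ s₂ : ℂ} (h1 : 2 < s₁.re) (h2 : 1 < s₂.re) :
    ∑' x : FormClass q × ℕ, classWeight ε x.1 * (((|(x.1.1 : ℝ)| : ℝ) : ℂ) ^ (-s₁) *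
      ((leastDisc ε x.1 + discStep q x.1.1 * x.2 : ℝ) : ℂ) ^ (-s₂)) =
      formSeries ε q (s₁, s₂) / (s₂ - 1) := by
  have hs2 : s₂ - 1 ≠ 0 := fun h => by
    have := congrArg Complex.re h
    simp at this
    linarith
  have hsum : Summable fun x : FormClass q × ℕ => classWeight ε x.1 *
      (((|(x.1.1 : ℝ)| : ℝ) : ℂ) ^ (-s₁) *
      ((leastDisc ε x.1 + discStep q x.1.1 * x.2 : ℝ) : ℂ) ^ (-s₂)) := by
    refine (summable_formSeries ε q h1 h2).of_norm_bounded fun x => ?_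
    have ha : (1 : ℝ) ≤ leastDisc ε x.1 := mod_cast leastDisc_pos ε x.1
    have hM : (1 : ℝ) ≤ discStep q x.1.1 := ha.trans (mod_cast leastDisc_le ε x.1)
    have hpos : (0 : ℝ) < leastDisc ε x.1 + discStep q x.1.1 * x.2 := by positivity
    rw [norm_mul, norm_mul, Complex.norm_cpow_eq_rpow_re_of_pos x.1.abs_pos,
      Complex.norm_cpow_eq_rpow_re_of_pos hpos, Complex.neg_re, Complex.neg_re]
    exact mul_le_of_le_one_left (by positivity) (norm_classWeight_le ε _)
  rw [hsum.tsum_prod, formSeries, eq_div_iff hs2, ← tsum_mul_right]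
  refine tsum_congr fun j => ?_
  dsimp only
  rw [progZeta_eq (mod_cast leastDisc_pos ε j) (mod_cast leastDisc_le ε j) h2, tsum_mul_left,
    tsum_mul_left]
  ring

/-! ### Enumeration of the reducible forms -/

/-- The discriminant `c² - 4bd` times the sign `ε`. -/
def signedDisc (ε : DiscSign) (x : Fin 3 → ℤ) : ℤ := ε.toInt * (x 1 ^ 2 - 4 * x 0 * x 2)

/-- The form with parameters `(j, k)` in its class, translated by `n_m`. -/
def formOf (ε : DiscSign) {q : ℕ} (y : (FormClass q × ℕ) × ℤ) : Fin 3 → ℤ :=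
  ![y.1.1.1, (y.1.1.2.1 : ℕ) + 2 * y.1.1.1 * y.2,
    y.1.1.1 * y.2 ^ 2 + (y.1.1.2.1 : ℕ) * y.2 + tailSign ε y.1.1.1 *
      (leastShift ε y.1.1.1 (y.1.1.2.1 : ℕ) + (y.1.1.2.2 : ℕ) + (q : ℤ) ^ 2 * y.1.2)]

theorem abs_mul_tailSign (ε : DiscSign) (b : ℤ) : |b| * tailSign ε b = -(ε.toInt * b) := by
  have h : |b| * b.sign = b := by rw [mul_comm, Int.sign_mul_abs]
  rw [tailSign]
  linear_combination (-ε.toInt) * h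

theorem toInt_mul_mul_tailSign (ε : DiscSign) {b : ℤ} (hb : b ≠ 0) (e : ℤ) :
    ε.toInt * (b * (tailSign ε b * e)) = -(|b| * e) := by
  have h1 := abs_mul_tailSign ε b
  have h2 := tailSign_mul_self ε hb
  linear_combination (tailSign ε b * e) * h1 - (|b| * e) * h2

theorem signedDisc_formOf (ε : DiscSign) {q : ℕ} (y : (FormClass q × ℕ) × ℤ) :
    signedDisc ε (formOf ε y) = leastDisc ε y.1.1 + discStep q y.1.1.1 * y.1.2 := by
  have h := toInt_mul_mul_tailSign ε y.1.1.ne_zero (leastShift ε y.1.1.1 (y.1.1.2.1 : ℕ) +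
    ((y.1.1.2.2 : ℕ) : ℤ) + (q : ℤ) ^ 2 * y.1.2)
  simp only [signedDisc, formOf, leastDisc, discStep, Matrix.cons_val]
  linear_combination (-4) * h

/-- Together with `exists_formOf`: every reducible form with `b ≠ 0` of the right sign has unique
parameters, since `n_m` shifts `c` by `2bm` and the discriminant then determines `d`. -/
theorem formOf_injective (ε : DiscSign) {q : ℕ} (hq : q ≠ 0) :
    Function.Injective (formOf ε (q := q)) := by
  rintro ⟨⟨⟨b, c, r⟩, k⟩, m⟩ ⟨⟨⟨b', c', r'⟩, k'⟩, m'⟩ h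
  have h0 := congrFun h 0
  have h1 := congrFun h 1
  have h2 := congrFun h 2
  simp only [formOf, Matrix.cons_val] at h0 h1 h2
  subst h0
  have hb : b ≠ 0 := FormClass.ne_zero (q := q) ⟨b, c, r⟩
  have hlt : ∀ c : Fin (2 * b.natAbs), (((c : ℕ) : ℤ)) < |2 * b| := by
    intro c
    have h3 : ((c : ℕ) : ℤ) < ((2 * b.natAbs : ℕ) : ℤ) := by exact_mod_cast c.isLt
    rw [abs_mul, abs_of_pos (by norm_num : (0 : ℤ) < 2)]
    push_cast at h3
    exact h3
  have hmod : ∀ (c : Fin (2 * b.natAbs)) (m : ℤ), (((c : ℕ) : ℤ) + 2 * b * m) % (2 * b) = (c : ℕ) := by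
    intro c m
    rw [Int.add_mul_emod_self_left, ← Int.emod_abs, Int.emod_eq_of_lt (by positivity) (hlt c)]
  have hc : (c : ℕ) = c' := by
    have := congrArg (· % (2 * b)) h1
    simp only [hmod] at this
    exact_mod_cast this
  have hc' : c = c' := Fin.ext hc
  subst hc'
  have hm : m = m' := by
    have : 2 * b * m = 2 * b * m' := by linarith
    exact mul_left_cancel₀ (by simpa using hb) this
  subst hm
  have hs : tailSign ε b ≠ 0 := fun h => by
    have := tailSign_mul_self ε hb
    simp [h] at this
  have h3 : ((r : ℕ) : ℤ) + (q : ℤ) ^ 2 * k = ((r' : ℕ) : ℤ) + (q : ℤ) ^ 2 * k' := by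
    have h4 := add_left_cancel h2
    have := mul_left_cancel₀ hs h4
    linarith
  have h4 : (r : ℕ) + q ^ 2 * k = (r' : ℕ) + q ^ 2 * k' := by exact_mod_cast h3
  have hr : (r : ℕ) = r' := by
    have := congrArg (· % q ^ 2) h4
    simpa [Nat.add_mul_mod_self_left, Nat.mod_eq_of_lt r.isLt, Nat.mod_eq_of_lt r'.isLt] using this
  have hr' : r = r' := Fin.ext hr
  subst hr'
  have hk : k = k' := by
    have : q ^ 2 * k = q ^ 2 * k' := by omega
    exact Nat.eq_of_mul_eq_mul_left (by positivity) this
  subst hk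
  rfl

theorem exists_formOf (ε : DiscSign) {q : ℕ} (hq : q ≠ 0) (x : Fin 3 → ℤ) (hb : x 0 ≠ 0)
    (hD : 0 < signedDisc ε x) : x ∈ Set.range (formOf ε (q := q)) := by
  obtain ⟨b, hbx⟩ : ∃ b, b = x 0 := ⟨_, rfl⟩
  rw [← hbx] at hb
  have h2b : 2 * b ≠ 0 := by omega
  have hc0 := Int.emod_nonneg (x 1) h2b
  have hc1 := Int.emod_lt_abs (x 1) h2b
  have hcm := Int.emod_add_mul_ediv (x 1) (2 * b)
  obtain ⟨c, hc⟩ : ∃ c : ℕ, (c : ℤ) = x 1 % (2 * b) := ⟨_, Int.toNat_of_nonneg hc0⟩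
  obtain ⟨m, hm⟩ : ∃ m, m = x 1 / (2 * b) := ⟨_, rfl⟩
  rw [← hc] at hc1
  rw [← hc, ← hm] at hcm
  have hclt : c < 2 * b.natAbs := by
    rw [abs_mul, abs_of_pos (by norm_num : (0 : ℤ) < 2)] at hc1
    zify
    exact hc1
  obtain ⟨d, hd⟩ : ∃ d, d = x 2 - b * m ^ 2 - c * m := ⟨_, rfl⟩
  have hss := tailSign_mul_self ε hb
  obtain ⟨e, he⟩ : ∃ e, e = tailSign ε b * d := ⟨_, rfl⟩
  have hde : d = tailSign ε b * e := by rw [he]; linear_combination (-d) * hss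
  have hspec := (leastShift_spec ε hb c).2
  have habs := toInt_mul_mul_tailSign ε hb e
  have hpos : 0 < ε.toInt * (c : ℤ) ^ 2 + 4 * |b| * e := by
    have e1 : signedDisc ε x = ε.toInt * (c : ℤ) ^ 2 + 4 * |b| * e := by
      rw [signedDisc, ← hbx, ← hcm, show x 2 = d + b * m ^ 2 + c * m by rw [hd]; ring, hde]
      linear_combination (-4) * habs
    rw [← e1]; exact hD
  have hge : 0 ≤ e - leastShift ε b c := by
    have hb' : 0 < |b| := abs_pos.mpr hb
    by_contra hneg
    have h1 : e - leastShift ε b c ≤ -1 := by omega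
    nlinarith
  obtain ⟨n, hn⟩ : ∃ n : ℕ, (n : ℤ) = e - leastShift ε b c := ⟨_, Int.toNat_of_nonneg hge⟩
  have hn2 := Nat.mod_add_div n (q ^ 2)
  refine ⟨((⟨b, ⟨c, hclt⟩, ⟨n % q ^ 2, Nat.mod_lt _ (by positivity)⟩⟩, n / q ^ 2), m), ?_⟩
  have hn3 : ((n % q ^ 2 : ℕ) : ℤ) + (q : ℤ) ^ 2 * ((n / q ^ 2 : ℕ) : ℤ) = e - leastShift ε b c := by
    rw [← hn]; exact_mod_cast hn2
  funext i
  fin_cases i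
  · simpa [formOf] using hbx
  · simpa [formOf] using hcm
  · simp only [formOf, Matrix.cons_val, Fin.reduceFinMk]
    rw [add_assoc (leastShift ε b c), hn3]
    have : x 2 = d + b * m ^ 2 + c * m := by rw [hd]; ring
    rw [this, hde]
    ring

theorem nonMaxIndRed_formOf (ε : DiscSign) {q : ℕ} (y : (FormClass q × ℕ) × ℤ) :
    nonMaxIndRed q (formOf ε y) = classWeight ε y.1.1 := by
  rw [formOf, nonMaxIndRed_translate, classWeight]
  refine nonMaxIndRed_periodic q _ _ ⟨tailSign ε y.1.1.1 * y.1.2, ?_⟩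
  ring

/-! ### Unfolding of the integrals over the lower triangular group -/

theorem aestronglyMeasurable_tsum {α ι : Type*} [MeasurableSpace α] [Countable ι] {μ : Measure α}
    {F : ι → α → ℂ} (hF : ∀ i, AEStronglyMeasurable (F i) μ) (hs : ∀ᵐ a ∂μ, Summable fun i => F i a) :
    AEStronglyMeasurable (fun a => ∑' i, F i a) μ := by
  refine aestronglyMeasurable_of_tendsto_ae (u := (atTop : Filter (Finset ι)))
    (f := fun s a => ∑ i ∈ s, F i a)
    (fun s => Finset.aestronglyMeasurable_fun_sum s fun i _ => hF i) ?_
  filter_upwards [hs] with a ha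
  exact ha.hasSum

theorem integrable_tsum_of_summable {α ι : Type*} [MeasurableSpace α] {μ : Measure α} [Countable ι]
    {F : ι → α → ℂ} (hF : ∀ i, Integrable (F i) μ) (hs : Summable fun i => ∫ a, ‖F i a‖ ∂μ) :
    Integrable (fun a => ∑' i, F i a) μ := by
  have hlin : ∫⁻ a, ∑' i, ‖F i a‖ₑ ∂μ < ⊤ := by
    rw [lintegral_tsum fun i => (hF i).1.enorm]
    have e : ∀ i, ∫⁻ a, ‖F i a‖ₑ ∂μ = ENNReal.ofReal (∫ a, ‖F i a‖ ∂μ) := fun i =>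
      (ofReal_integral_norm_eq_lintegral_enorm (hF i)).symm
    simp_rw [e]
    rw [← ENNReal.ofReal_tsum_of_nonneg (fun i => integral_nonneg fun _ => norm_nonneg _) hs]
    exact ENNReal.ofReal_lt_top
  have hae : ∀ᵐ a ∂μ, ∑' i, ‖F i a‖ₑ < ⊤ :=
    ae_lt_top' (AEMeasurable.tsum fun i => (hF i).1.enorm) hlin.ne
  have hsum : ∀ᵐ a ∂μ, Summable fun i => F i a := by
    filter_upwards [hae] with a ha
    apply Summable.of_norm
    have := ENNReal.tsum_coe_ne_top_iff_summable.mp ha.ne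
    exact NNReal.summable_coe.mpr this
  refine ⟨aestronglyMeasurable_tsum (fun i => (hF i).1) hsum, ?_⟩
  refine lt_of_le_of_lt (lintegral_mono_ae ?_) hlin
  filter_upwards [hae] with a ha
  exact enorm_tsum_le_tsum_enorm

/-- The coordinates `(l, t, u)` with `v₀ ≤ u < v₀ + 1`. -/
def window (v₀ : ℝ) : Set (ℝ × ℝ × ℝ) := Ioi 0 ×ˢ Ioi 0 ×ˢ Ico v₀ (v₀ + 1)

theorem measurableSet_window (v₀ : ℝ) : MeasurableSet (window v₀) :=
  measurableSet_Ioi.prod (measurableSet_Ioi.prod measurableSet_Ico)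

theorem window_zero : window 0 = borelDomain := by
  rw [window, borelDomain, zero_add]

theorem window_subset (v₀ : ℝ) : window v₀ ⊆ halfSpace :=
  prod_mono_right (prod_mono_right (subset_univ _))

theorem iUnion_window (v₀ : ℝ) : ⋃ m : ℤ, window (v₀ + m) = halfSpace := by
  ext ⟨l, t, u⟩
  simp only [window, halfSpace, mem_iUnion, mem_prod, mem_univ, and_true]
  refine ⟨fun ⟨m, h⟩ => ⟨h.1, h.2.1⟩, fun h => ⟨⌊u - v₀⌋, h.1, h.2, ?_, ?_⟩⟩
  · linarith [Int.floor_le (u - v₀)]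
  · linarith [Int.lt_floor_add_one (u - v₀)]

theorem pairwise_disjoint_window (v₀ : ℝ) :
    Pairwise (Function.onFun Disjoint fun m : ℤ => window (v₀ + m)) := by
  intro m n hmn
  rw [Function.onFun, Set.disjoint_left]
  rintro ⟨l, t, u⟩ ⟨_, _, h1, h2⟩ ⟨_, _, h3, h4⟩
  apply hmn
  simp only at h1 h2 h3 h4
  have a1 : (m : ℝ) < n + 1 := by linarith
  have a2 : (n : ℝ) < m + 1 := by linarith
  have b1 : m < n + 1 := by exact_mod_cast a1
  have b2 : n < m + 1 := by exact_mod_cast a2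
  omega

theorem window_preimage (v₀ : ℝ) (m : ℤ) :
    (fun x : ℝ × ℝ × ℝ => x + ((0 : ℝ), (0 : ℝ), (m : ℝ))) ⁻¹' window (v₀ + m) = window v₀ := by
  ext ⟨l, t, u⟩
  simp only [window, mem_preimage, Prod.mk_add_mk, mem_prod, add_zero, mem_Ioi, mem_Ico]
  refine and_congr Iff.rfl (and_congr Iff.rfl (and_congr ?_ ?_)) <;> constructor <;> intro h <;>
    linarith

theorem measurePreserving_shift (c : ℝ) :
    MeasurePreserving (fun x : ℝ × ℝ × ℝ => x + ((0 : ℝ), (0 : ℝ), c)) volume volume := by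
  have h := (MeasurePreserving.id (volume : Measure ℝ)).prod
    ((MeasurePreserving.id (volume : Measure ℝ)).prod
      (measurePreserving_add_right (volume : Measure ℝ) c))
  have e : (fun x : ℝ × ℝ × ℝ => x + ((0 : ℝ), (0 : ℝ), c)) =
      Prod.map id (Prod.map id fun x => x + c) := by
    funext x
    simp [Prod.ext_iff]
  rw [e]
  exact h

theorem integrableOn_window_shift {E : Type*} [NormedAddCommGroup E] {G : ℝ × ℝ × ℝ → E}
    (hG : IntegrableOn G halfSpace) (v₀ : ℝ) (m : ℤ) :
    IntegrableOn (fun x => G (x + ((0 : ℝ), (0 : ℝ), (m : ℝ)))) (window v₀) := by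
  have h := (measurePreserving_shift m).integrableOn_comp_preimage (f := G) (s := window (v₀ + m))
    (measurableEmbedding_addRight _)
  rw [window_preimage] at h
  exact h.mpr (hG.mono_set (window_subset _))

theorem hasSum_window_shift {E : Type*} [NormedAddCommGroup E] [NormedSpace ℝ E]
    {G : ℝ × ℝ × ℝ → E} (hG : IntegrableOn G halfSpace) (v₀ : ℝ) :
    HasSum (fun m : ℤ => ∫ x in window v₀, G (x + ((0 : ℝ), (0 : ℝ), (m : ℝ))))
      (∫ x in halfSpace, G x) := by
  have h := hasSum_integral_iUnion (f := G) (fun m : ℤ => measurableSet_window (v₀ + m))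
    (pairwise_disjoint_window v₀) (by rw [iUnion_window]; exact hG)
  rw [iUnion_window] at h
  convert h using 2 with m
  have h2 := (measurePreserving_shift m).setIntegral_preimage_emb (measurableEmbedding_addRight _) G
    (window (v₀ + m))
  rw [window_preimage] at h2
  exact h2

/-- The contribution of the reducible form `x` to the integrand of a zeta function, in the
coordinates `(l, t, u)`. -/
def redTerm (ε : DiscSign) (q : ℕ) (fD : ℝ → ℂ) (p r : ℕ) (A B : ℂ) (x : Fin 3 → ℤ) :
    ℝ × ℝ × ℝ → ℂ :=
  if x 0 ≠ 0 ∧ 0 < signedDisc ε x then fun y => nonMaxIndRed q x *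
    orbitTerm fD p r ((x 0 : ℝ) ^ 2 * signedDisc ε x) (shape ε (x 0) (signedDisc ε x))
      ((x 1 : ℝ) / (2 * x 0)) A B y
  else 0

/-- The discriminant of the form with parameters `(j, k)` in its class. -/
def classDisc (ε : DiscSign) {q : ℕ} (y : FormClass q × ℕ) : ℝ :=
  leastDisc ε y.1 + discStep q y.1.1 * y.2

theorem classDisc_pos (ε : DiscSign) {q : ℕ} (y : FormClass q × ℕ) : 0 < classDisc ε y := by
  have ha : (1 : ℝ) ≤ leastDisc ε y.1 := mod_cast leastDisc_pos ε y.1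
  have hM : (1 : ℝ) ≤ discStep q y.1.1 := ha.trans (mod_cast leastDisc_le ε y.1)
  rw [classDisc]
  positivity

theorem signedDisc_formOf_cast (ε : DiscSign) {q : ℕ} (y : (FormClass q × ℕ) × ℤ) :
    (signedDisc ε (formOf ε y) : ℝ) = classDisc ε y.1 := by
  rw [signedDisc_formOf, classDisc]
  push_cast
  ring

/-- The integrand of the orbit of the form with parameters `(j, k)`. -/
def classTerm (ε : DiscSign) {q : ℕ} (fD : ℝ → ℂ) (p r : ℕ) (A B : ℂ) (y : FormClass q × ℕ) :
    ℝ × ℝ × ℝ → ℂ :=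
  orbitTerm fD p r ((y.1.1 : ℝ) ^ 2 * classDisc ε y) (shape ε y.1.1 (classDisc ε y))
      (((y.1.2.1 : ℕ) : ℝ) / (2 * y.1.1)) A B

/-- Translation of the form by `n_m` is translation of the coordinate `u` by `m`; hence the sum over
`m` unfolds the integral over a strip to one over the half space. -/
theorem redTerm_formOf (ε : DiscSign) {q : ℕ} (fD : ℝ → ℂ) (p r : ℕ) (A B : ℂ)
    (y : (FormClass q × ℕ) × ℤ) : redTerm ε q fD p r A B (formOf ε y) =
      fun x => classWeight ε y.1.1 *
        classTerm ε fD p r A B y.1 (x + ((0 : ℝ), (0 : ℝ), (y.2 : ℝ))) := by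
  have hb : y.1.1.1 ≠ 0 := y.1.1.ne_zero
  have hbR : (y.1.1.1 : ℝ) ≠ 0 := mod_cast hb
  have h0 : formOf ε y 0 = y.1.1.1 := rfl
  have h1 : formOf ε y 1 = (y.1.1.2.1 : ℕ) + 2 * y.1.1.1 * y.2 := rfl
  have hD : 0 < signedDisc ε (formOf ε y) := by
    have h := classDisc_pos ε y.1
    rw [← signedDisc_formOf_cast] at h
    exact_mod_cast h
  rw [redTerm, if_pos ⟨by rw [h0]; exact hb, hD⟩]
  funext x
  obtain ⟨l, t, u⟩ := x
  rw [nonMaxIndRed_formOf, signedDisc_formOf_cast, h0, h1, classTerm]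
  simp only [orbitTerm, gaussFactor, Prod.mk_add_mk, add_zero]
  have e : u + ((((y.1.1.2.1 : ℕ) + 2 * y.1.1.1 * y.2 : ℤ) : ℝ) / (2 * y.1.1.1)) =
      u + y.2 + ((y.1.1.2.1 : ℕ) : ℝ) / (2 * y.1.1.1) := by
    push_cast
    field_simp
    ring
  rw [e]

theorem shape_pos (ε : DiscSign) {b Δ : ℝ} (hb : b ≠ 0) (hΔ : 0 < Δ) : 0 < shape ε b Δ := by
  have := shapeConst_pos ε
  rw [shape]
  positivity

/-- The dependence of the orbit integral on the form, as a product of powers of `|b|` and `Δ`. -/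
theorem kappa_shape_cpow (ε : DiscSign) {b Δ : ℝ} (hb : b ≠ 0) (hΔ : 0 < Δ) (a β : ℂ) :
    ((b ^ 2 * Δ : ℝ) : ℂ) ^ (-a) * (shape ε b Δ : ℂ) ^ (-(β / 2)) =
      (shapeConst ε : ℂ) ^ (-(β / 2)) *
        (((|b| : ℝ) : ℂ) ^ (-(2 * a + β / 2)) * (Δ : ℂ) ^ (-(a - β / 4))) := by
  have hk := shapeConst_pos ε
  have hb' : 0 < |b| := abs_pos.mpr hb
  rw [ofReal_cpow_eq_exp (by positivity), ofReal_cpow_eq_exp (shape_pos ε hb hΔ),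
    ofReal_cpow_eq_exp hk, ofReal_cpow_eq_exp hb', ofReal_cpow_eq_exp hΔ, ← Complex.exp_add,
    ← Complex.exp_add, ← Complex.exp_add, shape, ← sq_abs b, Real.log_mul (by positivity) hΔ.ne',
    Real.log_pow, Real.log_div (by positivity) (by positivity), Real.log_mul hk.ne' hb'.ne',
    Real.log_sqrt hΔ.le]
  congr 1
  push_cast
  ring

theorem tsupport_norm_subset (f : ℝ → ℂ) : tsupport (fun y => (‖f y‖ : ℂ)) ⊆ tsupport f := by
  refine closure_mono fun y hy => ?_
  contrapose! hy
  simp [Function.notMem_support.mp hy]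

section Unfolding

variable {fD : ℝ → ℂ} (hf : Continuous fD) (hc : HasCompactSupport fD) (hsupp : tsupport fD ⊆ Ioi 0)
  {p : ℕ} (hp : p ≠ 0)
include hf hc hsupp hp

theorem integrableOn_classTerm (ε : DiscSign) {q : ℕ} (r : ℕ) (A B : ℂ) (y : FormClass q × ℕ) :
    IntegrableOn (classTerm ε fD p r A B y) halfSpace := by
  have hb : (y.1.1 : ℝ) ≠ 0 := mod_cast y.1.ne_zero
  have hΔ := classDisc_pos ε y
  exact integrable_orbitTerm hf hc hsupp hp r (by positivity) (shape_pos ε hb hΔ) _ A B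

theorem integral_classTerm (ε : DiscSign) {q : ℕ} (r : ℕ) (A B : ℂ) (y : FormClass q × ℕ) :
    ∫ x in halfSpace, classTerm ε fD p r A B y x =
      (archFactor fD p r A B * (shapeConst ε : ℂ) ^ (-((B - r * A / p) / 2))) *
        (((|(y.1.1 : ℝ)| : ℝ) : ℂ) ^ (-(2 * (A / p) + (B - r * A / p) / 2)) *
          (classDisc ε y : ℂ) ^ (-(A / p - (B - r * A / p) / 4))) := by
  have hb : (y.1.1 : ℝ) ≠ 0 := mod_cast y.1.ne_zero
  have hΔ := classDisc_pos ε y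
  have h := integral_orbitTerm hf hc hsupp hp r (κ := (y.1.1 : ℝ) ^ 2 * classDisc ε y)
    (by positivity) (shape_pos ε hb hΔ) (((y.1.2.1 : ℕ) : ℝ) / (2 * y.1.1)) A B
  rw [kappa_shape_cpow ε hb hΔ] at h
  rw [classTerm, h]
  ring

theorem integral_norm_classTerm (ε : DiscSign) {q : ℕ} (r : ℕ) (A B : ℂ) (y : FormClass q × ℕ) :
    ∫ x in halfSpace, ‖classTerm ε fD p r A B y x‖ =
      ‖archFactor (fun y => (‖fD y‖ : ℂ)) p r A.re B.re *
          (shapeConst ε : ℂ) ^ (-(((B.re : ℂ) - r * A.re / p) / 2))‖ *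
        (|(y.1.1 : ℝ)| ^ (-(2 * (A / p) + (B - r * A / p) / 2).re) *
          classDisc ε y ^ (-(A / p - (B - r * A / p) / 4).re)) := by
  have hf' : Continuous fun y => (‖fD y‖ : ℂ) := Complex.continuous_ofReal.comp hf.norm
  have hts := tsupport_norm_subset fD
  have hc' : HasCompactSupport fun y => (‖fD y‖ : ℂ) :=
    hc.of_isClosed_subset (isClosed_tsupport _) hts
  have h := integral_classTerm hf' hc' (hts.trans hsupp) hp ε r A.re B.re y
  have e : ∫ x in halfSpace, classTerm ε (fun y => (‖fD y‖ : ℂ)) p r A.re B.re y x =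
      ∫ x in halfSpace, (‖classTerm ε fD p r A B y x‖ : ℂ) := by
    refine setIntegral_congr_fun (measurableSet_Ioi.prod (measurableSet_Ioi.prod .univ))
      fun x hx => ?_
    exact (norm_orbitTerm fD p r _ _ _ A B hx.1 hx.2.1).symm
  rw [e, integral_complex_ofReal] at h
  have h2 := congrArg norm h
  rw [Complex.norm_real, Real.norm_of_nonneg (integral_nonneg fun _ => norm_nonneg _), norm_mul,
    norm_mul (_ ^ _) (_ ^ _), Complex.norm_cpow_eq_rpow_re_of_pos y.1.abs_pos,
    Complex.norm_cpow_eq_rpow_re_of_pos (classDisc_pos ε y)] at h2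
  rw [h2]
  congr 3
  · simp
  · simp

theorem integrableOn_redTerm (ε : DiscSign) {q : ℕ} (hq : q ≠ 0) (r : ℕ) (A B : ℂ) (v₀ : ℝ)
    (x : Fin 3 → ℤ) : IntegrableOn (redTerm ε q fD p r A B x) (window v₀) := by
  by_cases h : x 0 ≠ 0 ∧ 0 < signedDisc ε x
  · obtain ⟨y, rfl⟩ := exists_formOf ε hq x h.1 h.2
    rw [redTerm_formOf]
    exact (integrableOn_window_shift (integrableOn_classTerm hf hc hsupp hp ε r A B y.1) v₀
      y.2).const_mul _
  · rw [redTerm, if_neg h]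
    exact integrableOn_zero

theorem hasSum_norm_redTerm (ε : DiscSign) {q : ℕ} (r : ℕ) (A B : ℂ) (v₀ : ℝ)
    (y : FormClass q × ℕ) :
    HasSum (fun m : ℤ => ∫ x in window v₀, ‖redTerm ε q fD p r A B (formOf ε (y, m)) x‖)
      (‖classWeight ε y.1‖ * ∫ x in halfSpace, ‖classTerm ε fD p r A B y x‖) := by
  have h := (hasSum_window_shift (integrableOn_classTerm hf hc hsupp hp ε r A B y).norm v₀).mul_left
    ‖classWeight ε y.1‖
  refine h.congr_fun fun m => ?_
  rw [redTerm_formOf, ← integral_const_mul]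
  simp only [norm_mul]

/-- Absolute convergence follows from the same computation applied to `‖fD‖` and the real parts of
the exponents. -/
theorem summable_redTerm (ε : DiscSign) {q : ℕ} (hq : q ≠ 0) (r : ℕ) (A B : ℂ) (v₀ : ℝ)
    (h1 : 2 < (2 * (A / p) + (B - r * A / p) / 2).re) (h2 : 1 < (A / p - (B - r * A / p) / 4).re) :
    Summable fun x : Fin 3 → ℤ => ∫ y in window v₀, ‖redTerm ε q fD p r A B x y‖ := by
  rw [← (formOf_injective ε hq).summable_iff]
  · have h0 : 0 ≤ (fun x : Fin 3 → ℤ => ∫ y in window v₀, ‖redTerm ε q fD p r A B x y‖) ∘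
        formOf ε (q := q) := fun _ => integral_nonneg fun _ => norm_nonneg _
    rw [summable_prod_of_nonneg h0]
    refine ⟨fun y => (hasSum_norm_redTerm hf hc hsupp hp ε r A B v₀ y).summable, ?_⟩
    have e : ∀ y : FormClass q × ℕ, ∑' m : ℤ,
        ((fun x : Fin 3 → ℤ => ∫ y in window v₀, ‖redTerm ε q fD p r A B x y‖) ∘ formOf ε) (y, m) =
        ‖classWeight ε y.1‖ * ∫ x in halfSpace, ‖classTerm ε fD p r A B y x‖ := fun y =>
      (hasSum_norm_redTerm hf hc hsupp hp ε r A B v₀ y).tsum_eq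
    simp_rw [e, integral_norm_classTerm hf hc hsupp hp]
    refine ((summable_formSeries ε q h1 h2).mul_left
      ‖archFactor (fun y => (‖fD y‖ : ℂ)) p r A.re B.re *
          (shapeConst ε : ℂ) ^ (-(((B.re : ℂ) - r * A.re / p) / 2))‖).of_nonneg_of_le
      (fun y => ?_) (fun y => ?_)
    · have := classDisc_pos ε y
      positivity
    · have := classDisc_pos ε y
      exact mul_le_of_le_one_left (by positivity) (norm_classWeight_le ε y.1)
  · intro x hx
    have : redTerm ε q fD p r A B x = 0 := by
      rw [redTerm, if_neg]
      exact fun h => hx (exists_formOf ε hq x h.1 h.2)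
    simp [this]

theorem integrableOn_tsum_redTerm (ε : DiscSign) {q : ℕ} (hq : q ≠ 0) (r : ℕ) (A B : ℂ) (v₀ : ℝ)
    (h1 : 2 < (2 * (A / p) + (B - r * A / p) / 2).re) (h2 : 1 < (A / p - (B - r * A / p) / 4).re) :
    IntegrableOn (fun y => ∑' x : Fin 3 → ℤ, redTerm ε q fD p r A B x y) (window v₀) :=
  integrable_tsum_of_summable (integrableOn_redTerm hf hc hsupp hp ε hq r A B v₀)
    (summable_redTerm hf hc hsupp hp ε hq r A B v₀ h1 h2)

/-- The unfolded integral: an archimedean factor times the Dirichlet series of the reducible forms.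
-/
theorem integral_tsum_redTerm (ε : DiscSign) {q : ℕ} (hq : q ≠ 0) (r : ℕ) (A B : ℂ) (v₀ : ℝ)
    (h1 : 2 < (2 * (A / p) + (B - r * A / p) / 2).re) (h2 : 1 < (A / p - (B - r * A / p) / 4).re) :
    ∫ y in window v₀, ∑' x : Fin 3 → ℤ, redTerm ε q fD p r A B x y =
      archFactor fD p r A B * (shapeConst ε : ℂ) ^ (-((B - r * A / p) / 2)) *
        (formSeries ε q (2 * (A / p) + (B - r * A / p) / 2, A / p - (B - r * A / p) / 4) /
          (A / p - (B - r * A / p) / 4 - 1)) := by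
  have hs := summable_redTerm hf hc hsupp hp ε hq r A B v₀ h1 h2
  have hi := hasSum_integral_of_summable_integral_norm
    (integrableOn_redTerm hf hc hsupp hp ε hq r A B v₀) hs
  rw [← hi.tsum_eq]
  have hsupport : Function.support (fun x : Fin 3 → ℤ => ∫ y in window v₀, redTerm ε q fD p r A B x y)
      ⊆ Set.range (formOf ε (q := q)) := by
    intro x hx
    by_contra hxr
    apply hx
    have : redTerm ε q fD p r A B x = 0 := by
      rw [redTerm, if_neg]
      exact fun h => hxr (exists_formOf ε hq x h.1 h.2)
    simp [this]
  rw [← (formOf_injective ε hq).tsum_eq hsupport, ← tsum_formSeries ε q h1 h2, ← tsum_mul_left]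
  have hsum : Summable fun y : (FormClass q × ℕ) × ℤ =>
      ∫ x in window v₀, redTerm ε q fD p r A B (formOf ε y) x :=
    hi.summable.comp_injective (formOf_injective ε hq)
  rw [hsum.tsum_prod]
  refine tsum_congr fun y => ?_
  have h := (hasSum_window_shift (integrableOn_classTerm hf hc hsupp hp ε r A B y) v₀).mul_left
    (classWeight ε y.1)
  rw [integral_classTerm hf hc hsupp hp] at h
  have e : (fun m : ℤ => ∫ x in window v₀, redTerm ε q fD p r A B (formOf ε (y, m)) x) =
      fun m : ℤ => classWeight ε y.1 *
        ∫ x in window v₀, classTerm ε fD p r A B y (x + ((0 : ℝ), (0 : ℝ), (m : ℝ))) := by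
    funext m
    rw [redTerm_formOf, ← integral_const_mul]
  rw [e, h.tsum_eq, classDisc]
  ring

end Unfolding

/-! ### The kernels in coordinates -/

theorem borelElt_eq (y : ℝ × ℝ × ℝ) :
    borelElt y = !![y.1 * y.2.1, 0; y.1 * (1 / y.2.1) * y.2.2, y.1 * (1 / y.2.1)] := by
  simp [borelElt, dMat, aMat, nMat]

theorem det_borelElt {y : ℝ × ℝ × ℝ} (ht : 0 < y.2.1) : (borelElt y).det = y.1 ^ 2 := by
  rw [borelElt_eq, Matrix.det_fin_two_of]
  field_simp
  ring

theorem chiCubic_borelElt {y : ℝ × ℝ × ℝ} (ht : 0 < y.2.1) : chiCubic (borelElt y) = y.1 ^ 12 := by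
  rw [chiCubic, det_borelElt ht]
  ring

theorem iwasawaT_borelElt {y : ℝ × ℝ × ℝ} (hl : 0 < y.1) (ht : 0 < y.2.1) :
    iwasawaT (borelElt y) = y.2.1 := by
  rw [iwasawaT, det_borelElt ht, Real.sqrt_sq hl.le, borelElt_eq]
  simp only [Matrix.of_apply, Matrix.cons_val]
  rw [show (0 : ℝ) ^ 2 + (y.1 * (1 / y.2.1)) ^ 2 = (y.1 / y.2.1) ^ 2 by ring,
    Real.sqrt_sq (by positivity)]
  field_simp

/-- The value of the test function on the translate of a reducible form. -/
theorem testFun_cubicAct_borelElt (ε : DiscSign) (fD : ℝ → ℂ) (x : Fin 3 → ℤ) {y : ℝ × ℝ × ℝ}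
    (hl : 0 < y.1) (ht : 0 < y.2.1) :
    testFun ε fD (cubicAct (borelElt y) (toReal (reducibleForm x))) =
      if x 0 ≠ 0 ∧ 0 < signedDisc ε x then
        (gaussFactor (shape ε (x 0) (signedDisc ε x)) ((x 1 : ℝ) / (2 * x 0)) y.2.1 y.2.2 : ℂ) *
          fD ((x 0 : ℝ) ^ 2 * signedDisc ε x * y.1 ^ 12 * y.2.1 ^ 0)
      else 0 := by
  obtain ⟨l, t, u⟩ := y
  simp only at hl ht
  have hform : cubicAct (borelElt (l, t, u)) (toReal (reducibleForm x)) =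
      ![0, l ^ 3 * t * x 0, l ^ 3 / t * (2 * x 0 * u + x 1),
        l ^ 3 / t ^ 3 * (x 0 * u ^ 2 + x 1 * u + x 2)] := by
    rw [borelElt_eq]
    funext i
    fin_cases i
    · simp [cubicAct, toReal, reducibleForm]
    · simp [cubicAct, toReal, reducibleForm]
      field_simp
    · simp [cubicAct, toReal, reducibleForm]
      field_simp
    · simp [cubicAct, toReal, reducibleForm]
      field_simp
  have hdisc : (ε.toInt : ℝ) * ((l ^ 3 / t * (2 * x 0 * u + x 1)) ^ 2 -
      4 * (l ^ 3 * t * x 0) * (l ^ 3 / t ^ 3 * (x 0 * u ^ 2 + x 1 * u + x 2))) =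
      l ^ 6 / t ^ 2 * signedDisc ε x := by
    rw [signedDisc]
    push_cast
    field_simp
    ring
  have hpos : 0 < l ^ 6 / t ^ 2 := by positivity
  rw [hform]
  split_ifs with h
  · have hb : (x 0 : ℝ) ≠ 0 := mod_cast h.1
    have hD : (0 : ℝ) < signedDisc ε x := mod_cast h.2
    rw [testFun_reducible _ _ _ _ _ (by positivity) (by rw [hdisc]; positivity), hdisc]
    have hshape : shape ε (l ^ 3 * t * x 0) (l ^ 6 / t ^ 2 * signedDisc ε x) =
        shape ε (x 0) (signedDisc ε x) * t ^ 2 := by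
      have hD' : 0 < √(signedDisc ε x : ℝ) := Real.sqrt_pos.mpr hD
      rw [shape, shape, abs_mul, abs_of_pos (by positivity : 0 < l ^ 3 * t),
        Real.sqrt_mul (by positivity), show l ^ 6 / t ^ 2 = (l ^ 3 / t) ^ 2 by ring,
        Real.sqrt_sq (by positivity)]
      field_simp
    rw [hshape, gaussFactor]
    congr 2
    · congr 2
      congr 1
      field_simp
    · field_simp
  · apply testFun_reducible_eq_zero
    rw [hdisc]
    rintro ⟨h1, h2⟩
    refine h ⟨?_, ?_⟩
    · rintro h0
      simp [h0] at h1
    · have := (pos_iff_pos_of_mul_pos h2).mp hpos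
      exact_mod_cast this

/-- The value of the test function on the translate of a binary quadratic form. -/
theorem testFunRed_quadAct_borelElt (ε : DiscSign) (fD : ℝ → ℂ) (x : Fin 3 → ℤ) {y : ℝ × ℝ × ℝ}
    (hl : 0 < y.1) (ht : 0 < y.2.1) :
    testFunRed ε fD (quadAct (borelElt y) (toReal x)) =
      if x 0 ≠ 0 ∧ 0 < signedDisc ε x then
        (gaussFactor (shape ε (x 0) (signedDisc ε x)) ((x 1 : ℝ) / (2 * x 0)) y.2.1 y.2.2 : ℂ) *
          fD ((x 0 : ℝ) ^ 2 * signedDisc ε x * y.1 ^ 8 * y.2.1 ^ 4)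
      else 0 := by
  obtain ⟨l, t, u⟩ := y
  simp only at hl ht
  have hform : reducibleForm (quadAct (borelElt (l, t, u)) (toReal x)) =
      ![0, l ^ 2 * t ^ 2 * x 0, l ^ 2 * (2 * x 0 * u + x 1),
        l ^ 2 / t ^ 2 * (x 0 * u ^ 2 + x 1 * u + x 2)] := by
    rw [borelElt_eq]
    funext i
    fin_cases i
    · simp [quadAct, toReal, reducibleForm]
    · simp [quadAct, toReal, reducibleForm]
      ring
    · simp [quadAct, toReal, reducibleForm]
      field_simp
    · simp [quadAct, toReal, reducibleForm]
      field_simp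
  have hdisc : (ε.toInt : ℝ) * ((l ^ 2 * (2 * x 0 * u + x 1)) ^ 2 -
      4 * (l ^ 2 * t ^ 2 * x 0) * (l ^ 2 / t ^ 2 * (x 0 * u ^ 2 + x 1 * u + x 2))) =
      l ^ 4 * signedDisc ε x := by
    rw [signedDisc]
    push_cast
    field_simp
    ring
  have hpos : 0 < l ^ 4 := by positivity
  rw [testFunRed, hform]
  split_ifs with h
  · have hb : (x 0 : ℝ) ≠ 0 := mod_cast h.1
    have hD : (0 : ℝ) < signedDisc ε x := mod_cast h.2
    rw [testFun_reducible _ _ _ _ _ (by positivity) (by rw [hdisc]; positivity), hdisc]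
    have hshape : shape ε (l ^ 2 * t ^ 2 * x 0) (l ^ 4 * signedDisc ε x) =
        shape ε (x 0) (signedDisc ε x) * t ^ 2 := by
      have hD' : 0 < √(signedDisc ε x : ℝ) := Real.sqrt_pos.mpr hD
      rw [shape, shape, abs_mul, abs_of_pos (by positivity : 0 < l ^ 2 * t ^ 2),
        Real.sqrt_mul (by positivity), show l ^ 4 = (l ^ 2) ^ 2 by ring,
        Real.sqrt_sq (by positivity)]
      field_simp
    rw [hshape, gaussFactor]
    congr 2
    · congr 2
      congr 1
      field_simp
    · ring
  · apply testFun_reducible_eq_zero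
    rw [hdisc]
    rintro ⟨h1, h2⟩
    refine h ⟨?_, ?_⟩
    · rintro h0
      simp [h0] at h1
    · have := (pos_iff_pos_of_mul_pos h2).mp hpos
      exact_mod_cast this

theorem redTerm_eq_cubic (ε : DiscSign) (q : ℕ) (fD : ℝ → ℂ) (A B : ℂ) (x : Fin 3 → ℤ)
    {y : ℝ × ℝ × ℝ} (hl : 0 < y.1) (ht : 0 < y.2.1) :
    redTerm ε q fD 12 0 A B x y = ((y.1 : ℂ) ^ A * (y.2.1 : ℂ) ^ B *
      ((1 / (y.1 * y.2.1 ^ 3) : ℝ) : ℂ)) * (nonMaxInd q (reducibleForm x) *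
        testFun ε fD (cubicAct (borelElt y) (toReal (reducibleForm x)))) := by
  rw [testFun_cubicAct_borelElt ε fD x hl ht, redTerm]
  split_ifs
  · simp only [orbitTerm, nonMaxIndRed, pow_zero, mul_one]; ring
  · simp

theorem redTerm_eq_quad (ε : DiscSign) (q : ℕ) (fD : ℝ → ℂ) (A B : ℂ) (x : Fin 3 → ℤ)
    {y : ℝ × ℝ × ℝ} (hl : 0 < y.1) (ht : 0 < y.2.1) :
    redTerm ε q fD 8 4 A B x y = ((y.1 : ℂ) ^ A * (y.2.1 : ℂ) ^ B *
      ((1 / (y.1 * y.2.1 ^ 3) : ℝ) : ℂ)) * (nonMaxIndRed q x *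
        testFunRed ε fD (quadAct (borelElt y) (toReal x))) := by
  rw [testFunRed_quadAct_borelElt ε fD x hl ht, redTerm]
  split_ifs
  · simp only [orbitTerm]; ring
  · simp

/-- The sum over reducible forms in the integrand of the zeta functions of cubic forms. -/
def redSum (ε : DiscSign) (q : ℕ) (fD : ℝ → ℂ) (g : Matrix (Fin 2) (Fin 2) ℝ) : ℂ :=
  ∑' x : Fin 3 → ℤ, nonMaxInd q (reducibleForm x) *
    testFun ε fD (cubicAct g (toReal (reducibleForm x)))

theorem tsum_redTerm_cubic (ε : DiscSign) (q : ℕ) (fD : ℝ → ℂ) (A B : ℂ)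
    {y : ℝ × ℝ × ℝ} (hl : 0 < y.1) (ht : 0 < y.2.1) :
    ∑' x : Fin 3 → ℤ, redTerm ε q fD 12 0 A B x y = ((y.1 : ℂ) ^ A * (y.2.1 : ℂ) ^ B *
      ((1 / (y.1 * y.2.1 ^ 3) : ℝ) : ℂ)) * redSum ε q fD (borelElt y) := by
  rw [redSum, ← tsum_mul_left]
  exact tsum_congr fun x => redTerm_eq_cubic ε q fD A B x hl ht

theorem pow_cpow_eq {x : ℝ} (hx : 0 < x) (n : ℕ) (s : ℂ) :
    ((x ^ n : ℝ) : ℂ) ^ s = (x : ℂ) ^ (n * s) := by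
  rw [ofReal_cpow_eq_exp (by positivity), ofReal_cpow_eq_exp hx, Real.log_pow]
  push_cast
  ring_nf

/-- The integrand of the reducible zeta function as a combination of two sums of orbit terms. -/
theorem borelIntegrand_redConstKernel (ε : DiscSign) (q : ℕ) (fD : ℝ → ℂ) (z s : ℂ)
    {y : ℝ × ℝ × ℝ} (hl : 0 < y.1) (ht : 0 < y.2.1) :
    borelIntegrand (redConstKernel ε q fD z s) y =
      ∑' x : Fin 3 → ℤ, redTerm ε q fD 12 0 (12 * s) (1 + z) x y +
        xi z / xi (1 + z) * ∑' x : Fin 3 → ℤ, redTerm ε q fD 12 0 (12 * s) (1 - z) x y := by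
  rw [tsum_redTerm_cubic ε q fD _ _ hl ht, tsum_redTerm_cubic ε q fD _ _ hl ht, borelIntegrand,
    redConstKernel, eisensteinConst, iwasawaT_borelElt hl ht, chiCubic_borelElt ht,
    pow_cpow_eq hl, redSum]
  push_cast
  ring

theorem borelIntegrand_quadKernel (ε : DiscSign) (q : ℕ) (fD : ℝ → ℂ) (s₁ s₂ : ℂ)
    {y : ℝ × ℝ × ℝ} (hl : 0 < y.1) (ht : 0 < y.2.1) :
    borelIntegrand (quadKernel q (testFunRed ε fD) s₁ s₂) y =
      ∑' x : Fin 3 → ℤ, redTerm ε q fD 8 4 (2 * s₁ + 4 * s₂) (2 * s₁) x y := by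
  have hl0 : (y.1 : ℂ) ≠ 0 := mod_cast hl.ne'
  have h1 : chiOne (borelElt y) = (y.1 * y.2.1) ^ 2 := by
    rw [chiOne, borelElt_eq]; rfl
  have h2 : chiQuad (borelElt y) = y.1 ^ 4 := by
    rw [chiQuad, det_borelElt ht]; ring
  have e : ∀ x : Fin 3 → ℤ, redTerm ε q fD 8 4 (2 * s₁ + 4 * s₂) (2 * s₁) x y = _ :=
    fun x => redTerm_eq_quad ε q fD _ _ x hl ht
  simp_rw [e]
  rw [tsum_mul_left, borelIntegrand, quadKernel, h1, h2, pow_cpow_eq (mul_pos hl ht),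
    pow_cpow_eq hl, Complex.ofReal_mul y.1, Complex.mul_cpow_ofReal_nonneg hl.le ht.le,
    Complex.cpow_add _ _ hl0]
  push_cast
  ring

/-! ### Evaluation of the reducible zeta functions -/

/-- The function `(s₂ - 1) Z_{q,r}(f_{±,0}, s₁, s₂)`, continued to `Re s₁ > 2`, `Re s₂ > 1/2`. -/
def quadZetaNum (ε : DiscSign) (q : ℕ) (fD : ℝ → ℂ) (s : ℂ × ℂ) : ℂ :=
  (1 / 8) * mellin fD ((s.1 + 2 * s.2) / 4) *
    ((√Real.pi : ℂ) * besselK ((s.1 - 2 * s.2 - 1) / 2) 2) *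
    (shapeConst ε : ℂ) ^ (-((s.1 - 2 * s.2) / 2)) * formSeries ε q s

section Evaluation

variable {fD : ℝ → ℂ} (hf : Continuous fD) (hc : HasCompactSupport fD) (hsupp : tsupport fD ⊆ Ioi 0)
include hf hc hsupp

theorem differentiableOn_quadZetaNum (ε : DiscSign) (q : ℕ) :
    DifferentiableOn ℂ (quadZetaNum ε q fD) {s | 2 < s.1.re ∧ 1 / 2 < s.2.re} := by
  have h1 : Differentiable ℂ fun s : ℂ × ℂ => mellin fD ((s.1 + 2 * s.2) / 4) :=
    (differentiable_mellin_of_support hf hc hsupp).comp (by fun_prop)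
  have h2 : Differentiable ℂ fun s : ℂ × ℂ => besselK ((s.1 - 2 * s.2 - 1) / 2) 2 :=
    Differentiable.comp (g := fun ν => besselK ν 2) (differentiable_besselK two_pos) (by fun_prop)
  have h3 : Differentiable ℂ fun s : ℂ × ℂ => (shapeConst ε : ℂ) ^ (-((s.1 - 2 * s.2) / 2)) := by
    intro s
    refine DifferentiableAt.const_cpow (by fun_prop) (Or.inl ?_)
    exact mod_cast (shapeConst_pos ε).ne'
  exact ((((h1.const_mul _).mul (h2.const_mul _)).mul h3).differentiableOn).mul
    (differentiableOn_formSeries ε q)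

theorem borelIntegrable_quadKernel (ε : DiscSign) {q : ℕ} (hq : q ≠ 0) {s₁ s₂ : ℂ}
    (h1 : 2 < s₁.re) (h2 : 1 < s₂.re) : BorelIntegrable (quadKernel q (testFunRed ε fD) s₁ s₂) := by
  have e1 : 2 * ((2 * s₁ + 4 * s₂) / (8 : ℕ)) + (2 * s₁ - (4 : ℕ) * (2 * s₁ + 4 * s₂) / (8 : ℕ)) / 2
      = s₁ := by push_cast; ring
  have e2 : (2 * s₁ + 4 * s₂) / (8 : ℕ) - (2 * s₁ - (4 : ℕ) * (2 * s₁ + 4 * s₂) / (8 : ℕ)) / 4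
      = s₂ := by push_cast; ring
  have h := integrableOn_tsum_redTerm hf hc hsupp (p := 8) (by norm_num) ε hq 4 (2 * s₁ + 4 * s₂)
    (2 * s₁) 0 (by rw [e1]; exact h1) (by rw [e2]; exact h2)
  rw [window_zero] at h
  refine h.congr_fun (fun y hy => ?_) (window_zero ▸ measurableSet_window 0)
  exact (borelIntegrand_quadKernel ε q fD s₁ s₂ hy.1 hy.2.1).symm

/-- In the coordinates used here `g₁₁ = l t`, which accounts for the exponents `2 s₁ + 4 s₂` and
`2 s₁`. -/
theorem quadZeta_eq (ε : DiscSign) {q : ℕ} (hq : q ≠ 0) {s₁ s₂ : ℂ}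
    (h1 : 2 < s₁.re) (h2 : 1 < s₂.re) :
    quadZeta q (testFunRed ε fD) s₁ s₂ = quadZetaNum ε q fD (s₁, s₂) / (s₂ - 1) := by
  have e1 : 2 * ((2 * s₁ + 4 * s₂) / (8 : ℕ)) + (2 * s₁ - (4 : ℕ) * (2 * s₁ + 4 * s₂) / (8 : ℕ)) / 2
      = s₁ := by push_cast; ring
  have e2 : (2 * s₁ + 4 * s₂) / (8 : ℕ) - (2 * s₁ - (4 : ℕ) * (2 * s₁ + 4 * s₂) / (8 : ℕ)) / 4
      = s₂ := by push_cast; ring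
  have h := integral_tsum_redTerm hf hc hsupp (p := 8) (by norm_num) ε hq 4 (2 * s₁ + 4 * s₂)
    (2 * s₁) 0 (by rw [e1]; exact h1) (by rw [e2]; exact h2)
  rw [e1, e2, window_zero] at h
  rw [quadZeta, borelIntegral, setIntegral_congr_fun (window_zero ▸ measurableSet_window 0)
    (fun y hy => borelIntegrand_quadKernel ε q fD s₁ s₂ hy.1 hy.2.1), h, archFactor, quadZetaNum]
  have e3 : (2 * s₁ + 4 * s₂) / (8 : ℕ) = (s₁ + 2 * s₂) / 4 := by push_cast; ring
  have e4 : 2 * s₁ - (4 : ℕ) * (2 * s₁ + 4 * s₂) / (8 : ℕ) = s₁ - 2 * s₂ := by push_cast; ring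
  rw [e3, e4]
  push_cast
  ring

/-- The cubic analogue of `borelIntegrable_quadKernel` and `quadZeta_eq`, for one of the two powers
`t^(1 + w)` of the constant term. -/
theorem integral_redTerm_cubic (ε : DiscSign) {q : ℕ} (hq : q ≠ 0) {s w : ℂ} (hw : w.re = 0)
    (hs : 5 / 4 < s.re) (v₀ : ℝ) :
    IntegrableOn (fun y => ∑' x : Fin 3 → ℤ, redTerm ε q fD 12 0 (12 * s) (1 + w) x y) (window v₀) ∧
    ∫ y in window v₀, ∑' x : Fin 3 → ℤ, redTerm ε q fD 12 0 (12 * s) (1 + w) x y =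
      2 / 3 * (quadZetaNum ε q fD (2 * s + 1 / 2 + w / 2, s - 1 / 4 - w / 4) /
        (s - 1 / 4 - w / 4 - 1)) := by
  have e1 : 2 * (12 * s / (12 : ℕ)) + (1 + w - (0 : ℕ) * (12 * s) / (12 : ℕ)) / 2
      = 2 * s + 1 / 2 + w / 2 := by push_cast; ring
  have e2 : 12 * s / (12 : ℕ) - (1 + w - (0 : ℕ) * (12 * s) / (12 : ℕ)) / 4
      = s - 1 / 4 - w / 4 := by push_cast; ring
  have h1 : 2 < (2 * s + 1 / 2 + w / 2).re := by
    simp [hw]; linarith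
  have h2 : 1 < (s - 1 / 4 - w / 4).re := by
    simp [hw]; linarith
  refine ⟨integrableOn_tsum_redTerm hf hc hsupp (p := 12) (by norm_num) ε hq 0 (12 * s)
    (1 + w) v₀ (by rw [e1]; exact h1) (by rw [e2]; exact h2), ?_⟩
  have h := integral_tsum_redTerm hf hc hsupp (p := 12) (by norm_num) ε hq 0 (12 * s)
    (1 + w) v₀ (by rw [e1]; exact h1) (by rw [e2]; exact h2)
  rw [e1, e2] at h
  rw [h, archFactor, quadZetaNum]
  have e3 : 12 * s / (12 : ℕ) = (2 * s + 1 / 2 + w / 2 + 2 * (s - 1 / 4 - w / 4)) / 4 := by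
    push_cast; ring
  have e4 : 1 + w - (0 : ℕ) * (12 * s) / (12 : ℕ) =
      2 * s + 1 / 2 + w / 2 - 2 * (s - 1 / 4 - w / 4) := by push_cast; ring
  rw [e3, e4]
  push_cast
  ring

/-- The reducible zeta function in its region of absolute convergence, computed over any strip
`v₀ ≤ u < v₀ + 1`. The strip `[0, 1)` occurs in its definition, and `[-1/2, 1/2)` contains the
fundamental domain of the full group. -/
theorem integral_redConstKernel (ε : DiscSign) {q : ℕ} (hq : q ≠ 0) {z s : ℂ} (hz : z.re = 0)
    (hs : 5 / 4 < s.re) (v₀ : ℝ) :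
    IntegrableOn (borelIntegrand (redConstKernel ε q fD z s)) (window v₀) ∧
    (1 / 2) * ∫ y in window v₀, borelIntegrand (redConstKernel ε q fD z s) y =
      1 / 3 * (quadZetaNum ε q fD (2 * s + 1 / 2 + z / 2, s - 1 / 4 - z / 4) /
          (s - 1 / 4 - z / 4 - 1) + xi z / xi (1 + z) *
        (quadZetaNum ε q fD (2 * s + 1 / 2 - z / 2, s - 1 / 4 + z / 4) /
          (s - 1 / 4 + z / 4 - 1))) := by
  have hp := integral_redTerm_cubic hf hc hsupp ε hq hz hs v₀
  have hm := integral_redTerm_cubic hf hc hsupp ε hq (w := -z) (by simpa using hz) hs v₀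
  simp only [← sub_eq_add_neg, neg_div, sub_neg_eq_add] at hm
  have e : ∀ y ∈ window v₀, borelIntegrand (redConstKernel ε q fD z s) y = _ := fun y hy =>
    borelIntegrand_redConstKernel ε q fD z s hy.1 hy.2.1
  refine ⟨?_, ?_⟩
  · rw [integrableOn_congr_fun e (measurableSet_window v₀)]
    exact hp.1.add (hm.1.const_mul _)
  · rw [setIntegral_congr_fun (measurableSet_window v₀) e, integral_add hp.1 (hm.1.const_mul _),
      integral_const_mul, hp.2, hm.2]
    ring

end Evaluation

/-! ### Bounds for the Eisenstein series -/

theorem norm_etaDiv_le {ν : ℂ} (hν : ν.re = 0) (m : ℕ) : ‖etaDiv ν m‖ ≤ m := by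
  have h : ∀ ab ∈ m.divisorsAntidiagonal, ‖((((ab.1 : ℝ) / (ab.2 : ℝ) : ℝ) : ℂ) ^ ν)‖ = 1 := by
    intro ab hab
    obtain ⟨h1, h2⟩ := Nat.mem_divisorsAntidiagonal.mp hab
    have ha : (0 : ℝ) < ab.1 := by
      have : ab.1 ≠ 0 := by rintro h; simp [h] at h1; exact h2 h1.symm
      positivity
    have hb : (0 : ℝ) < ab.2 := by
      have : ab.2 ≠ 0 := by rintro h; simp [h] at h1; exact h2 h1.symm
      positivity
    rw [Complex.norm_cpow_eq_rpow_re_of_pos (by positivity), hν, Real.rpow_zero]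
  calc ‖etaDiv ν m‖ ≤ ∑ ab ∈ m.divisorsAntidiagonal, (1 : ℝ) :=
        (norm_sum_le _ _).trans_eq (Finset.sum_congr rfl h)
    _ ≤ m := by
        rw [Finset.sum_const, nsmul_eq_mul, mul_one, ← Nat.map_div_right_divisors, Finset.card_map]
        exact_mod_cast Nat.card_divisors_le_self m

/-- The Bessel function decays exponentially. -/
theorem exists_norm_besselK_le (ν : ℂ) : ∃ C, 0 ≤ C ∧ ∀ x : ℝ, 1 ≤ x →
    ‖besselK ν x‖ ≤ C * Real.exp (-x) := by
  have hint : IntegrableOn (fun y : ℝ => ‖(y : ℂ) ^ (ν - 1) • besselExp (1 / 2) y‖) (Ioi 0) :=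
    (mellinConvergent_besselExp one_half_pos ν).norm
  refine ⟨1 / 2 * (Real.exp 1 * ∫ y in Ioi (0 : ℝ), ‖(y : ℂ) ^ (ν - 1) • besselExp (1 / 2) y‖),
    mul_nonneg (by norm_num) (mul_nonneg (Real.exp_pos _).le
      (integral_nonneg fun _ => norm_nonneg _)), fun x hx => ?_⟩
  rw [besselK_eq_mellin, norm_mul, mellin]
  have h12 : ‖(1 / 2 : ℂ)‖ = 1 / 2 := by norm_num
  rw [h12, mul_assoc, mul_assoc, mul_comm (∫ y in Ioi (0 : ℝ), _), ← mul_assoc (Real.exp 1),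
    ← Real.exp_add]
  refine mul_le_mul_of_nonneg_left ?_ (by norm_num)
  rw [← integral_const_mul]
  refine norm_integral_le_of_norm_le (hint.const_mul _) ?_
  refine (ae_restrict_mem measurableSet_Ioi).mono fun y (hy : 0 < y) => ?_
  rw [norm_smul, norm_smul, norm_besselExp, norm_besselExp, mul_left_comm, ← Real.exp_add]
  refine mul_le_mul_of_nonneg_left (Real.exp_le_exp.mpr ?_) (norm_nonneg _)
  have h2 : 2 ≤ y + 1 / y := by
    have : y + 1 / y - 2 = (y - 1) ^ 2 / y := by field_simp; ring
    have : 0 ≤ (y - 1) ^ 2 / y := by positivity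
    linarith
  nlinarith

theorem measurable_besselK (ν : ℂ) : Measurable (besselK ν) := by
  have h : StronglyMeasurable fun x : ℝ => ∫ y in Ioi (0 : ℝ),
      (Real.exp (-(x / 2) * (y + 1 / y)) : ℂ) * (y : ℂ) ^ (ν - 1) := by
    refine StronglyMeasurable.integral_prod_right' (f := fun p : ℝ × ℝ =>
      (Real.exp (-(p.1 / 2) * (p.2 + 1 / p.2)) : ℂ) * (p.2 : ℂ) ^ (ν - 1)) ?_
    exact Measurable.stronglyMeasurable (by fun_prop)
  exact h.measurable.const_mul _

/-- The constant term of the Eisenstein series in the coordinate `t`. -/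
def constTerm (z : ℂ) (t : ℝ) : ℂ := (t : ℂ) ^ (1 + z) + xi z / xi (1 + z) * (t : ℂ) ^ (1 - z)

/-- The summands of the nonconstant part of the Fourier development of the Eisenstein series. -/
def fourierTerm (z : ℂ) (m : ℕ) (x : ℝ × ℝ) : ℂ :=
  etaDiv (z / 2) (m + 1) * besselK (z / 2) (2 * Real.pi * (m + 1) * x.1 ^ 2) *
      (Real.cos (2 * Real.pi * (m + 1) * x.2) : ℂ)

/-- The nonconstant part of the Eisenstein series in the coordinates `(t, u)`. -/
def cuspTerm (z : ℂ) (x : ℝ × ℝ) : ℂ := 4 * (x.1 : ℂ) / xi (1 + z) * ∑' m : ℕ, fourierTerm z m x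

theorem eisenstein_eq (z : ℂ) (g : Matrix (Fin 2) (Fin 2) ℝ) :
    eisenstein z g = constTerm z (iwasawaT g) + cuspTerm z (iwasawaT g, iwasawaU g) := rfl

theorem measurable_constTerm (z : ℂ) : Measurable (constTerm z) := by
  unfold constTerm
  fun_prop

theorem exists_norm_constTerm_le {z : ℂ} (hz : z.re = 0) : ∃ C, 0 ≤ C ∧ ∀ t : ℝ, 0 < t →
    ‖constTerm z t‖ ≤ C * t := by
  refine ⟨1 + ‖xi z / xi (1 + z)‖, by positivity, fun t ht => ?_⟩
  refine (norm_add_le _ _).trans ?_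
  rw [norm_mul, Complex.norm_cpow_eq_rpow_re_of_pos ht, Complex.norm_cpow_eq_rpow_re_of_pos ht]
  simp only [Complex.add_re, Complex.sub_re, Complex.one_re, hz, add_zero, sub_zero, Real.rpow_one]
  rw [add_mul, one_mul]

theorem summable_succ_mul_exp : Summable fun m : ℕ => ((m : ℝ) + 1) * Real.exp (-((m : ℝ) + 1)) := by
  have h := Real.summable_pow_mul_exp_neg_nat_mul 1 one_pos
  have h2 := (summable_nat_add_iff 1).mpr h
  simpa using h2

/-- In the Siegel domain `t ≥ 1/2` the Fourier series is dominated by a convergent series. -/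
theorem exists_norm_fourierTerm_le {z : ℂ} (hz : z.re = 0) : ∃ C, 0 ≤ C ∧ ∀ (m : ℕ) (x : ℝ × ℝ),
    1 / 2 ≤ x.1 → ‖fourierTerm z m x‖ ≤
      C * Real.exp (-x.1) * (((m : ℝ) + 1) * Real.exp (-((m : ℝ) + 1))) := by
  obtain ⟨C, hC, hK⟩ := exists_norm_besselK_le (z / 2)
  refine ⟨C, hC, fun m x hx => ?_⟩
  have hm : (0 : ℝ) ≤ m := m.cast_nonneg
  have hπ := Real.pi_gt_three
  have ht2 : 1 / 4 ≤ x.1 ^ 2 := by nlinarith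
  have harg : x.1 + (m + 1) ≤ 2 * Real.pi * (m + 1) * x.1 ^ 2 := by
    have h1 : 6 * ((m + 1) * x.1 ^ 2) ≤ 2 * Real.pi * (m + 1) * x.1 ^ 2 := by
      have : 0 ≤ (m + 1 : ℝ) * x.1 ^ 2 := by positivity
      nlinarith
    nlinarith
  have h1 : 1 ≤ 2 * Real.pi * (m + 1) * x.1 ^ 2 := by linarith
  have hη : ‖etaDiv (z / 2) (m + 1)‖ ≤ (m : ℝ) + 1 := by
    have := norm_etaDiv_le (ν := z / 2) (by simp [hz]) (m + 1)
    exact_mod_cast this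
  have hcos : ‖(Real.cos (2 * Real.pi * (m + 1) * x.2) : ℂ)‖ ≤ 1 := by
    rw [Complex.norm_real]
    exact Real.abs_cos_le_one _
  rw [fourierTerm, norm_mul, norm_mul]
  calc _ ≤ ((m : ℝ) + 1) * (C * Real.exp (-(x.1 + (m + 1)))) * 1 := by
        gcongr
        refine (hK _ h1).trans ?_
        gcongr
    _ = _ := by rw [neg_add, Real.exp_add]; ring

theorem summable_fourierTerm {z : ℂ} (hz : z.re = 0) {x : ℝ × ℝ} (hx : 1 / 2 ≤ x.1) :
    Summable fun m : ℕ => fourierTerm z m x := by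
  obtain ⟨C, -, h⟩ := exists_norm_fourierTerm_le hz
  exact Summable.of_norm_bounded (summable_succ_mul_exp.mul_left _) fun m => h m x hx

theorem exists_norm_cuspTerm_le {z : ℂ} (hz : z.re = 0) : ∃ C, 0 ≤ C ∧ ∀ x : ℝ × ℝ, 1 / 2 ≤ x.1 →
    ‖cuspTerm z x‖ ≤ C := by
  obtain ⟨C, hC, h⟩ := exists_norm_fourierTerm_le hz
  set S := ∑' m : ℕ, ((m : ℝ) + 1) * Real.exp (-((m : ℝ) + 1))
  have hS : 0 ≤ S := tsum_nonneg fun m => by positivity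
  refine ⟨4 / ‖xi (1 + z)‖ * (C * S), by positivity, fun x hx => ?_⟩
  have hx0 : 0 ≤ x.1 := by linarith
  have h1 : ‖∑' m : ℕ, fourierTerm z m x‖ ≤ C * Real.exp (-x.1) * S :=
    tsum_of_norm_bounded (summable_succ_mul_exp.hasSum.mul_left _) fun m => h m x hx
  have h2 : x.1 * Real.exp (-x.1) ≤ 1 := by
    rw [Real.exp_neg, ← div_eq_mul_inv, div_le_one (Real.exp_pos _)]
    linarith [Real.add_one_le_exp x.1]
  rw [cuspTerm, norm_mul, norm_div, norm_mul, Complex.norm_real, Real.norm_of_nonneg hx0,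
    show ‖(4 : ℂ)‖ = 4 by norm_num]
  calc _ ≤ 4 * x.1 / ‖xi (1 + z)‖ * (C * Real.exp (-x.1) * S) := by gcongr
    _ = 4 / ‖xi (1 + z)‖ * (C * S) * (x.1 * Real.exp (-x.1)) := by ring
    _ ≤ 4 / ‖xi (1 + z)‖ * (C * S) * 1 := by gcongr
    _ = _ := mul_one _

theorem measurable_fourierTerm (z : ℂ) (m : ℕ) : Measurable (fourierTerm z m) := by
  have h := measurable_besselK (z / 2)
  unfold fourierTerm
  fun_prop

/-! ### The fundamental domain -/

/-- The coordinates `(l, t, u)` of the fundamental domain of `G⁺ / SL₂(ℤ)`. -/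
def fundDomain : Set (ℝ × ℝ × ℝ) :=
  {y | 0 < y.1 ∧ 0 < y.2.1 ∧ -(1 / 2) ≤ y.2.2 ∧ y.2.2 < 1 / 2 ∧ 1 ≤ y.2.2 ^ 2 + y.2.1 ^ 4}

theorem measurableSet_fundDomain : MeasurableSet fundDomain := by
  unfold fundDomain
  measurability

theorem fundDomain_subset : fundDomain ⊆ window (-(1 / 2)) := by
  rintro ⟨l, t, u⟩ ⟨h1, h2, h3, h4, -⟩
  exact ⟨h1, h2, h3, by simp only at h4 ⊢; linarith⟩

theorem half_le_of_mem_fundDomain {y : ℝ × ℝ × ℝ} (hy : y ∈ fundDomain) : 1 / 2 ≤ y.2.1 := by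
  obtain ⟨-, h2, h3, h4, h5⟩ := hy
  by_contra! h
  have h6 : y.2.2 ^ 2 ≤ 1 / 4 := by nlinarith
  have h7 : y.2.1 ^ 2 ≤ 1 / 4 := by nlinarith
  nlinarith [sq_nonneg (y.2.1 ^ 2)]

theorem le_one_of_notMem_fundDomain {y : ℝ × ℝ × ℝ} (hy : y ∈ window (-(1 / 2)))
    (hy' : y ∉ fundDomain) : y.2.1 ≤ 1 := by
  obtain ⟨h1, h2, h3, h4⟩ := hy
  by_contra! h
  refine hy' ⟨h1, h2, h3, by linarith, ?_⟩
  nlinarith [sq_nonneg y.2.2, one_le_pow₀ h.le (n := 4)]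

theorem aestronglyMeasurable_cuspTerm {z : ℂ} (hz : z.re = 0) :
    AEStronglyMeasurable (fun y : ℝ × ℝ × ℝ => cuspTerm z y.2) (volume.restrict fundDomain) := by
  have h : AEStronglyMeasurable (fun y : ℝ × ℝ × ℝ => ∑' m : ℕ, fourierTerm z m y.2)
      (volume.restrict fundDomain) := by
    refine aestronglyMeasurable_tsum (fun m =>
      ((measurable_fourierTerm z m).comp measurable_snd).aestronglyMeasurable) ?_
    refine (ae_restrict_mem measurableSet_fundDomain).mono fun y hy => ?_
    exact summable_fourierTerm hz (half_le_of_mem_fundDomain hy)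
  refine AEStronglyMeasurable.mul ?_ h
  exact Measurable.aestronglyMeasurable (by fun_prop)

/-! ### Decay of the test function and sums over lattices -/

/-- The decay function `(1 + |y|)⁻²`. -/
def decay (y : ℝ) : ℝ := ((1 + |y|) ^ 2)⁻¹

theorem decay_pos (y : ℝ) : 0 < decay y := by
  unfold decay
  positivity

theorem decay_anti {x y : ℝ} (h : |x| ≤ |y|) : decay y ≤ decay x := by
  unfold decay
  gcongr

/-- The linear bound in `1 / c`, by comparison with a telescoping series. -/
theorem tsum_decay_succ_le {c : ℝ} (hc : 0 < c) :
    ∑' n : ℕ, ENNReal.ofReal (decay (c * (n + 1))) ≤ ENNReal.ofReal (1 / c) := by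
  refine ENNReal.tsum_le_of_sum_range_le fun N => ?_
  rw [← ENNReal.ofReal_sum_of_nonneg fun n _ => (decay_pos _).le]
  refine ENNReal.ofReal_le_ofReal ?_
  have key : ∀ N : ℕ, ∑ n ∈ Finset.range N, decay (c * (n + 1)) ≤ 1 / c - 1 / (c * (1 + c * N)) := by
    intro N
    induction N with
    | zero => simp
    | succ N ih =>
      rw [Finset.sum_range_succ]
      have h1 : decay (c * (N + 1)) ≤ 1 / (c * (1 + c * N)) - 1 / (c * (1 + c * (N + 1))) := by
        rw [decay, abs_of_pos (by positivity)]
        have : 1 / (c * (1 + c * N)) - 1 / (c * (1 + c * (N + 1))) =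
            ((1 + c * N) * (1 + c * (N + 1)))⁻¹ := by
          field_simp
          ring
        rw [this, sq]
        gcongr
        linarith
      push_cast
      linarith
  refine (key N).trans ?_
  have : 0 ≤ 1 / (c * (1 + c * N)) := by positivity
  linarith

/-- The quadratic bound in `1 / c`, which is the better one for large `c`. -/
theorem tsum_decay_succ_le' {c : ℝ} (hc : 0 < c) :
    ∑' n : ℕ, ENNReal.ofReal (decay (c * (n + 1))) ≤ ENNReal.ofReal (2 / c ^ 2) := by
  refine ENNReal.tsum_le_of_sum_range_le fun N => ?_
  rw [← ENNReal.ofReal_sum_of_nonneg fun n _ => (decay_pos _).le]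
  refine ENNReal.ofReal_le_ofReal ?_
  have key : ∀ N : ℕ, ∑ n ∈ Finset.range N, decay (c * (n + 1)) ≤ 2 / c ^ 2 * (1 - 1 / (N + 1)) := by
    intro N
    induction N with
    | zero => simp
    | succ N ih =>
      rw [Finset.sum_range_succ]
      have h1 : decay (c * (N + 1)) ≤ 2 / c ^ 2 * (1 / (N + 1) - 1 / (N + 2)) := by
        rw [decay, abs_of_pos (by positivity)]
        have : 2 / c ^ 2 * (1 / ((N : ℝ) + 1) - 1 / (N + 2)) =
            (c ^ 2 * ((N + 1) * ((N + 2) / 2)))⁻¹ := by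
          field_simp
          ring
        rw [this]
        gcongr
        have : c ^ 2 * ((N + 1) * (((N : ℝ) + 2) / 2)) ≤ (c * (N + 1)) ^ 2 := by
          rw [mul_pow]
          gcongr
          have : (0 : ℝ) ≤ N := N.cast_nonneg
          nlinarith
        have h0 : 0 < c * (N + 1) := by positivity
        nlinarith
      push_cast
      have : 2 / c ^ 2 * (1 - 1 / ((N : ℝ) + 1 + 1)) = 2 / c ^ 2 * (1 - 1 / (N + 1)) +
        2 / c ^ 2 * (1 / (N + 1) - 1 / (N + 2)) := by ring
      linarith
  refine (key N).trans (mul_le_of_le_one_right (by positivity) ?_)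
  have : (0 : ℝ) ≤ 1 / (N + 1) := by positivity
  linarith

theorem tsum_decay_le {c : ℝ} (hc : 0 < c) :
    ∑' n : ℕ, ENNReal.ofReal (decay (c * n)) ≤ ENNReal.ofReal (1 + 1 / c) := by
  rw [tsum_eq_zero_add' ENNReal.summable , ENNReal.ofReal_add one_pos.le (by positivity)]
  refine add_le_add (ENNReal.ofReal_le_ofReal (by simp [decay])) ?_
  simpa using tsum_decay_succ_le hc

/-- A sum over a translate of the lattice `c ℤ`, bounded uniformly in the translation. -/
theorem tsum_int_decay_le {c : ℝ} (hc : 0 < c) (α : ℝ) :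
    ∑' n : ℤ, ENNReal.ofReal (decay (c * (n + α))) ≤ ENNReal.ofReal (2 + 2 / c) := by
  have e : ∑' n : ℤ, ENNReal.ofReal (decay (c * (n + α))) =
      ∑' n : ℤ, ENNReal.ofReal (decay (c * (n + Int.fract α))) := by
    rw [← (Equiv.subRight ⌊α⌋).tsum_eq]
    refine tsum_congr fun n => ?_
    rw [Equiv.subRight_apply, Int.fract]
    push_cast
    ring_nf
  have h0 := Int.fract_nonneg α
  have h1 := (Int.fract_lt_one α).le
  rw [e, tsum_of_nat_of_neg_add_one ENNReal.summable ENNReal.summable,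
    show (2 : ℝ) + 2 / c = (1 + 1 / c) + (1 + 1 / c) by ring,
    ENNReal.ofReal_add (by positivity) (by positivity)]
  have hn : ∀ n : ℕ, (0 : ℝ) ≤ n := fun n => n.cast_nonneg
  refine add_le_add ((ENNReal.tsum_le_tsum fun n => ?_).trans (tsum_decay_le hc))
    ((ENNReal.tsum_le_tsum fun n => ?_).trans (tsum_decay_le hc))
  · refine ENNReal.ofReal_le_ofReal (decay_anti ?_)
    rw [abs_mul, abs_mul]
    gcongr
    have := hn n
    push_cast
    linarith
  · refine ENNReal.ofReal_le_ofReal (decay_anti ?_)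
    rw [abs_mul, abs_mul]
    refine mul_le_mul_of_nonneg_left ?_ (abs_nonneg _)
    have := hn n
    push_cast
    rw [abs_of_nonneg this, abs_of_nonpos (by linarith)]
    linarith

theorem tsum_int_ne_zero_decay (c : ℝ) :
    ∑' n : ℤ, (if n ≠ 0 then ENNReal.ofReal (decay (c * n)) else 0) =
      2 * ∑' n : ℕ, ENNReal.ofReal (decay (c * (n + 1))) := by
  rw [tsum_of_nat_of_neg_add_one ENNReal.summable ENNReal.summable,
    tsum_eq_zero_add' ENNReal.summable, two_mul]
  congr 1
  · simp only [Nat.cast_zero, ne_eq, not_true_eq_false, if_false, zero_add]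
    refine tsum_congr fun n => ?_
    rw [if_pos (by push_cast; omega)]
    push_cast
    rfl
  · refine tsum_congr fun n => ?_
    rw [if_pos (by omega)]
    congr 1
    rw [decay, decay]
    push_cast
    rw [mul_neg, abs_neg]

theorem abs_mul_mul_le {a b c S : ℝ} (ha : |a| ≤ S) (hb : |b| ≤ S) (hc : |c| ≤ S) :
    |a * b * c| ≤ S ^ 3 := by
  have hS := (abs_nonneg a).trans ha
  rw [abs_mul, abs_mul, pow_succ, sq]
  gcongr

theorem exists_abs_basePoint_le (ε : DiscSign) : ∃ K, 1 ≤ K ∧ ∀ i, |basePoint ε i| ≤ K := by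
  refine ⟨1 + ∑ i, |basePoint ε i|, ?_, fun i => ?_⟩
  · have : 0 ≤ ∑ i, |basePoint ε i| := Finset.sum_nonneg fun i _ => abs_nonneg _
    linarith
  · have := Finset.single_le_sum (f := fun i => |basePoint ε i|) (fun i _ => abs_nonneg _)
      (Finset.mem_univ i)
    linarith

theorem abs_cubicAct_le {K S : ℝ} {x : Fin 4 → ℝ} (hx : ∀ i, |x i| ≤ K)
    {h : Matrix (Fin 2) (Fin 2) ℝ} (hh : ∀ i j, |h i j| ≤ S) (i : Fin 4) :
    |cubicAct h x i| ≤ 12 * (K * S ^ 3) := by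
  have hS := (abs_nonneg _).trans (hh 0 0)
  have m : ∀ (i : Fin 4) (a b c d e f : Fin 2), |x i * (h a b * h c d * h e f)| ≤ K * S ^ 3 := by
    intro i a b c d e f
    rw [abs_mul]
    exact mul_le_mul (hx i) (abs_mul_mul_le (hh _ _) (hh _ _) (hh _ _)) (abs_nonneg _)
      ((abs_nonneg _).trans (hx i))
  have key : ∀ (a b : Fin 2), |x 0 * (h a 0 * h a 0 * h b 0)| ≤ K * S ^ 3 := fun a b => m _ _ _ _ _ _ _
  have hK : 0 ≤ K * S ^ 3 := (abs_nonneg _).trans (key 0 0)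
  rw [abs_le]
  have M := fun i a b c d e f => abs_le.mp (m i a b c d e f)
  fin_cases i
  · have h1 := M 0 0 0 0 0 0 0
    have h2 := M 1 0 0 0 0 0 1
    have h3 := M 2 0 0 0 1 0 1
    have h4 := M 3 0 1 0 1 0 1
    simp only [cubicAct, Matrix.cons_val, Fin.zero_eta, Fin.isValue]
    constructor <;> linarith
  · have h1 := M 0 0 0 0 0 1 0
    have h2 := M 1 0 0 1 0 0 1
    have h3 := M 1 0 0 0 0 1 1
    have h4 := M 2 1 0 0 1 0 1
    have h5 := M 2 0 0 0 1 1 1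
    have h6 := M 3 0 1 0 1 1 1
    simp only [cubicAct, Matrix.cons_val, Fin.mk_one, Fin.isValue]
    constructor <;> linarith
  · have h1 := M 0 0 0 1 0 1 0
    have h2 := M 1 1 0 1 0 0 1
    have h3 := M 1 0 0 1 0 1 1
    have h4 := M 2 1 0 0 1 1 1
    have h5 := M 2 0 0 1 1 1 1
    have h6 := M 3 0 1 1 1 1 1
    simp only [cubicAct, Matrix.cons_val, Fin.reduceFinMk, Fin.isValue]
    constructor <;> linarith
  · have h1 := M 0 1 0 1 0 1 0
    have h2 := M 1 1 0 1 0 1 1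
    have h3 := M 2 1 0 1 1 1 1
    have h4 := M 3 1 1 1 1 1 1
    simp only [cubicAct, Matrix.cons_val, Fin.reduceFinMk, Fin.isValue]
    constructor <;> linarith

theorem trace_transpose_mul_self (h : Matrix (Fin 2) (Fin 2) ℝ) :
    (h.transpose * h).trace = h 0 0 ^ 2 + h 0 1 ^ 2 + h 1 0 ^ 2 + h 1 1 ^ 2 := by
  simp [Matrix.trace, Fin.sum_univ_two, Matrix.mul_apply]
  ring

/-- A bound for the support of `fD`. -/
theorem exists_bound_of_hasCompactSupport {fD : ℝ → ℂ} (hc : HasCompactSupport fD) :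
    ∃ M, 1 ≤ M ∧ ∀ x, fD x ≠ 0 → x ≤ M := by
  obtain ⟨M, hM⟩ := hc.isCompact.bddAbove
  exact ⟨max 1 M, le_max_left _ _, fun x hx => (hM (subset_tsupport _ hx)).trans (le_max_right _ _)⟩

/-- The test function decays rapidly: on the orbit, `fG` decays exponentially in the entries of the
group element, since the determinant is bounded on the support of `fD`. -/
theorem exists_norm_testFun_le (ε : DiscSign) {fD : ℝ → ℂ} (hf : Continuous fD)
    (hc : HasCompactSupport fD) : ∃ C, 0 ≤ C ∧ ∀ y : Fin 4 → ℝ,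
      ‖testFun ε fD y‖ ≤ C * ∏ i, decay (y i) := by
  obtain ⟨M, hM1, hM⟩ := exists_bound_of_hasCompactSupport hc
  obtain ⟨B, hB⟩ := hf.bounded_above_of_compact_support hc
  obtain ⟨K, hK1, hK⟩ := exists_abs_basePoint_le ε
  have hB0 : 0 ≤ B := (norm_nonneg _).trans (hB 0)
  refine ⟨(13 * K) ^ 8 * ((Nat.factorial 24) * M ^ 24 * Real.exp 1) * B, by positivity, fun y => ?_⟩
  have hprod : 0 ≤ ∏ i, decay (y i) := Finset.prod_nonneg fun i _ => (decay_pos _).le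
  by_cases hy : ∃ g : Matrix (Fin 2) (Fin 2) ℝ, 0 < g.det ∧ cubicAct g (basePoint ε) = y
  swap
  · rw [testFun, dif_neg hy, norm_zero]
    positivity
  obtain ⟨g, hg, rfl⟩ := hy
  rw [testFun_apply ε fD hg]
  by_cases h0 : fD (chiCubic g) = 0
  · rw [h0, mul_zero, norm_zero]
    positivity
  have hdet : g.det ≤ M := by
    have h1 := hM _ h0
    rw [chiCubic] at h1
    by_contra! h2
    have h3 : 1 ≤ g.det := by linarith
    have : g.det ≤ g.det ^ 6 := le_self_pow₀ h3 (by norm_num)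
    linarith
  set R := (g.transpose * g).trace with hR
  have hRe := trace_transpose_mul_self g
  rw [← hR] at hRe
  have hR0 : 0 ≤ R := by rw [hRe]; positivity
  have hent : ∀ i j, |g i j| ≤ 1 + R := by
    have aux : ∀ x : ℝ, x ^ 2 ≤ R → |x| ≤ 1 + R := by
      intro x hx
      rw [abs_le]
      constructor <;> nlinarith [sq_nonneg (x - 1), sq_nonneg (x + 1)]
    intro i j
    apply aux
    rw [hRe]
    fin_cases i <;> fin_cases j <;> simp <;> nlinarith [sq_nonneg (g 0 0), sq_nonneg (g 0 1),
      sq_nonneg (g 1 0), sq_nonneg (g 1 1)]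
  have hy := abs_cubicAct_le hK hent
  have hS : 1 ≤ (1 + R) ^ 3 := one_le_pow₀ (by linarith)
  have hdec : ∀ i, (((13 * K) * (1 + R) ^ 3) ^ 2)⁻¹ ≤ decay (cubicAct g (basePoint ε) i) := by
    intro i
    rw [decay]
    gcongr
    have := hy i
    nlinarith
  have hdecp : (((13 * K) ^ 8 * (1 + R) ^ 24))⁻¹ ≤ ∏ i, decay (cubicAct g (basePoint ε) i) := by
    calc (((13 * K) ^ 8 * (1 + R) ^ 24))⁻¹ = ∏ _i : Fin 4, (((13 * K) * (1 + R) ^ 3) ^ 2)⁻¹ := by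
          rw [Finset.prod_const, Finset.card_univ, Fintype.card_fin, inv_pow]
          congr 1
          ring
      _ ≤ _ := Finset.prod_le_prod (fun i _ => by positivity) fun i _ => hdec i
  -- the exponent `24` is four coefficients times two powers of a cubic polynomial in the entries
  have hfG : fG g ≤ (Nat.factorial 24) * M ^ 24 * Real.exp 1 * ((1 + R) ^ 24)⁻¹ := by
    have h1 : fG g ≤ Real.exp (-(R / M)) := by
      rw [fG]
      apply Real.exp_le_exp.mpr
      apply neg_le_neg
      gcongr
    have h2 := Real.pow_div_factorial_le_exp ((1 + R) / M) (by positivity) 24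
    have h3 : Real.exp ((1 + R) / M) ≤ Real.exp 1 * Real.exp (R / M) := by
      rw [← Real.exp_add]
      apply Real.exp_le_exp.mpr
      rw [add_div]
      gcongr
      rw [div_le_one (by positivity)]
      exact hM1
    refine h1.trans ?_
    rw [Real.exp_neg, ← div_eq_mul_inv, le_div_iff₀ (by positivity), inv_mul_le_iff₀ (Real.exp_pos _)]
    have h4 := h2.trans h3
    rw [div_pow, div_div, div_le_iff₀ (by positivity)] at h4
    linarith
  rw [norm_mul, Complex.norm_real, Real.norm_of_nonneg (show 0 ≤ fG g from (Real.exp_pos _).le)]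
  calc fG g * ‖fD (chiCubic g)‖
      ≤ ((Nat.factorial 24) * M ^ 24 * Real.exp 1 * ((1 + R) ^ 24)⁻¹) * B := by
        gcongr
        exact hB _
    _ = (13 * K) ^ 8 * ((Nat.factorial 24) * M ^ 24 * Real.exp 1) * B *
        (((13 * K) ^ 8 * (1 + R) ^ 24))⁻¹ := by
        field_simp
    _ ≤ _ := by gcongr

/-! ### Sums over all integral forms -/

/-- Quadruples as vectors. -/
def quadEquiv : ℤ × ℤ × ℤ × ℤ ≃ (Fin 4 → ℤ) where
  toFun p := ![p.1, p.2.1, p.2.2.1, p.2.2.2]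
  invFun x := (x 0, x 1, x 2, x 3)
  left_inv _ := rfl
  right_inv x := by
    funext i
    fin_cases i <;> rfl

theorem quadEquiv_apply (p : ℤ × ℤ × ℤ × ℤ) : quadEquiv p = ![p.1, p.2.1, p.2.2.1, p.2.2.2] := rfl

theorem cubicAct_borelElt (x : Fin 4 → ℤ) {l t : ℝ} (ht : 0 < t) (u : ℝ) :
    cubicAct (borelElt (l, t, u)) (toReal x) =
      ![l ^ 3 * t ^ 3 * x 0, l ^ 3 * t * (x 1 + 3 * x 0 * u),
        l ^ 3 / t * (x 2 + (3 * x 0 * u ^ 2 + 2 * x 1 * u)),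
        l ^ 3 / t ^ 3 * (x 3 + (x 0 * u ^ 3 + x 1 * u ^ 2 + x 2 * u))] := by
  rw [borelElt_eq]
  funext i
  fin_cases i
  · simp [cubicAct, toReal]
    ring
  · simp [cubicAct, toReal]
    field_simp
    ring
  · simp [cubicAct, toReal]
    field_simp
    ring
  · simp [cubicAct, toReal]
    field_simp
    ring

/-- Sums of the test function over the lattice of integral forms, with weights that depend on the
first coefficient: three of the four coefficients are summed with the help of `tsum_int_decay_le`.
-/
theorem exists_tsum_testFun_le (ε : DiscSign) {fD : ℝ → ℂ} (hf : Continuous fD)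
    (hc : HasCompactSupport fD) : ∃ C, 0 ≤ C ∧ ∀ (w : ℤ → ENNReal) (l t u : ℝ), 0 < l → 0 < t →
      ∑' x : Fin 4 → ℤ, w (x 0) * ‖testFun ε fD (cubicAct (borelElt (l, t, u)) (toReal x))‖ₑ ≤
        (∑' a : ℤ, w a * ENNReal.ofReal (decay (l ^ 3 * t ^ 3 * a))) *
          ENNReal.ofReal (C * ((2 + 2 / (l ^ 3 * t)) * ((2 + 2 / (l ^ 3 / t)) *
            (2 + 2 / (l ^ 3 / t ^ 3))))) := by
  obtain ⟨C, hC, hbound⟩ := exists_norm_testFun_le ε hf hc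
  refine ⟨C, hC, fun w l t u hl ht => ?_⟩
  have hd := fun y => (decay_pos y).le
  have h1 : 0 < l ^ 3 * t := by positivity
  have h2 : 0 < l ^ 3 / t := by positivity
  have h3 : 0 < l ^ 3 / t ^ 3 := by positivity
  have hterm : ∀ p : ℤ × ℤ × ℤ × ℤ, w (quadEquiv p 0) *
      ‖testFun ε fD (cubicAct (borelElt (l, t, u)) (toReal (quadEquiv p)))‖ₑ ≤
        ENNReal.ofReal C * (w p.1 * ENNReal.ofReal (decay (l ^ 3 * t ^ 3 * p.1)) *
          (ENNReal.ofReal (decay (l ^ 3 * t * (p.2.1 + 3 * p.1 * u))) *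
          (ENNReal.ofReal (decay (l ^ 3 / t * (p.2.2.1 + (3 * p.1 * u ^ 2 + 2 * p.2.1 * u)))) *
          ENNReal.ofReal (decay (l ^ 3 / t ^ 3 *
            (p.2.2.2 + (p.1 * u ^ 3 + p.2.1 * u ^ 2 + p.2.2.1 * u))))))) := by
    rintro ⟨a, b, c, d⟩
    have h := hbound (cubicAct (borelElt (l, t, u)) (toReal (quadEquiv (a, b, c, d))))
    rw [cubicAct_borelElt _ ht, Fin.prod_univ_four] at h
    rw [cubicAct_borelElt _ ht, ← ofReal_norm]
    refine (mul_le_mul_right (ENNReal.ofReal_le_ofReal h) _).trans_eq ?_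
    rw [ENNReal.ofReal_mul hC, ENNReal.ofReal_mul (mul_nonneg (mul_nonneg (hd _) (hd _)) (hd _)),
      ENNReal.ofReal_mul (mul_nonneg (hd _) (hd _)), ENNReal.ofReal_mul (hd _)]
    simp only [quadEquiv_apply, Matrix.cons_val]
    ring
  rw [← quadEquiv.tsum_eq]
  refine (ENNReal.tsum_le_tsum hterm).trans ?_
  rw [ENNReal.tsum_mul_left, ENNReal.tsum_prod']
  simp only [ENNReal.tsum_mul_left]
  rw [ENNReal.ofReal_mul hC, mul_left_comm]
  refine mul_le_mul_right ?_ _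
  rw [← ENNReal.tsum_mul_right]
  refine ENNReal.tsum_le_tsum fun a => mul_le_mul_right ?_ _
  rw [ENNReal.tsum_prod']
  simp only [ENNReal.tsum_mul_left]
  have hc : ∀ b : ℤ, ∑' p : ℤ × ℤ, ENNReal.ofReal (decay (l ^ 3 / t *
      (p.1 + (3 * a * u ^ 2 + 2 * b * u)))) * ENNReal.ofReal (decay (l ^ 3 / t ^ 3 *
            (p.2 + (a * u ^ 3 + b * u ^ 2 + p.1 * u)))) ≤
      ENNReal.ofReal ((2 + 2 / (l ^ 3 / t)) * (2 + 2 / (l ^ 3 / t ^ 3))) := by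
    intro b
    rw [ENNReal.tsum_prod', ENNReal.ofReal_mul (by positivity)]
    simp only [ENNReal.tsum_mul_left]
    refine (ENNReal.tsum_le_tsum fun c => mul_le_mul_right (tsum_int_decay_le h3 _) _).trans ?_
    rw [ENNReal.tsum_mul_right]
    exact mul_le_mul_left (tsum_int_decay_le h2 _) _
  refine (ENNReal.tsum_le_tsum fun b => mul_le_mul_right (hc b) _).trans ?_
  rw [ENNReal.tsum_mul_right, ENNReal.ofReal_mul (p := 2 + 2 / (l ^ 3 * t)) (by positivity)]
  exact mul_le_mul_left (tsum_int_decay_le h1 _) _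

theorem summable_testFun (ε : DiscSign) {fD : ℝ → ℂ} (hf : Continuous fD)
    (hc : HasCompactSupport fD) (q : ℕ) {y : ℝ × ℝ × ℝ} (hl : 0 < y.1) (ht : 0 < y.2.1) :
    Summable fun x : Fin 4 → ℤ => nonMaxInd q x * testFun ε fD (cubicAct (borelElt y) (toReal x)) := by
  obtain ⟨C, -, h⟩ := exists_tsum_testFun_le ε hf hc
  have h1 := h 1 y.1 y.2.1 y.2.2 hl ht
  simp only [Pi.one_apply, one_mul] at h1
  have h2 : ∑' a : ℤ, ENNReal.ofReal (decay (y.1 ^ 3 * y.2.1 ^ 3 * a)) ≠ ⊤ := by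
    have := tsum_int_decay_le (c := y.1 ^ 3 * y.2.1 ^ 3) (by positivity) 0
    simp only [add_zero] at this
    exact (this.trans_lt ENNReal.ofReal_lt_top).ne
  have h3 := (h1.trans_lt (ENNReal.mul_lt_top h2.lt_top ENNReal.ofReal_lt_top)).ne
  have h4 : Summable fun x : Fin 4 → ℤ => ‖testFun ε fD (cubicAct (borelElt y) (toReal x))‖ :=
    NNReal.summable_coe.mpr (ENNReal.tsum_coe_ne_top_iff_summable.mp h3)
  refine Summable.of_norm_bounded h4 fun x => ?_
  rw [norm_mul]
  exact mul_le_of_le_one_left (norm_nonneg _) (norm_nonMaxInd_le q x)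

/-- The sum over the forms with nonzero first coefficient. -/
def cuspSum (ε : DiscSign) (q : ℕ) (fD : ℝ → ℂ) (g : Matrix (Fin 2) (Fin 2) ℝ) : ℂ :=
  ∑' x : Fin 4 → ℤ, if x 0 ≠ 0 then nonMaxInd q x * testFun ε fD (cubicAct g (toReal x)) else 0

theorem reducibleForm_injective : Function.Injective (reducibleForm (R := ℤ)) := by
  intro x y h
  funext i
  have h1 := congrFun h i.succ
  fin_cases i <;> exact h1

/-- The sum over all forms is the sum of the reducible part and the part with `a ≠ 0`. -/
theorem tsum_eq_redSum_add_cuspSum (ε : DiscSign) {fD : ℝ → ℂ} (hf : Continuous fD)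
    (hc : HasCompactSupport fD) (q : ℕ) {y : ℝ × ℝ × ℝ} (hl : 0 < y.1) (ht : 0 < y.2.1) :
    ∑' x : Fin 4 → ℤ, nonMaxInd q x * testFun ε fD (cubicAct (borelElt y) (toReal x)) =
      redSum ε q fD (borelElt y) + cuspSum ε q fD (borelElt y) := by
  have hs := summable_testFun ε hf hc q hl ht
  set F : (Fin 4 → ℤ) → ℂ := fun x => nonMaxInd q x * testFun ε fD (cubicAct (borelElt y) (toReal x))
    with hF
  have e0 : redSum ε q fD (borelElt y) = ∑' x, {x : Fin 4 → ℤ | x 0 = 0}.indicator F x := by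
    have hr : Function.support ({x : Fin 4 → ℤ | x 0 = 0}.indicator F) ⊆
        Set.range (reducibleForm (R := ℤ)) := by
      intro x hx
      have h0 : x 0 = 0 := by
        by_contra h
        exact hx (indicator_of_notMem (by simpa using h) _)
      refine ⟨![x 1, x 2, x 3], ?_⟩
      funext i
      fin_cases i
      · simp [reducibleForm, h0]
      · rfl
      · rfl
      · rfl
    rw [← reducibleForm_injective.tsum_eq hr, redSum]
    refine tsum_congr fun x => ?_
    rw [indicator_of_mem (by simp [reducibleForm])]
  have e1 : cuspSum ε q fD (borelElt y) = ∑' x, {x : Fin 4 → ℤ | x 0 = 0}ᶜ.indicator F x := by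
    rw [cuspSum]
    refine tsum_congr fun x => ?_
    simp only [indicator, mem_compl_iff, mem_ofPred_eq, hF, ne_eq]
  rw [e0, e1, ← (hs.indicator _).tsum_add (hs.indicator _)]
  exact tsum_congr fun x => (congrFun (indicator_self_add_compl _ F) x).symm

/-- The discriminant of an integral form in the orbit of the base point is at least `1` in absolute
value, so `fD` bounds the determinant. -/
theorem chiCubic_le_of_testFun_ne_zero (ε : DiscSign) {fD : ℝ → ℂ} {M : ℝ} (hM : ∀ x, fD x ≠ 0 → x ≤ M)
    {x : Fin 4 → ℤ} {g : Matrix (Fin 2) (Fin 2) ℝ} (hg : 0 < g.det)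
    (h : testFun ε fD (cubicAct g (toReal x)) ≠ 0) : chiCubic g ≤ M := by
  by_cases hx : ∃ k : Matrix (Fin 2) (Fin 2) ℝ, 0 < k.det ∧ cubicAct k (basePoint ε) =
      cubicAct g (toReal x)
  · obtain ⟨k, hk, he⟩ := hx
    rw [← he, testFun_apply ε fD hk] at h
    have h1 := hM _ (right_ne_zero_of_mul h)
    have h2 := chiCubic_eq_mul_cubicDisc ε he
    have h3 : (0 : ℝ) < chiCubic k := by rw [chiCubic]; positivity
    have h4 : cubicDisc (toReal x) = (cubicDisc x : ℤ) := by
      simp [cubicDisc, toReal]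
    rw [cubicDisc_cubicAct, h4] at h2
    have h5 : chiCubic k = g.det ^ 6 * ((ε.toInt * cubicDisc x : ℤ) : ℝ) := by
      rw [h2]; push_cast; ring
    have hg6 : 0 < g.det ^ 6 := by positivity
    have h6 : 0 < ε.toInt * cubicDisc x := by
      rw [h5] at h3
      exact_mod_cast (pos_iff_pos_of_mul_pos h3).mp hg6
    have h7 : (1 : ℝ) ≤ ((ε.toInt * cubicDisc x : ℤ) : ℝ) := by exact_mod_cast h6
    rw [chiCubic]
    nlinarith
  · exact absurd (by rw [testFun, dif_neg hx]) h

/-- In the Siegel domain `t ≥ 1/2` the sum over the forms with `a ≠ 0` is bounded independently of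
`t`, and it vanishes for large `l` since the discriminant of an integral form is an integer. -/
theorem exists_norm_cuspSum_le (ε : DiscSign) {fD : ℝ → ℂ} (hf : Continuous fD)
    (hc : HasCompactSupport fD) : ∃ M C, 1 ≤ M ∧ 0 ≤ C ∧ ∀ (q : ℕ) (y : ℝ × ℝ × ℝ), 0 < y.1 →
      1 / 2 ≤ y.2.1 → (M < y.1 → cuspSum ε q fD (borelElt y) = 0) ∧
        ‖cuspSum ε q fD (borelElt y)‖ ≤ C * (y.1 ^ 12)⁻¹ := by
  obtain ⟨M, hM1, hM⟩ := exists_bound_of_hasCompactSupport hc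
  obtain ⟨C, hC, hbd⟩ := exists_tsum_testFun_le ε hf hc
  set N : ℝ := 16 * M ^ 3 + 2 with hN
  have hN0 : 0 < N := by positivity
  refine ⟨M, C * (N * (N * 72)), hM1, by positivity, fun q y hl ht => ?_⟩
  have ht0 : 0 < y.2.1 := by linarith
  have hzero : M < y.1 → cuspSum ε q fD (borelElt y) = 0 := by
    intro hlt
    rw [cuspSum]
    convert tsum_zero with x
    split_ifs
    · have : testFun ε fD (cubicAct (borelElt y) (toReal x)) = 0 := by
        by_contra h
        have h1 := chiCubic_le_of_testFun_ne_zero ε hM (by rw [det_borelElt ht0]; positivity) h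
        rw [chiCubic_borelElt ht0] at h1
        have h2 : y.1 ≤ y.1 ^ 12 := le_self_pow₀ (by linarith) (by norm_num)
        linarith
      rw [this, mul_zero]
    · rfl
  refine ⟨hzero, ?_⟩
  rcases lt_or_ge M y.1 with hlt | hle
  · rw [hzero hlt, norm_zero]
    positivity
  obtain ⟨l, t, u⟩ := y
  simp only at hl ht ht0 hle ⊢
  set L := l ^ 3 with hL
  have hL0 : 0 < L := by positivity
  have hLM : L ≤ M ^ 3 := pow_le_pow_left₀ hl.le hle 3
  have hnorm : ‖cuspSum ε q fD (borelElt (l, t, u))‖ₑ ≤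
      ∑' x : Fin 4 → ℤ, (if x 0 ≠ 0 then 1 else 0) *
        ‖testFun ε fD (cubicAct (borelElt (l, t, u)) (toReal x))‖ₑ := by
    rw [cuspSum]
    refine enorm_tsum_le_tsum_enorm.trans (ENNReal.tsum_le_tsum fun x => ?_)
    split_ifs
    · rw [one_mul, enorm_mul, ← ofReal_norm (nonMaxInd q x)]
      refine mul_le_of_le_one_left zero_le ?_
      exact ENNReal.ofReal_le_one.mpr (norm_nonMaxInd_le q x)
    · simp
  have h1 := hnorm.trans (hbd (fun a => if a ≠ 0 then 1 else 0) l t u hl ht0)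
  simp only [ite_mul, one_mul, zero_mul] at h1
  rw [tsum_int_ne_zero_decay, ← hL] at h1
  have hc0 : 0 < L * t ^ 3 := by positivity
  have hA1 := tsum_decay_succ_le hc0
  have hA2 := tsum_decay_succ_le' hc0
  -- for bounded `L` and `t ≥ 1/2` the constant terms of the two remaining factors can be absorbed
  have hfac : (2 : ℝ) + 2 / (L / t) ≤ N * (t / L) := by
    have e : (2 : ℝ) + 2 / (L / t) = (2 * (L / t) + 2) * (t / L) := by field_simp
    rw [e, hN]
    have h5 : 2 * (L / t) ≤ 16 * M ^ 3 := by
      rw [mul_div_assoc', div_le_iff₀ ht0]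
      nlinarith
    exact mul_le_mul_of_nonneg_right (by linarith) (by positivity)
  have hfac' : (2 : ℝ) + 2 / (L / t ^ 3) ≤ N * (t ^ 3 / L) := by
    have e : (2 : ℝ) + 2 / (L / t ^ 3) = (2 * (L / t ^ 3) + 2) * (t ^ 3 / L) := by field_simp
    have ht3 : (1 / 8 : ℝ) ≤ t ^ 3 := by
      have := pow_le_pow_left₀ (by norm_num) ht 3
      norm_num at this ⊢
      exact this
    rw [e, hN]
    have h5 : 2 * (L / t ^ 3) ≤ 16 * M ^ 3 := by
      rw [mul_div_assoc', div_le_iff₀ (by positivity)]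
      nlinarith
    exact mul_le_mul_of_nonneg_right (by linarith) (by positivity)
  have hX : ENNReal.ofReal (C * ((2 + 2 / (L * t)) * ((2 + 2 / (L / t)) * (2 + 2 / (L / t ^ 3))))) ≤
      ENNReal.ofReal (C * ((2 + 2 / (L * t)) * (N * (t / L) * (N * (t ^ 3 / L))))) :=
    ENNReal.ofReal_le_ofReal (by gcongr)
  have h2 : ‖cuspSum ε q fD (borelElt (l, t, u))‖ₑ ≤ ENNReal.ofReal (C * (N * (N * 72)) * (l ^ 12)⁻¹) := by
    refine (h1.trans (mul_le_mul_right hX _)).trans ?_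
    -- the summand `2` of `2 + 2 / (L t)` uses the quadratic bound, the other one the linear bound
    rw [show C * ((2 + 2 / (L * t)) * (N * (t / L) * (N * (t ^ 3 / L)))) =
      C * 2 * (N * (t / L) * (N * (t ^ 3 / L))) + C * (2 / (L * t)) * (N * (t / L) * (N * (t ^ 3 / L)))
      by ring, ENNReal.ofReal_add (by positivity) (by positivity), mul_add]
    have p1 := mul_le_mul' (mul_le_mul' (le_refl (2 : ENNReal)) hA2)
      (le_refl (ENNReal.ofReal (C * 2 * (N * (t / L) * (N * (t ^ 3 / L))))))
    have p2 := mul_le_mul' (mul_le_mul' (le_refl (2 : ENNReal)) hA1)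
      (le_refl (ENNReal.ofReal (C * (2 / (L * t)) * (N * (t / L) * (N * (t ^ 3 / L))))))
    refine (add_le_add p1 p2).trans ?_
    rw [show (2 : ENNReal) = ENNReal.ofReal 2 by simp, ← ENNReal.ofReal_mul (by positivity),
      ← ENNReal.ofReal_mul (by positivity), ← ENNReal.ofReal_mul (by positivity),
      ← ENNReal.ofReal_mul (by positivity), ← ENNReal.ofReal_add (by positivity) (by positivity)]
    refine ENNReal.ofReal_le_ofReal ?_
    have hl12 : l ^ 12 = L ^ 4 := by rw [hL]; ring
    have e : 2 * (2 / (L * t ^ 3) ^ 2) * (C * 2 * (N * (t / L) * (N * (t ^ 3 / L)))) +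
        2 * (1 / (L * t ^ 3)) * (C * (2 / (L * t)) * (N * (t / L) * (N * (t ^ 3 / L)))) =
        C * (N * (N * (8 * (1 / t) ^ 2 + 4))) * (L ^ 4)⁻¹ := by
      field_simp
      ring
    rw [e, hl12]
    have h3 : 1 / t ≤ 2 := by rw [div_le_iff₀ ht0]; linarith
    have h4 : (1 / t) ^ 2 ≤ 2 ^ 2 := pow_le_pow_left₀ (by positivity) h3 2
    gcongr
    linarith
  rw [← ofReal_norm] at h2
  exact (ENNReal.ofReal_le_ofReal_iff (by positivity)).mp h2

/-! ### Measurability and integrability of the lattice sums -/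

theorem measurable_borelElt_apply (i j : Fin 2) : Measurable fun y : ℝ × ℝ × ℝ => borelElt y i j := by
  simp_rw [borelElt_eq]
  fin_cases i <;> fin_cases j <;> simp <;> fun_prop

theorem aestronglyMeasurable_testFun (ε : DiscSign) {fD : ℝ → ℂ} (hf : Continuous fD)
    (x : Fin 4 → ℝ) {s : Set (ℝ × ℝ × ℝ)} (hs : MeasurableSet s) (hsub : s ⊆ halfSpace) :
    AEStronglyMeasurable (fun y => testFun ε fD (cubicAct (borelElt y) x)) (volume.restrict s) := by
  have hdet : ∀ y ∈ s, 0 < (borelElt y).det := fun y hy => by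
    have h := hsub hy
    rw [det_borelElt h.2.1]
    have : 0 < y.1 := h.1
    positivity
  by_cases hx : ∃ k : Matrix (Fin 2) (Fin 2) ℝ, 0 < k.det ∧ cubicAct k (basePoint ε) = x
  · obtain ⟨k, hk, rfl⟩ := hx
    have hm : Measurable fun y : ℝ × ℝ × ℝ =>
        (fG (borelElt y * k) : ℂ) * fD (chiCubic (borelElt y * k)) := by
      have h00 := measurable_borelElt_apply 0 0
      have h01 := measurable_borelElt_apply 0 1
      have h10 := measurable_borelElt_apply 1 0
      have h11 := measurable_borelElt_apply 1 1
      have := hf.measurable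
      simp only [fG, chiCubic, trace_transpose_mul_self, Matrix.det_fin_two, Matrix.mul_apply, Fin.sum_univ_two]
      fun_prop
    refine AEStronglyMeasurable.congr hm.aestronglyMeasurable ?_
    refine (ae_restrict_mem hs).mono fun y hy => ?_
    simp only
    rw [← cubicAct_mul, testFun_apply ε fD (by rw [Matrix.det_mul]; exact mul_pos (hdet y hy) hk)]
  · refine AEStronglyMeasurable.congr (aestronglyMeasurable_const (b := (0 : ℂ))) ?_
    refine (ae_restrict_mem hs).mono fun y hy => ?_
    simp only
    rw [testFun, dif_neg]
    rintro ⟨k, hk, he⟩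
    have hu : IsUnit (borelElt y).det := (hdet y hy).ne'.isUnit
    refine hx ⟨(borelElt y)⁻¹ * k, ?_, ?_⟩
    · rw [Matrix.det_mul, Matrix.det_nonsing_inv, Ring.inverse_eq_inv']
      have := hdet y hy
      positivity
    · rw [cubicAct_mul, he, ← cubicAct_mul, Matrix.nonsing_inv_mul _ hu, cubicAct_one]

/-- The density of the Haar measure of `B⁺`. -/
def haarDensity (y : ℝ × ℝ × ℝ) : ℝ := 1 / (y.1 * y.2.1 ^ 3)

theorem haarDensity_pos {y : ℝ × ℝ × ℝ} (hl : 0 < y.1) (ht : 0 < y.2.1) : 0 < haarDensity y := by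
  unfold haarDensity
  positivity

theorem measurable_haarDensity : Measurable haarDensity := by
  unfold haarDensity
  fun_prop

theorem norm_testFun (ε : DiscSign) (fD : ℝ → ℂ) (x : Fin 4 → ℝ) :
    testFun ε (fun y => (‖fD y‖ : ℂ)) x = (‖testFun ε fD x‖ : ℂ) := by
  rw [testFun, testFun]
  split_ifs
  · rw [norm_mul, Complex.norm_real, Real.norm_of_nonneg (show 0 ≤ fG _ from (Real.exp_pos _).le),
      Complex.ofReal_mul]
  · simp

section LatticeSums

variable {fD : ℝ → ℂ} (hf : Continuous fD) (hc : HasCompactSupport fD)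
include hf hc

theorem aestronglyMeasurable_redSum (ε : DiscSign) (q : ℕ) {s : Set (ℝ × ℝ × ℝ)}
    (hs : MeasurableSet s) (hsub : s ⊆ halfSpace) :
    AEStronglyMeasurable (fun y => redSum ε q fD (borelElt y)) (volume.restrict s) := by
  refine aestronglyMeasurable_tsum
    (fun x => (aestronglyMeasurable_testFun ε hf _ hs hsub).const_mul _) ?_
  refine (ae_restrict_mem hs).mono fun y hy => ?_
  exact (summable_testFun ε hf hc q (hsub hy).1 (hsub hy).2.1).comp_injective
    reducibleForm_injective

theorem aestronglyMeasurable_cuspSum (ε : DiscSign) (q : ℕ) {s : Set (ℝ × ℝ × ℝ)}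
    (hs : MeasurableSet s) (hsub : s ⊆ halfSpace) :
    AEStronglyMeasurable (fun y => cuspSum ε q fD (borelElt y)) (volume.restrict s) := by
  refine aestronglyMeasurable_tsum (fun x => ?_) ?_
  · by_cases h : x 0 ≠ 0
    · simp only [if_pos h]
      exact (aestronglyMeasurable_testFun ε hf _ hs hsub).const_mul _
    · simp only [if_neg h]
      exact aestronglyMeasurable_const
  refine (ae_restrict_mem hs).mono fun y hy => ?_
  refine Summable.of_norm_bounded (summable_testFun ε hf hc q (hsub hy).1 (hsub hy).2.1).norm
    fun x => ?_
  split_ifs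
  · exact le_rfl
  · rw [norm_zero]
    exact norm_nonneg _

theorem norm_redSum_le (ε : DiscSign) (q : ℕ) {y : ℝ × ℝ × ℝ} (hl : 0 < y.1) (ht : 0 < y.2.1) :
    ‖redSum ε q fD (borelElt y)‖ ≤ ‖redSum ε 1 (fun y => (‖fD y‖ : ℂ)) (borelElt y)‖ := by
  have hs : Summable fun x : Fin 3 → ℤ =>
      ‖testFun ε fD (cubicAct (borelElt y) (toReal (reducibleForm x)))‖ := by
    have h := (summable_testFun ε hf hc 1 hl ht).comp_injective reducibleForm_injective
    simpa [nonMaxInd, Function.comp_def] using h.norm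
  have e : redSum ε 1 (fun y => (‖fD y‖ : ℂ)) (borelElt y) =
      ((∑' x : Fin 3 → ℤ, ‖testFun ε fD (cubicAct (borelElt y) (toReal (reducibleForm x)))‖ : ℝ) : ℂ) := by
    rw [redSum, Complex.ofReal_tsum]
    refine tsum_congr fun x => ?_
    rw [norm_testFun]
    simp [nonMaxInd]
  rw [e, Complex.norm_real, Real.norm_of_nonneg (tsum_nonneg fun _ => norm_nonneg _)]
  refine tsum_of_norm_bounded hs.hasSum fun x => ?_
  rw [norm_mul]
  exact mul_le_of_le_one_left (norm_nonneg _) (norm_nonMaxInd_le q _)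

/-- The integrals of the reducible sum against real powers are those of `redTerm` for `‖fD‖` and
`q = 1`. -/
theorem integrableOn_norm_redSum (hsupp : tsupport fD ⊆ Ioi 0) (ε : DiscSign) (q : ℕ) {σ β : ℝ}
    (h1 : 2 < 2 * σ + β / 2) (h2 : 1 < σ - β / 4) (v₀ : ℝ) :
    IntegrableOn (fun y : ℝ × ℝ × ℝ => y.1 ^ (12 * σ) * y.2.1 ^ β * haarDensity y *
      ‖redSum ε q fD (borelElt y)‖) (window v₀) := by
  have hts := tsupport_norm_subset fD
  have h := integrableOn_tsum_redTerm (Complex.continuous_ofReal.comp hf.norm)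
    (hc.of_isClosed_subset (isClosed_tsupport _) hts) (hts.trans hsupp) (p := 12) (by norm_num) ε
    one_ne_zero 0 ((12 * σ : ℝ) : ℂ) (β : ℂ) v₀ (by
      have e : 2 * (((12 * σ : ℝ) : ℂ) / (12 : ℕ)) +
          ((β : ℂ) - (0 : ℕ) * ((12 * σ : ℝ) : ℂ) / (12 : ℕ)) / 2 = ((2 * σ + β / 2 : ℝ) : ℂ) := by
        push_cast; ring
      rw [e, Complex.ofReal_re]; exact h1) (by
      have e : ((12 * σ : ℝ) : ℂ) / (12 : ℕ) -
          ((β : ℂ) - (0 : ℕ) * ((12 * σ : ℝ) : ℂ) / (12 : ℕ)) / 4 = ((σ - β / 4 : ℝ) : ℂ) := by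
        push_cast; ring
      rw [e, Complex.ofReal_re]; exact h2)
  refine Integrable.mono h.norm ?_ ?_
  · refine AEStronglyMeasurable.mul (Measurable.aestronglyMeasurable ?_)
      (aestronglyMeasurable_redSum hf hc ε q (measurableSet_window v₀) (window_subset v₀)).norm
    have := measurable_haarDensity
    fun_prop
  · refine (ae_restrict_mem (measurableSet_window v₀)).mono fun y hy => ?_
    have hl : 0 < y.1 := hy.1
    have ht : 0 < y.2.1 := hy.2.1
    have hd := haarDensity_pos hl ht
    rw [tsum_redTerm_cubic _ _ _ _ _ hl ht, norm_norm, norm_mul (_ * _) (redSum _ _ _ _), norm_mul,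
      norm_norm]
    refine mul_le_mul (le_of_eq ?_) (norm_redSum_le hf hc ε q hl ht) (norm_nonneg _) (norm_nonneg _)
    rw [norm_mul (_ * _) (((1 / (y.1 * y.2.1 ^ 3) : ℝ) : ℂ)), norm_mul ((y.1 : ℂ) ^ _),
      Complex.norm_cpow_eq_rpow_re_of_pos hl, Complex.norm_cpow_eq_rpow_re_of_pos ht,
      Complex.norm_real, Complex.ofReal_re, Complex.ofReal_re,
      Real.norm_of_nonneg (by positivity)]
    change _ = _ * ‖haarDensity y‖
    rw [Real.norm_of_nonneg hd.le]

/-- By `exists_norm_cuspSum_le` the integrand is dominated by `l^(12 σ - 13) t⁻²` on `l ≤ M`,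
`t ≥ 1/2`. -/
theorem integrableOn_norm_cuspSum (ε : DiscSign) (q : ℕ) {σ : ℝ} (hσ : 1 < σ) :
    IntegrableOn (fun y : ℝ × ℝ × ℝ => y.1 ^ (12 * σ) * y.2.1 * haarDensity y *
      ‖cuspSum ε q fD (borelElt y)‖) fundDomain := by
  obtain ⟨M, C, hM, hC, h⟩ := exists_norm_cuspSum_le ε hf hc
  set S : Set (ℝ × ℝ × ℝ) := Ioc 0 M ×ˢ Ici (1 / 2) ×ˢ Ico (-(1 / 2)) (1 / 2) with hS
  have hSm : MeasurableSet S := measurableSet_Ioc.prod (measurableSet_Ici.prod measurableSet_Ico)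
  have hint : IntegrableOn (fun y : ℝ × ℝ × ℝ => C * (y.1 ^ (12 * σ - 13) * (y.2.1 ^ (-2 : ℝ) * 1)))
      S := by
    rw [IntegrableOn, hS, volume_restrict_prod3]
    refine Integrable.const_mul (Integrable.mul_prod (f := fun l : ℝ => l ^ (12 * σ - 13))
      (g := fun x : ℝ × ℝ => x.1 ^ (-2 : ℝ) * 1) ?_ (Integrable.mul_prod
        (f := fun t : ℝ => t ^ (-2 : ℝ)) (g := fun _ : ℝ => (1 : ℝ)) ?_ ?_)) C
    · have := intervalIntegral.intervalIntegrable_rpow' (a := 0) (b := M) (r := 12 * σ - 13)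
        (by linarith)
      rwa [intervalIntegrable_iff_integrableOn_Ioc_of_le (by linarith)] at this
    · change IntegrableOn _ _ _
      rw [integrableOn_Ici_iff_integrableOn_Ioi]
      exact integrableOn_Ioi_rpow_of_lt (by norm_num) (by norm_num)
    · exact integrable_const _
  have hind : Integrable (S.indicator fun y : ℝ × ℝ × ℝ =>
      C * (y.1 ^ (12 * σ - 13) * (y.2.1 ^ (-2 : ℝ) * 1))) := (integrable_indicator_iff hSm).mpr hint
  refine Integrable.mono (hind.integrableOn (s := fundDomain)) ?_ ?_
  · refine AEStronglyMeasurable.mul (Measurable.aestronglyMeasurable ?_)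
      (aestronglyMeasurable_cuspSum hf hc ε q measurableSet_fundDomain
        (fundDomain_subset.trans (window_subset _))).norm
    have := measurable_haarDensity
    fun_prop
  · refine (ae_restrict_mem measurableSet_fundDomain).mono fun y hy => ?_
    have hl : 0 < y.1 := hy.1
    have ht := half_le_of_mem_fundDomain hy
    have ht0 : 0 < y.2.1 := hy.2.1
    obtain ⟨hz, hb⟩ := h q y hl ht
    rcases lt_or_ge M y.1 with hlt | hle
    · rw [hz hlt, norm_zero, mul_zero, norm_zero]
      exact norm_nonneg _
    have hd := haarDensity_pos hl ht0
    rw [indicator_of_mem (show y ∈ S from ⟨⟨hl, hle⟩, ht, hy.2.2.1, hy.2.2.2.1⟩),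
      Real.norm_of_nonneg (by positivity), Real.norm_of_nonneg (by positivity)]
    refine (mul_le_mul_of_nonneg_left hb (by positivity)).trans (le_of_eq ?_)
    rw [haarDensity, Real.rpow_sub hl, Real.rpow_neg ht0.le]
    norm_cast
    field_simp

end LatticeSums

/-! ### The fundamental domain of the full group -/

theorem fullElt_eq (p : ℝ × ℝ × ℝ × ℝ) :
    fullElt p = kMat p.2.1 * borelElt (p.1, p.2.2.1, p.2.2.2) := by
  have h : dMat p.1 * kMat p.2.1 = kMat p.2.1 * dMat p.1 := by
    ext i j
    fin_cases i <;> fin_cases j <;> simp [dMat, kMat, mul_comm]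
  rw [fullElt, borelElt, h]
  simp only [Matrix.mul_assoc]

theorem kMat_orthogonal (θ : ℝ) : (kMat θ).transpose * kMat θ = 1 := by
  have h := Real.sin_sq_add_cos_sq (2 * Real.pi * θ)
  ext i j
  fin_cases i <;> fin_cases j <;> simp [kMat, Matrix.mul_apply, Fin.sum_univ_two] <;> linarith

theorem det_kMat (θ : ℝ) : (kMat θ).det = 1 := by
  have h := Real.sin_sq_add_cos_sq (2 * Real.pi * θ)
  rw [kMat, Matrix.det_fin_two_of]
  linarith

theorem fG_kMat_mul (θ : ℝ) (g : Matrix (Fin 2) (Fin 2) ℝ) : fG (kMat θ * g) = fG g := by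
  rw [fG, fG, Matrix.det_mul, det_kMat, one_mul, Matrix.transpose_mul, Matrix.mul_assoc,
    ← Matrix.mul_assoc (kMat θ).transpose, kMat_orthogonal, one_mul]

theorem testFun_cubicAct_kMat (ε : DiscSign) (fD : ℝ → ℂ) (θ : ℝ) (x : Fin 4 → ℝ) :
    testFun ε fD (cubicAct (kMat θ) x) = testFun ε fD x := by
  by_cases hx : ∃ k : Matrix (Fin 2) (Fin 2) ℝ, 0 < k.det ∧ cubicAct k (basePoint ε) = x
  · obtain ⟨k, hk, rfl⟩ := hx
    rw [← cubicAct_mul, testFun_apply ε fD hk, testFun_apply ε fD (by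
      rw [Matrix.det_mul, det_kMat, one_mul]; exact hk), fG_kMat_mul, chiCubic, chiCubic,
      Matrix.det_mul, det_kMat, one_mul]
  · rw [testFun, testFun, dif_neg hx, dif_neg]
    rintro ⟨k, hk, he⟩
    refine hx ⟨(kMat θ).transpose * k, ?_, ?_⟩
    · rw [Matrix.det_mul, Matrix.det_transpose, det_kMat, one_mul]
      exact hk
    · rw [cubicAct_mul, he, ← cubicAct_mul, kMat_orthogonal, cubicAct_one]

/-- The integrand of the zeta function of all forms in the coordinates `(l, t, u)`. -/
def fullCore (ε : DiscSign) (q : ℕ) (fD : ℝ → ℂ) (z s : ℂ) (y : ℝ × ℝ × ℝ) : ℂ :=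
  (y.1 : ℂ) ^ (12 * s) * (haarDensity y : ℂ) * ((constTerm z y.2.1 + cuspTerm z y.2) *
    (redSum ε q fD (borelElt y) + cuspSum ε q fD (borelElt y)))

theorem fullIntegrand_fullKernel (ε : DiscSign) {fD : ℝ → ℂ} (hf : Continuous fD)
    (hc : HasCompactSupport fD) (q : ℕ) (z s : ℂ) {p : ℝ × ℝ × ℝ × ℝ} (hp : p ∈ fullDomain) :
    fullIntegrand (fullKernel ε q fD z s) p = fullCore ε q fD z s (p.1, p.2.2) := by
  obtain ⟨l, θ, t, u⟩ := p
  obtain ⟨hl, -, -, ht, -⟩ := hp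
  simp only at hl ht
  have hT : iwasawaT (fullElt (l, θ, t, u)) = t := (iwasawa_coordinates hl ht θ u).1
  have hU : iwasawaU (fullElt (l, θ, t, u)) = u := (iwasawa_coordinates hl ht θ u).2
  have hχ : chiCubic (fullElt (l, θ, t, u)) = l ^ 12 := by
    rw [fullElt_eq, chiCubic, Matrix.det_mul, det_kMat, one_mul]
    exact chiCubic_borelElt (y := (l, t, u)) ht
  have hsum : ∑' x : Fin 4 → ℤ, nonMaxInd q x * testFun ε fD
      (cubicAct (fullElt (l, θ, t, u)) (toReal x)) = redSum ε q fD (borelElt (l, t, u)) +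
        cuspSum ε q fD (borelElt (l, t, u)) := by
    rw [← tsum_eq_redSum_add_cuspSum ε hf hc q hl ht]
    refine tsum_congr fun x => ?_
    rw [fullElt_eq, cubicAct_mul, testFun_cubicAct_kMat]
  rw [fullIntegrand, fullKernel, hsum, eisenstein_eq, hT, hU, hχ, pow_cpow_eq hl, fullCore,
    haarDensity]
  push_cast
  ring

/-- The interchange of the coordinates `l` and `θ`. -/
def swapEquiv : ℝ × ℝ × ℝ × ℝ ≃ᵐ ℝ × ℝ × ℝ × ℝ :=
  MeasurableEquiv.prodAssoc.symm.trans
    ((MeasurableEquiv.prodComm.prodCongr (MeasurableEquiv.refl (ℝ × ℝ))).trans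
      MeasurableEquiv.prodAssoc)

theorem swapEquiv_apply (p : ℝ × ℝ × ℝ × ℝ) : swapEquiv p = (p.2.1, p.1, p.2.2) := rfl

theorem measurePreserving_swapEquiv : MeasurePreserving swapEquiv volume volume := by
  have h1 : MeasurePreserving (MeasurableEquiv.prodAssoc (α := ℝ) (β := ℝ) (γ := ℝ × ℝ))
    volume volume := measurePreserving_prodAssoc _ _ _
  have h2 : MeasurePreserving (MeasurableEquiv.prodComm.prodCongr (MeasurableEquiv.refl (ℝ × ℝ)) :
      (ℝ × ℝ) × ℝ × ℝ ≃ᵐ (ℝ × ℝ) × ℝ × ℝ) volume volume :=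
    (Measure.measurePreserving_swap (μ := (volume : Measure ℝ)) (ν := (volume : Measure ℝ))).prod
      (MeasurePreserving.id _)
  exact h1.comp (h2.comp (h1.symm _))

theorem fullDomain_eq : fullDomain = swapEquiv ⁻¹' (Ico 0 (1 / 2) ×ˢ fundDomain) := by
  ext ⟨l, θ, t, u⟩
  simp only [fullDomain, fundDomain, mem_preimage, swapEquiv_apply, mem_prod, mem_Ico, mem_ofPred_eq]
  tauto

theorem integrableOn_fullDomain {G : ℝ × ℝ × ℝ → ℂ} (hG : IntegrableOn G fundDomain) :
    IntegrableOn (fun p : ℝ × ℝ × ℝ × ℝ => G (p.1, p.2.2)) fullDomain := by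
  have h : IntegrableOn (fun p : ℝ × ℝ × ℝ × ℝ => G p.2) (Ico 0 (1 / 2) ×ˢ fundDomain) := by
    rw [IntegrableOn, Measure.volume_eq_prod, ← Measure.prod_restrict]
    exact hG.comp_snd _
  rw [fullDomain_eq]
  exact (measurePreserving_swapEquiv.integrableOn_comp_preimage
    swapEquiv.measurableEmbedding).mpr h

/-- The angle `θ` contributes the factor `1/2`. -/
theorem integral_fullDomain (G : ℝ × ℝ × ℝ → ℂ) :
    ∫ p in fullDomain, G (p.1, p.2.2) = 1 / 2 * ∫ y in fundDomain, G y := by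
  have h := measurePreserving_swapEquiv.setIntegral_preimage_emb swapEquiv.measurableEmbedding
    (fun p : ℝ × ℝ × ℝ × ℝ => G p.2) (Ico 0 (1 / 2) ×ˢ fundDomain)
  rw [← fullDomain_eq] at h
  refine Eq.trans h ?_
  rw [Measure.volume_eq_prod, ← Measure.prod_restrict, integral_fun_snd]
  simp

/-! ### The holomorphic difference -/

/-- An integral `∫ x^{12 s} Ψ`, absolutely convergent for `Re s > 1`, is holomorphic there. -/
theorem differentiableOn_integral_cpow {α : Type*} [MeasurableSpace α] {μ : Measure α} {X : α → ℝ}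
    {Ψ : α → ℂ} (hX : Measurable X) (hΨ : AEStronglyMeasurable Ψ μ) (hpos : ∀ᵐ a ∂μ, 0 < X a) {c : ℝ}
    (hint : ∀ σ : ℝ, c < σ → Integrable (fun a => X a ^ (12 * σ) * ‖Ψ a‖) μ) :
    DifferentiableOn ℂ (fun s : ℂ => ∫ a, (X a : ℂ) ^ (12 * s) * Ψ a ∂μ) {s : ℂ | c < s.re} := by
  intro s hs
  have hs' : c < s.re := hs
  obtain ⟨δ, hδ, hδs⟩ : ∃ δ : ℝ, 0 < δ ∧ c < s.re - 2 * δ :=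
    ⟨(s.re - c) / 4, by linarith, by linarith⟩
  have hmeas : ∀ w : ℂ, AEStronglyMeasurable (fun a => (X a : ℂ) ^ (12 * w) * Ψ a) μ := fun w =>
    (Measurable.aestronglyMeasurable (by fun_prop)).mul hΨ
  have hI : Integrable (fun a => (X a : ℂ) ^ (12 * s) * Ψ a) μ := by
    refine Integrable.mono' (hint s.re hs') (hmeas s) ?_
    filter_upwards [hpos] with a ha
    rw [norm_mul, Complex.norm_cpow_eq_rpow_re_of_pos ha]
    simp
  have h := hasDerivAt_integral_of_dominated_loc_of_deriv_le (𝕜 := ℂ) (μ := μ)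
    (F := fun w a => (X a : ℂ) ^ (12 * w) * Ψ a)
    (F' := fun w a => (X a : ℂ) ^ (12 * w) * (12 * (Real.log (X a) : ℂ)) * Ψ a)
    (bound := fun a => 1 / δ * (X a ^ (12 * (s.re + 2 * δ)) * ‖Ψ a‖ +
      X a ^ (12 * (s.re - 2 * δ)) * ‖Ψ a‖))
    (s := Metric.ball s δ) (x₀ := s) (Metric.ball_mem_nhds s hδ) (Eventually.of_forall hmeas) hI
    ((Measurable.aestronglyMeasurable (by fun_prop)).mul hΨ) ?_
    (((hint _ (by linarith)).add (hint _ hδs)).const_mul _) ?_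
  · exact h.2.differentiableAt.differentiableWithinAt
  · filter_upwards [hpos] with a ha w hw
    have hre : |w.re - s.re| ≤ δ := by
      have h1 := Complex.abs_re_le_norm (w - s)
      rw [Complex.sub_re] at h1
      rw [Metric.mem_ball, dist_eq_norm] at hw
      linarith
    rw [norm_mul, norm_mul, Complex.norm_cpow_eq_rpow_re_of_pos ha, ← add_mul, ← mul_assoc]
    refine mul_le_mul_of_nonneg_right ?_ (norm_nonneg _)
    have hlog : ‖(12 * (Real.log (X a) : ℂ))‖ = 12 * |Real.log (X a)| := by
      rw [norm_mul, Complex.norm_real]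
      norm_num
    have hwre : (12 * w).re = 12 * w.re := by simp
    rw [hlog, hwre, Real.rpow_def_of_pos ha, Real.rpow_def_of_pos ha, Real.rpow_def_of_pos ha]
    generalize Real.log (X a) = L
    have h1 : 12 * |L| ≤ 1 / δ * Real.exp (12 * δ * |L|) := by
      rw [one_div, inv_mul_eq_div, le_div_iff₀ hδ]
      have := Real.add_one_le_exp (12 * δ * |L|)
      linarith
    have h2 : L * (12 * w.re) ≤ L * (12 * s.re) + 12 * δ * |L| := by
      have h3 : L * (w.re - s.re) ≤ |L| * δ := by
        refine (le_abs_self _).trans ?_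
        rw [abs_mul]
        gcongr
      linarith
    calc Real.exp (L * (12 * w.re)) * (12 * |L|)
        ≤ Real.exp (L * (12 * s.re) + 12 * δ * |L|) * (1 / δ * Real.exp (12 * δ * |L|)) := by
          gcongr
      _ = 1 / δ * Real.exp (L * (12 * s.re) + 24 * δ * |L|) := by
          rw [mul_left_comm, ← Real.exp_add]
          ring_nf
      _ ≤ _ := by
          gcongr
          rcases le_total 0 L with h0 | h0
          · rw [abs_of_nonneg h0]
            refine le_add_of_le_of_nonneg (Real.exp_le_exp.mpr ?_) (Real.exp_pos _).le
            linarith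
          · rw [abs_of_nonpos h0]
            refine le_add_of_nonneg_of_le (Real.exp_pos _).le (Real.exp_le_exp.mpr ?_)
            linarith
  · filter_upwards [hpos] with a ha w _
    have hX0 : (X a : ℂ) ≠ 0 := mod_cast ha.ne'
    have h1 : HasDerivAt (fun w : ℂ => 12 * w) 12 w := by
      simpa using (hasDerivAt_id w).const_mul (12 : ℂ)
    have h2 := (h1.const_cpow (c := (X a : ℂ)) (Or.inl hX0)).mul_const (Ψ a)
    rw [← Complex.ofReal_log ha.le] at h2
    exact h2.congr_deriv (by ring)

/-- The integrand of the difference of the two zeta functions, without the factor `l^{12 s}`. On the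
fundamental domain the product of the constant term and the reducible sum cancels; outside it this
product remains, in the region `t ≤ 1`. -/
def remainder (ε : DiscSign) (q : ℕ) (fD : ℝ → ℂ) (z : ℂ) (y : ℝ × ℝ × ℝ) : ℂ :=
  1 / 2 * (haarDensity y : ℂ) *
    (fundDomain.indicator (fun y => (constTerm z y.2.1 + cuspTerm z y.2) *
        cuspSum ε q fD (borelElt y) + cuspTerm z y.2 * redSum ε q fD (borelElt y)) y -
      fundDomainᶜ.indicator (fun y => constTerm z y.2.1 * redSum ε q fD (borelElt y)) y)

/-- The difference of the zeta function of all forms and the reducible zeta function. -/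
def zetaDiff (ε : DiscSign) (q : ℕ) (fD : ℝ → ℂ) (z s : ℂ) : ℂ :=
  ∫ y in window (-(1 / 2)), (y.1 : ℂ) ^ (12 * s) * remainder ε q fD z y

/-- The Eisenstein series grows at most linearly in `t` on the fundamental domain, and all of this
growth is in the constant term. -/
theorem exists_norm_eisenstein_le {z : ℂ} (hz : z.re = 0) : ∃ C, 0 ≤ C ∧
    (∀ t : ℝ, 0 < t → ‖constTerm z t‖ ≤ C * t) ∧
    (∀ y ∈ fundDomain, ‖cuspTerm z y.2‖ ≤ C) ∧
    (∀ y ∈ fundDomain, ‖constTerm z y.2.1 + cuspTerm z y.2‖ ≤ C * y.2.1) := by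
  obtain ⟨C₁, hC₁, h₁⟩ := exists_norm_constTerm_le hz
  obtain ⟨C₂, hC₂, h₂⟩ := exists_norm_cuspTerm_le hz
  refine ⟨C₁ + 2 * C₂, by positivity, fun t ht => (h₁ t ht).trans ?_, fun y hy => ?_, fun y hy => ?_⟩
  · gcongr
    linarith
  · exact (h₂ _ (half_le_of_mem_fundDomain hy)).trans (by linarith)
  · have ht := half_le_of_mem_fundDomain hy
    refine (norm_add_le _ _).trans ?_
    have a1 := h₁ _ hy.2.1
    have a2 := h₂ _ ht
    nlinarith

section Difference

variable {fD : ℝ → ℂ} (hf : Continuous fD) (hc : HasCompactSupport fD) (hsupp : tsupport fD ⊆ Ioi 0)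
include hf hc

theorem aestronglyMeasurable_remainder (ε : DiscSign) (q : ℕ) {z : ℂ} (hz : z.re = 0) :
    AEStronglyMeasurable (remainder ε q fD z) (volume.restrict (window (-(1 / 2)))) := by
  have hfm := measurableSet_fundDomain
  have hwm := measurableSet_window (-(1 / 2))
  have hcT : Measurable fun y : ℝ × ℝ × ℝ => constTerm z y.2.1 :=
    (measurable_constTerm z).comp (by fun_prop)
  have hsub := fundDomain_subset.trans (window_subset _)
  have h1 : AEStronglyMeasurable (fun y : ℝ × ℝ × ℝ => (constTerm z y.2.1 + cuspTerm z y.2) *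
      cuspSum ε q fD (borelElt y) + cuspTerm z y.2 * redSum ε q fD (borelElt y))
      (volume.restrict fundDomain) :=
    ((hcT.aestronglyMeasurable.add (aestronglyMeasurable_cuspTerm hz)).mul
      (aestronglyMeasurable_cuspSum hf hc ε q hfm hsub)).add
      ((aestronglyMeasurable_cuspTerm hz).mul (aestronglyMeasurable_redSum hf hc ε q hfm hsub))
  have h2 : AEStronglyMeasurable (fun y : ℝ × ℝ × ℝ =>
      constTerm z y.2.1 * redSum ε q fD (borelElt y)) (volume.restrict (window (-(1 / 2)))) :=
    hcT.aestronglyMeasurable.mul (aestronglyMeasurable_redSum hf hc ε q hwm (window_subset _))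
  have h3 : AEStronglyMeasurable (fun y : ℝ × ℝ × ℝ => (1 / 2 * (haarDensity y : ℂ) : ℂ))
      (volume.restrict (window (-(1 / 2)))) := by
    have := measurable_haarDensity
    exact Measurable.aestronglyMeasurable (by fun_prop)
  refine h3.mul (AEStronglyMeasurable.sub ?_ (h2.indicator hfm.compl))
  exact ((aestronglyMeasurable_indicator_iff hfm).mpr h1).restrict

include hsupp

/-- Absolute convergence for `Re s > 1`: the reducible sum is multiplied by a bounded function both
inside the fundamental domain, where `cuspTerm` is bounded, and outside, where `t ≤ 1`. With a
bounded factor in place of the constant term, the abscissa of convergence is `1` instead of `5/4`.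
-/
theorem integrableOn_remainder (ε : DiscSign) (q : ℕ) {z : ℂ} (hz : z.re = 0) {σ : ℝ} (hσ : 1 < σ) :
    IntegrableOn (fun y : ℝ × ℝ × ℝ => y.1 ^ (12 * σ) * ‖remainder ε q fD z y‖)
      (window (-(1 / 2))) := by
  obtain ⟨C, hC, hc1, hc2, hc3⟩ := exists_norm_eisenstein_le hz
  have i1 := (integrable_indicator_iff measurableSet_fundDomain).mpr
    (integrableOn_norm_cuspSum hf hc ε q hσ)
  -- exponent zero of `t`: the factors of the reducible sum are bounded
  have i2 := integrableOn_norm_redSum hf hc hsupp ε q (σ := σ) (β := 0) (by linarith) (by linarith)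
    (-(1 / 2))
  refine Integrable.mono' ((i1.integrableOn (s := window (-(1 / 2)))).add i2 |>.const_mul C) ?_ ?_
  · exact (Measurable.aestronglyMeasurable (by fun_prop)).mul
      (aestronglyMeasurable_remainder hf hc ε q hz).norm
  · refine (ae_restrict_mem (measurableSet_window _)).mono fun y hy => ?_
    have hl : 0 < y.1 := hy.1
    have ht : 0 < y.2.1 := hy.2.1
    have hd := haarDensity_pos hl ht
    have hl' := Real.rpow_pos_of_pos hl (12 * σ)
    rw [Real.norm_of_nonneg (by positivity), remainder, norm_mul, norm_mul, Complex.norm_real,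
      Real.norm_of_nonneg hd.le, show ‖(1 / 2 : ℂ)‖ = 1 / 2 by norm_num, Pi.add_apply,
      Real.rpow_zero, mul_one]
    by_cases hy' : y ∈ fundDomain
    · have h0 : y ∉ fundDomainᶜ := fun h => h hy'
      rw [indicator_of_mem hy', indicator_of_notMem h0, sub_zero, indicator_of_mem hy']
      have hb : ‖(constTerm z y.2.1 + cuspTerm z y.2) * cuspSum ε q fD (borelElt y) +
          cuspTerm z y.2 * redSum ε q fD (borelElt y)‖ ≤
          C * y.2.1 * ‖cuspSum ε q fD (borelElt y)‖ + C * ‖redSum ε q fD (borelElt y)‖ := by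
        refine (norm_add_le _ _).trans ?_
        rw [norm_mul, norm_mul]
        gcongr
        · exact hc3 y hy'
        · exact hc2 y hy'
      calc _ ≤ y.1 ^ (12 * σ) * (1 * haarDensity y * (C * y.2.1 * ‖cuspSum ε q fD (borelElt y)‖ +
            C * ‖redSum ε q fD (borelElt y)‖)) := by
            gcongr
            norm_num
        _ = _ := by ring
    · rw [indicator_of_notMem hy', indicator_of_mem (mem_compl hy'), zero_sub, norm_neg, norm_mul,
        indicator_of_notMem hy', zero_add]
      have ht1 := le_one_of_notMem_fundDomain hy hy'
      have hb : ‖constTerm z y.2.1‖ ≤ C := (hc1 _ ht).trans (mul_le_of_le_one_right hC ht1)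
      calc _ ≤ y.1 ^ (12 * σ) * (1 * haarDensity y * (C * ‖redSum ε q fD (borelElt y)‖)) := by
            gcongr
            norm_num
        _ = _ := by ring

theorem differentiableOn_zetaDiff (ε : DiscSign) (q : ℕ) {z : ℂ} (hz : z.re = 0) :
    DifferentiableOn ℂ (zetaDiff ε q fD z) {s | 1 < s.re} :=
  differentiableOn_integral_cpow measurable_fst (aestronglyMeasurable_remainder hf hc ε q hz)
    ((ae_restrict_mem (measurableSet_window _)).mono fun _ hy => hy.1)
    fun _ hσ => integrableOn_remainder hf hc hsupp ε q hz hσ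

theorem integrableOn_fullCore (ε : DiscSign) (q : ℕ) {z s : ℂ} (hz : z.re = 0) (hs : 5 / 4 < s.re) :
    IntegrableOn (fullCore ε q fD z s) fundDomain := by
  obtain ⟨C, hC, -, -, hc3⟩ := exists_norm_eisenstein_le hz
  have i1 := integrableOn_norm_cuspSum hf hc ε q (σ := s.re) (by linarith)
  -- exponent one of `t`: the growth of the constant term
  have i2 := (integrableOn_norm_redSum hf hc hsupp ε q (σ := s.re) (β := 1) (by linarith)
    (by linarith) (-(1 / 2))).mono_set fundDomain_subset
  have hfm := measurableSet_fundDomain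
  have hsub := fundDomain_subset.trans (window_subset _)
  refine Integrable.mono' ((i1.add i2).const_mul C) ?_ ?_
  · have h1 : Measurable fun y : ℝ × ℝ × ℝ => (y.1 : ℂ) ^ (12 * s) * (haarDensity y : ℂ) := by
      have := measurable_haarDensity
      fun_prop
    have hcT : Measurable fun y : ℝ × ℝ × ℝ => constTerm z y.2.1 :=
      (measurable_constTerm z).comp (by fun_prop)
    exact h1.aestronglyMeasurable.mul ((hcT.aestronglyMeasurable.add
      (aestronglyMeasurable_cuspTerm hz)).mul ((aestronglyMeasurable_redSum hf hc ε q hfm hsub).add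
        (aestronglyMeasurable_cuspSum hf hc ε q hfm hsub)))
  · refine (ae_restrict_mem hfm).mono fun y hy => ?_
    have hl : 0 < y.1 := hy.1
    have ht : 0 < y.2.1 := hy.2.1
    have hd := haarDensity_pos hl ht
    have hl' := Real.rpow_pos_of_pos hl (12 * s.re)
    have hre : (12 * s).re = 12 * s.re := by simp
    rw [fullCore, norm_mul, norm_mul, norm_mul, Complex.norm_real, Real.norm_of_nonneg hd.le,
      Complex.norm_cpow_eq_rpow_re_of_pos hl, hre, Pi.add_apply, Real.rpow_one]
    calc _ ≤ y.1 ^ (12 * s.re) * haarDensity y * (C * y.2.1 *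
          (‖redSum ε q fD (borelElt y)‖ + ‖cuspSum ε q fD (borelElt y)‖)) := by
          gcongr
          · exact hc3 y hy
          · exact norm_add_le _ _
      _ = _ := by ring

theorem fullIntegrable_fullKernel (ε : DiscSign) (q : ℕ) {z s : ℂ} (hz : z.re = 0)
    (hs : 5 / 4 < s.re) : FullIntegrable (fullKernel ε q fD z s) := by
  have hm : MeasurableSet fullDomain := by
    rw [fullDomain_eq]
    exact swapEquiv.measurable (measurableSet_Ico.prod measurableSet_fundDomain)
  refine (integrableOn_fullDomain (integrableOn_fullCore hf hc hsupp ε q hz hs)).congr_fun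
    (fun p hp => ?_) hm
  exact (fullIntegrand_fullKernel ε hf hc q z s hp).symm

/-- In the region of absolute convergence, the zeta function of all forms is the sum of the integral
of the reducible kernel over the strip `|u| ≤ 1/2` and of the difference. -/
theorem fullZeta_eq (ε : DiscSign) {q : ℕ} (hq : q ≠ 0) {z s : ℂ} (hz : z.re = 0)
    (hs : 5 / 4 < s.re) : fullZeta ε q fD z s =
      1 / 2 * (∫ y in window (-(1 / 2)), borelIntegrand (redConstKernel ε q fD z s) y) +
        zetaDiff ε q fD z s := by
  have hfm := measurableSet_fundDomain
  have hm : MeasurableSet fullDomain := by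
    rw [fullDomain_eq]
    exact swapEquiv.measurable (measurableSet_Ico.prod hfm)
  have hwm := measurableSet_window (-(1 / 2))
  have h1 : fullZeta ε q fD z s = 1 / 2 * ∫ y in window (-(1 / 2)),
      fundDomain.indicator (fullCore ε q fD z s) y := by
    rw [fullZeta, fullIntegral, setIntegral_congr_fun hm
      fun p hp => fullIntegrand_fullKernel ε hf hc q z s hp, integral_fullDomain,
      setIntegral_indicator hfm, inter_eq_right.mpr fundDomain_subset]
  have hR : IntegrableOn (fun y : ℝ × ℝ × ℝ => (y.1 : ℂ) ^ (12 * s) * remainder ε q fD z y)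
      (window (-(1 / 2))) := by
    refine Integrable.mono' (integrableOn_remainder hf hc hsupp ε q hz (σ := s.re) (by linarith)) ?_ ?_
    · exact (Measurable.aestronglyMeasurable (by fun_prop)).mul
        (aestronglyMeasurable_remainder hf hc ε q hz)
    · refine (ae_restrict_mem hwm).mono fun y hy => ?_
      rw [norm_mul, Complex.norm_cpow_eq_rpow_re_of_pos hy.1]
      simp
  rw [h1, zetaDiff, ← integral_const_mul, ← integral_const_mul, ← integral_add
    ((integral_redConstKernel hf hc hsupp ε hq hz hs _).1.const_mul _) hR]
  refine setIntegral_congr_fun hwm fun y hy => ?_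
  have hl : 0 < y.1 := hy.1
  have ht : 0 < y.2.1 := hy.2.1
  have e : borelIntegrand (redConstKernel ε q fD z s) y = (y.1 : ℂ) ^ (12 * s) *
      (haarDensity y : ℂ) * (constTerm z y.2.1 * redSum ε q fD (borelElt y)) := by
    rw [borelIntegrand, redConstKernel, eisensteinConst, iwasawaT_borelElt hl ht,
      chiCubic_borelElt ht, pow_cpow_eq hl, haarDensity, constTerm, redSum]
    push_cast
    ring
  rw [e, remainder]
  by_cases hy' : y ∈ fundDomain
  · have h0 : y ∉ fundDomainᶜ := fun h => h hy'
    rw [indicator_of_mem hy', indicator_of_mem hy', indicator_of_notMem h0, fullCore]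
    ring
  · rw [indicator_of_notMem hy', indicator_of_notMem hy', indicator_of_mem (mem_compl hy')]
    ring

end Difference

/-! ### Functions with two simple poles -/

section TwoPoles

variable {U : Set ℂ} {g₁ g₂ : ℂ → ℂ} {a b : ℂ}

theorem analyticAt_two_poles (hU : IsOpen U) (h₁ : DifferentiableOn ℂ g₁ U)
    (h₂ : DifferentiableOn ℂ g₂ U) {s : ℂ} (hs : s ∈ U) (ha : s ≠ a) (hb : s ≠ b) :
    AnalyticAt ℂ (fun s => g₁ s / (s - a) + g₂ s / (s - b)) s :=
  ((h₁.analyticAt (hU.mem_nhds hs)).div (analyticAt_id.sub analyticAt_const) (sub_ne_zero.mpr ha)).add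
    ((h₂.analyticAt (hU.mem_nhds hs)).div (analyticAt_id.sub analyticAt_const) (sub_ne_zero.mpr hb))

theorem meromorphicOn_two_poles (hU : IsOpen U) (h₁ : DifferentiableOn ℂ g₁ U)
    (h₂ : DifferentiableOn ℂ g₂ U) :
    MeromorphicOn (fun s => g₁ s / (s - a) + g₂ s / (s - b)) U := fun _ hs =>
  ((h₁.analyticAt (hU.mem_nhds hs)).meromorphicAt.div
      (analyticAt_id.sub analyticAt_const).meromorphicAt).add
    ((h₂.analyticAt (hU.mem_nhds hs)).meromorphicAt.div
      (analyticAt_id.sub analyticAt_const).meromorphicAt)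

theorem tendsto_two_poles (hU : IsOpen U) (h₁ : DifferentiableOn ℂ g₁ U)
    (h₂ : DifferentiableOn ℂ g₂ U) (ha : a ∈ U) (hab : a ≠ b) :
    Tendsto (fun s => (s - a) * (g₁ s / (s - a) + g₂ s / (s - b))) (𝓝[≠] a) (𝓝 (g₁ a)) := by
  have c₁ : ContinuousAt g₁ a := (h₁.analyticAt (hU.mem_nhds ha)).continuousAt
  have c₂ : ContinuousAt g₂ a := (h₂.analyticAt (hU.mem_nhds ha)).continuousAt
  have hc : ContinuousAt (fun s => g₁ s + (s - a) * (g₂ s / (s - b))) a :=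
    c₁.add ((continuousAt_id.sub continuousAt_const).mul
      (c₂.div (continuousAt_id.sub continuousAt_const) (sub_ne_zero.mpr hab)))
  have h := hc.tendsto.mono_left (nhdsWithin_le_nhds (s := {a}ᶜ))
  simp only [sub_self, zero_mul, add_zero] at h
  refine h.congr' ?_
  filter_upwards [self_mem_nhdsWithin] with s hs
  have : s - a ≠ 0 := sub_ne_zero.mpr hs
  rw [mul_add, mul_div_cancel₀ _ this]

theorem meromorphicOrderAt_two_poles (hU : IsOpen U) (h₁ : DifferentiableOn ℂ g₁ U)
    (h₂ : DifferentiableOn ℂ g₂ U) (ha : a ∈ U) (hab : a ≠ b) (h0 : g₁ a ≠ 0) :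
    meromorphicOrderAt (fun s => g₁ s / (s - a) + g₂ s / (s - b)) a = ((-1 : ℤ) : WithTop ℤ) := by
  have a₁ := h₁.analyticAt (hU.mem_nhds ha)
  have a₂ := h₂.analyticAt (hU.mem_nhds ha)
  rw [meromorphicOrderAt_eq_int_iff (meromorphicOn_two_poles hU h₁ h₂ a ha)]
  refine ⟨fun s => g₁ s + (s - a) * (g₂ s / (s - b)),
    a₁.add ((analyticAt_id.sub analyticAt_const).mul
      (a₂.div (analyticAt_id.sub analyticAt_const) (sub_ne_zero.mpr hab))), by simpa using h0, ?_⟩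
  filter_upwards [self_mem_nhdsWithin] with s hs
  have : s - a ≠ 0 := sub_ne_zero.mpr hs
  rw [zpow_neg_one, smul_eq_mul, mul_add, inv_mul_cancel_left₀ this, div_eq_inv_mul]

end TwoPoles

/-! ### The residues -/

theorem besselK_neg (ν : ℂ) (x : ℝ) : besselK (-ν) x = besselK ν x := by
  rw [besselK_eq_mellin, besselK_eq_mellin, ← mellin_comp_inv]
  congr 2
  funext t
  simp only [besselExp, one_div, inv_inv]
  rw [add_comm]

/-- The power of `shapeConst` yields the power of `2` and the factor `κ_±` in the residues. -/
theorem shapeConst_cpow (ε : DiscSign) (w : ℂ) : (shapeConst ε : ℂ) ^ (-((1 + w) / 2)) =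
    2 * ((2 : ℂ) ^ ((-3 - w) / 2) * signFactor ε w) := by
  have h2 : (2 : ℂ) * (2 : ℂ) ^ ((-3 - w) / 2) = (2 : ℂ) ^ (-((1 + w) / 2)) := by
    rw [show -((1 + w) / 2) = 1 + (-3 - w) / 2 by ring, Complex.cpow_add _ _ two_ne_zero,
      Complex.cpow_one]
  rw [← mul_assoc, h2]
  cases ε
  · have e2 : (2 : ℂ) = ((2 : ℝ) : ℂ) := by norm_num
    have e3 : (3 : ℂ) = ((3 : ℝ) : ℂ) := by norm_num
    rw [shapeConst, signFactor, e2, e3, ofReal_cpow_eq_exp (by positivity),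
      ofReal_cpow_eq_exp two_pos, ofReal_cpow_eq_exp three_pos, ← Complex.exp_add,
      Real.log_div two_ne_zero (by positivity), Real.log_sqrt three_pos.le]
    congr 1
    push_cast
    ring
  · simp [shapeConst, signFactor]

/-- The residue of the zeta function of binary quadratic forms at `s₂ = 1`. -/
theorem quadZetaNum_one (ε : DiscSign) {q : ℕ} (hq : Squarefree q) (fD : ℝ → ℂ) {w : ℂ}
    (hw : w.re = 0) : 1 / 3 * quadZetaNum ε q fD (3 + w, 1) =
      residueFactor ε q fD w * ((√Real.pi : ℂ) * besselK (w / 2) 2) := by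
  rw [quadZetaNum, residueFactor, formSeries_one ε hq (by simp [hw]; norm_num)]
  simp only
  rw [show (3 + w - 2 * 1) / 2 = (1 + w) / 2 by ring, shapeConst_cpow,
    show (3 + w - 2 * 1 - 1) / 2 = w / 2 by ring, show (3 + w + 2 * 1) / 4 = (5 + w) / 4 by ring,
    show (2 : ℂ) + (3 + w) = 5 + w by ring]
  ring

theorem xi_ne_zero {s : ℂ} (hs : 1 ≤ s.re) : xi s ≠ 0 := by
  have h0 : s ≠ 0 := by
    rintro rfl
    norm_num at hs
  have h := riemannZeta_ne_zero_of_one_le_re hs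
  rw [riemannZeta_def_of_ne_zero h0] at h
  exact (div_ne_zero_iff.mp h).1

theorem xi_div_xi_ne_zero {z : ℂ} (hz : z.re = 0) : xi z / xi (1 + z) ≠ 0 := by
  have h : xi z = xi (1 - z) := (completedRiemannZeta_one_sub z).symm
  rw [h]
  exact div_ne_zero (xi_ne_zero (by simp [hz])) (xi_ne_zero (by simp [hz]))

/-- The factor at `p` does not vanish, since `p⁻² > p⁻³ + p⁻⁵`. -/
theorem eulerFactor_ne_zero {p : ℕ} (hp : 2 ≤ p) {w : ℂ} (hw : w.re = 0) :
    1 / (p : ℂ) ^ 2 + 1 / (p : ℂ) ^ (3 + w) - 1 / (p : ℂ) ^ (5 + w) ≠ 0 := by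
  intro h
  have hp0 : (0 : ℝ) < p := by positivity
  have hp2 : (2 : ℝ) ≤ p := mod_cast hp
  have h1 : 1 / (p : ℂ) ^ 2 = 1 / (p : ℂ) ^ (5 + w) - 1 / (p : ℂ) ^ (3 + w) := by
    linear_combination h
  have h2 := congrArg norm h1
  have h3 := norm_sub_le (1 / (p : ℂ) ^ (5 + w)) (1 / (p : ℂ) ^ (3 + w))
  rw [← h2] at h3
  have e5 : ‖(p : ℂ) ^ (5 + w)‖ = (p : ℝ) ^ 5 := by
    rw [← Complex.ofReal_natCast, Complex.norm_cpow_eq_rpow_re_of_pos hp0]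
    simp [hw]
  have e3 : ‖(p : ℂ) ^ (3 + w)‖ = (p : ℝ) ^ 3 := by
    rw [← Complex.ofReal_natCast, Complex.norm_cpow_eq_rpow_re_of_pos hp0]
    simp [hw]
  rw [norm_div, norm_div, norm_div, e5, e3, norm_pow, norm_one, Complex.norm_natCast] at h3
  have h4 : 1 / (p : ℝ) ^ 5 + 1 / (p : ℝ) ^ 3 = (1 + (p : ℝ) ^ 2) / p ^ 5 := by field_simp
  have h5 : 1 / (p : ℝ) ^ 2 = (p : ℝ) ^ 3 / p ^ 5 := by field_simp
  rw [h4, h5, div_le_div_iff_of_pos_right (by positivity)] at h3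
  nlinarith

/-- A residue vanishes only if the Bessel value `κ` or the Mellin transform does, since `ζ(3 + w)`
and the Euler factors are nonzero. -/
theorem residue_ne_zero (ε : DiscSign) (q : ℕ) {fD : ℝ → ℂ} {w κ : ℂ} (hw : w.re = 0) (hκ : κ ≠ 0)
    (hm : mellin fD ((5 + w) / 4) ≠ 0) : residueFactor ε q fD w * ((√Real.pi : ℂ) * κ) ≠ 0 := by
  have hπ : (√Real.pi : ℂ) ≠ 0 := by
    exact_mod_cast (Real.sqrt_pos.mpr Real.pi_pos).ne'
  have hζ : riemannZeta (3 + w) ≠ 0 := riemannZeta_ne_zero_of_one_le_re (by simp [hw])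
  have h2 : (2 : ℂ) ^ ((-3 - w) / 2) ≠ 0 := by simp [Complex.cpow_eq_zero_iff]
  have hs : signFactor ε w ≠ 0 := by
    cases ε <;> simp [signFactor, Complex.cpow_eq_zero_iff]
  have hprod : (∏ p ∈ q.primeFactors,
      (1 / (p : ℂ) ^ 2 + 1 / (p : ℂ) ^ (3 + w) - 1 / (p : ℂ) ^ (5 + w))) ≠ 0 :=
    Finset.prod_ne_zero_iff.mpr fun p hp =>
      eulerFactor_ne_zero (Nat.prime_of_mem_primeFactors hp).two_le hw
  rw [residueFactor]
  refine mul_ne_zero (mul_ne_zero (mul_ne_zero (mul_ne_zero (mul_ne_zero (mul_ne_zero (by norm_num) hζ)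
    h2) hs) hprod) hm) (mul_ne_zero hπ hκ)

end ReducibleZeta

end

theorem mainTheorem3 (ε : DiscSign) (q : ℕ) (hq : Squarefree q) (z : ℂ) (hz : z.re = 0) (hz0 : z ≠ 0)
    (fD : ℝ → ℂ) (hsmooth : ContDiff ℝ ∞ fD) (hcompact : HasCompactSupport fD)
    (hsupp : tsupport fD ⊆ Ioi 0) :
    -- the integrals that define the zeta functions converge absolutely
    (∀ s : ℂ, 5 / 4 < s.re → BorelIntegrable (redConstKernel ε q fD z s)) ∧
    (∀ s₁ s₂ : ℂ, 2 < s₁.re → 1 < s₂.re → BorelIntegrable (quadKernel q (testFunRed ε fD) s₁ s₂)) ∧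
    (∀ s : ℂ, 5 / 4 < s.re → FullIntegrable (fullKernel ε q fD z s)) ∧
    ∃ (F : ℂ → ℂ) (W h : ℂ × ℂ → ℂ),
      -- `F` is the meromorphic continuation of the reducible constant-term zeta function
      (∀ s : ℂ, 5 / 4 < s.re → F s = redConstZeta ε q fD z s) ∧
      MeromorphicOn F {s | 3 / 4 < s.re} ∧
      (∀ s : ℂ, 3 / 4 < s.re → s ≠ (5 + z) / 4 → s ≠ (5 - z) / 4 → AnalyticAt ℂ F s) ∧
      -- it has simple poles at `(5 ± z) / 4`, with explicit residues
      Tendsto (fun s => (s - (5 + z) / 4) * F s) (𝓝[≠] ((5 + z) / 4))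
        (𝓝 (residueFactor ε q fD z * ((√Real.pi : ℂ) * besselK (z / 2) 2))) ∧
      Tendsto (fun s => (s - (5 - z) / 4) * F s) (𝓝[≠] ((5 - z) / 4))
        (𝓝 (xi z / xi (1 + z) * residueFactor ε q fD (-z) *
          ((√Real.pi : ℂ) * besselK (z / 2) 2))) ∧
      (besselK (z / 2) 2 ≠ 0 → mellin fD ((5 + z) / 4) ≠ 0 →
        meromorphicOrderAt F ((5 + z) / 4) = ((-1 : ℤ) : WithTop ℤ)) ∧
      (besselK (z / 2) 2 ≠ 0 → mellin fD ((5 - z) / 4) ≠ 0 →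
        meromorphicOrderAt F ((5 - z) / 4) = ((-1 : ℤ) : WithTop ℤ)) ∧
      -- `W` is the meromorphic continuation of the zeta function of binary quadratic forms
      (∀ s₁ s₂ : ℂ, 2 < s₁.re → 1 < s₂.re →
        W (s₁, s₂) = quadZeta q (testFunRed ε fD) s₁ s₂) ∧
      DifferentiableOn ℂ h {p | 2 < p.1.re ∧ 1 / 2 < p.2.re} ∧
      (∀ s₁ s₂ : ℂ, 2 < s₁.re → 1 / 2 < s₂.re → s₂ ≠ 1 → W (s₁, s₂) = h (s₁, s₂) / (s₂ - 1)) ∧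
      -- the representation of `F` through `W`
      (∀ s : ℂ, 3 / 4 < s.re → s ≠ (5 + z) / 4 → s ≠ (5 - z) / 4 →
        F s = 1 / 3 * (W (2 * s + 1 / 2 + z / 2, s - 1 / 4 - z / 4) +
          xi z / xi (1 + z) * W (2 * s + 1 / 2 - z / 2, s - 1 / 4 + z / 4))) ∧
      -- the zeta function of all forms has the same poles and residues at `(5 ± z) / 4`, and they cancel
      ∃ (I H : ℂ → ℂ),
        (∀ s : ℂ, 5 / 4 < s.re → I s = fullZeta ε q fD z s) ∧
        MeromorphicOn I {s | 1 < s.re} ∧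
        (∀ s : ℂ, 1 < s.re → s ≠ (5 + z) / 4 → s ≠ (5 - z) / 4 → AnalyticAt ℂ I s) ∧
        Tendsto (fun s => (s - (5 + z) / 4) * I s) (𝓝[≠] ((5 + z) / 4))
          (𝓝 (residueFactor ε q fD z * ((√Real.pi : ℂ) * besselK (z / 2) 2))) ∧
        Tendsto (fun s => (s - (5 - z) / 4) * I s) (𝓝[≠] ((5 - z) / 4))
          (𝓝 (xi z / xi (1 + z) * residueFactor ε q fD (-z) *
            ((√Real.pi : ℂ) * besselK (z / 2) 2))) ∧
        DifferentiableOn ℂ H {s | 1 < s.re} ∧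
        (∀ s : ℂ, 1 < s.re → s ≠ (5 + z) / 4 → s ≠ (5 - z) / 4 → I s - F s = H s) := by
  have hf := hsmooth.continuous
  have hq0 := hq.ne_zero
  set c := xi z / xi (1 + z) with hc
  set U : Set ℂ := {s | 3 / 4 < s.re} with hUdef
  have hU : IsOpen U := isOpen_lt continuous_const Complex.continuous_re
  set V : Set ℂ := {s | 1 < s.re} with hVdef
  have hV : IsOpen V := isOpen_lt continuous_const Complex.continuous_re
  have hVU : V ⊆ U := fun s (hs : 1 < s.re) => show 3 / 4 < s.re by linarith
  have haV : (5 + z) / 4 ∈ V := by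
    change 1 < ((5 + z) / 4).re
    simp [hz]
    norm_num
  have hbV : (5 - z) / 4 ∈ V := by
    change 1 < ((5 - z) / 4).re
    simp [hz]
    norm_num
  have hab : (5 + z) / 4 ≠ (5 - z) / 4 := by
    intro h
    apply hz0
    linear_combination 2 * h
  set h := quadZetaNum ε q fD with hh
  have hdiff := differentiableOn_quadZetaNum hf hcompact hsupp ε q
  -- the two specializations of `quadZetaNum` are the numerators at the two poles
  set g₁ : ℂ → ℂ := fun s => 1 / 3 * h (2 * s + 1 / 2 + z / 2, s - 1 / 4 - z / 4) with hg₁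
  set g₂ : ℂ → ℂ := fun s => c * (1 / 3 * h (2 * s + 1 / 2 - z / 2, s - 1 / 4 + z / 4)) with hg₂
  have d₁ : DifferentiableOn ℂ g₁ U := by
    refine (hdiff.comp (t := _) (f := fun s : ℂ => (2 * s + 1 / 2 + z / 2, s - 1 / 4 - z / 4))
      (by fun_prop) fun s (hs : 3 / 4 < s.re) => ?_).const_mul _
    constructor <;> simp [hz] <;> linarith
  have d₂ : DifferentiableOn ℂ g₂ U := by
    refine ((hdiff.comp (t := _) (f := fun s : ℂ => (2 * s + 1 / 2 - z / 2, s - 1 / 4 + z / 4))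
      (by fun_prop) fun s (hs : 3 / 4 < s.re) => ?_).const_mul _).const_mul _
    constructor <;> simp [hz] <;> linarith
  have dH := differentiableOn_zetaDiff hf hcompact hsupp ε q hz
  set H := zetaDiff ε q fD z with hH
  set F : ℂ → ℂ := fun s => g₁ s / (s - (5 + z) / 4) + g₂ s / (s - (5 - z) / 4) with hF
  set W : ℂ × ℂ → ℂ := fun p => h p / (p.2 - 1) with hW
  have hFW : ∀ s, F s = 1 / 3 * (W (2 * s + 1 / 2 + z / 2, s - 1 / 4 - z / 4) +
      c * W (2 * s + 1 / 2 - z / 2, s - 1 / 4 + z / 4)) := by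
    intro s
    simp only [hF, hg₁, hg₂, hW]
    rw [show s - 1 / 4 - z / 4 - 1 = s - (5 + z) / 4 by ring,
      show s - 1 / 4 + z / 4 - 1 = s - (5 - z) / 4 by ring]
    ring
  have r₁ : g₁ ((5 + z) / 4) = residueFactor ε q fD z * ((√Real.pi : ℂ) * besselK (z / 2) 2) := by
    rw [← quadZetaNum_one ε hq fD hz]
    simp only [hg₁]
    congr 3 <;> ring
  have r₂ : g₂ ((5 - z) / 4) = c * residueFactor ε q fD (-z) *
      ((√Real.pi : ℂ) * besselK (z / 2) 2) := by
    have e := quadZetaNum_one ε hq fD (w := -z) (by simp [hz])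
    rw [neg_div, besselK_neg] at e
    rw [mul_assoc, ← e]
    simp only [hg₂]
    congr 4 <;> ring
  have hFcomm : F = fun s => g₂ s / (s - (5 - z) / 4) + g₁ s / (s - (5 + z) / 4) := by
    funext s
    exact add_comm _ _
  have t₁ : Tendsto (fun s => (s - (5 + z) / 4) * F s) (𝓝[≠] ((5 + z) / 4))
      (𝓝 (residueFactor ε q fD z * ((√Real.pi : ℂ) * besselK (z / 2) 2))) := by
    rw [← r₁]
    exact tendsto_two_poles hU d₁ d₂ (hVU haV) hab
  have t₂ : Tendsto (fun s => (s - (5 - z) / 4) * F s) (𝓝[≠] ((5 - z) / 4))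
      (𝓝 (c * residueFactor ε q fD (-z) * ((√Real.pi : ℂ) * besselK (z / 2) 2))) := by
    rw [← r₂, hFcomm]
    exact tendsto_two_poles hU d₂ d₁ (hVU hbV) hab.symm
  -- a holomorphic summand does not change the residues
  have tH : ∀ a ∈ V, Tendsto (fun s => (s - a) * H s) (𝓝[≠] a) (𝓝 0) := by
    intro a ha
    have hcont : ContinuousAt (fun s => (s - a) * H s) a :=
      (continuousAt_id.sub continuousAt_const).mul (dH.analyticAt (hV.mem_nhds ha)).continuousAt
    simpa using hcont.tendsto.mono_left (nhdsWithin_le_nhds (s := {a}ᶜ))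
  have hval : ∀ s : ℂ, 5 / 4 < s.re → ∀ v₀, 1 / 2 * (∫ y in window v₀,
      borelIntegrand (redConstKernel ε q fD z s) y) = F s := by
    intro s hs v₀
    rw [(integral_redConstKernel hf hcompact hsupp ε hq0 hz hs v₀).2, hFW]
  refine ⟨fun s hs => ?_, fun s₁ s₂ h₁ h₂ => borelIntegrable_quadKernel hf hcompact hsupp ε hq0 h₁ h₂,
    fun s hs => fullIntegrable_fullKernel hf hcompact hsupp ε q hz hs, F, W, h, fun s hs => ?_,
    meromorphicOn_two_poles hU d₁ d₂, fun s hs ha hb => analyticAt_two_poles hU d₁ d₂ hs ha hb, t₁, t₂,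
    fun hK hm => meromorphicOrderAt_two_poles hU d₁ d₂ (hVU haV) hab ?_, fun hK hm => ?_,
    fun s₁ s₂ h₁ h₂ => (quadZeta_eq hf hcompact hsupp ε hq0 h₁ h₂).symm, hdiff, fun _ _ _ _ _ => rfl,
    fun s _ _ _ => hFW s, fun s => F s + H s, H, fun s hs => ?_, ?_, fun s hs ha hb => ?_, ?_, ?_, dH,
    fun s _ _ _ => add_sub_cancel_left _ _⟩
  · have := (integral_redConstKernel hf hcompact hsupp ε hq0 hz hs 0).1
    rwa [window_zero] at this
  · rw [← hval s hs 0, window_zero]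
    rfl
  · rw [r₁]
    exact residue_ne_zero ε q hz hK hm
  · rw [hFcomm]
    refine meromorphicOrderAt_two_poles hU d₂ d₁ (hVU hbV) hab.symm ?_
    rw [r₂, mul_assoc]
    exact mul_ne_zero (xi_div_xi_ne_zero hz) (residue_ne_zero ε q (by simp [hz]) hK
      (by rwa [← sub_eq_add_neg]))
  · rw [fullZeta_eq hf hcompact hsupp ε hq0 hz hs, hval s hs]
  · exact fun s hs => (meromorphicOn_two_poles hU d₁ d₂ s (hVU hs)).add
      (dH.analyticAt (hV.mem_nhds hs)).meromorphicAt
  · exact (analyticAt_two_poles hU d₁ d₂ (hVU hs) ha hb).add (dH.analyticAt (hV.mem_nhds hs))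
  · simpa [mul_add] using t₁.add (tH _ haV)
  · simpa [mul_add] using t₂.add (tH _ hbV)
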